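/- Let $M$ be a smooth $8$-manifold with a $Spin(7)$-structure, i.e. a $4$-form $\Phi$ together with the Riemannian metric $g$ and the orientation it determines, such that near every point there is a smooth oriented orthonormal frame $e_0,\dots,e_7$ (with dual coframe denoted by the same letters) in which $$\Phi=-e_{0127}+e_{0236}-e_{0347}-e_{0567}+e_{0146}+e_{0245}-e_{0135}-e_{3456}-e_{1457}-e_{1256}-e_{1234}-e_{2357}-e_{1367}+e_{2467}.$$ Let $\delta=-*d*$ be the codifferential and let $\theta$ be the Lee form, $\theta_a=\frac1{42}(\delta\Phi)_{ijk}\Phi_{ijka}$; components are taken in an orthonormal frame and repeated indices are summed. Let $\nabla$ be the $Spin(7)$-torsion connection, i.e. the linear connection with $\nabla g=0$, $\nabla\Phi=0$ and totally skew-symmetric torsion $T(X,Y,Z)=g(\nabla_XY-\nabla_YX-[X,Y],Z)$; let $R(X,Y)Z=[\nabla_X,\nabla_Y]Z-\nabla_{[X,Y]}Z$ be its curvature, $Ric(X,Y)=\sum_a g(R(e_a,X)Y,e_a)$ its Ricci tensor, and put $d^\nabla\theta(X,Y)=(\nabla_X\theta)Y-(\nabla_Y\theta)X$. Then the following three conditions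 are equivalent: (a) the Ricci tensor is symmetric, $Ric(X,Y)=Ric(Y,X)$; (b) $(d^\nabla\theta)_{ij}=-\frac13\theta_s(\delta\Phi)_{sij}+\frac16\theta_s(\delta\Phi)_{sab}\Phi_{abij}$; (c) $(d^\nabla\theta)_{ij}=-\frac13\theta_sT_{sij}+\frac16\theta_sT_{sab}\Phi_{abij}$. If they hold, then also $(d^\nabla\theta)_{ij}=-\frac16(d^\nabla\theta)_{ab}\Phi_{abij}$; in particular $d^\nabla\theta$ is a section of $\Lambda^2_7=\{\beta\in\Lambda^2 : *(\beta\wedge\Phi)=-3\beta\}$. -/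

import Mathlib

open Bundle VectorField FiberBundle
open scoped Manifold ContDiff Nat

noncomputable section

namespace Spin7

/-- The model space `ℝ⁸`. -/
abbrev E8 : Type := EuclideanSpace ℝ (Fin 8)

/-- The model with corners of an 8-manifold without boundary. -/
abbrev I8 : ModelWithCorners ℝ E8 E8 := 𝓘(ℝ, E8)

/-- The tangent space `T_x M`. -/
abbrev TM {M : Type*} [TopologicalSpace M] [ChartedSpace E8 M] (x : M) : Type :=
  TangentSpace I8 x

/-! ### The standard 4-form on `ℝ⁸` -/

/-- The component `(e_q)(e_{i 0}, e_{i 1}, e_{i 2}, e_{i 3})` of the decomposable form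
`e_q = e_{q 0} ∧ e_{q 1} ∧ e_{q 2} ∧ e_{q 3}`. -/
def elem4 (q i : Fin 4 → Fin 8) : ℤ :=
  Matrix.det (Matrix.of fun a b : Fin 4 => if i a = q b then (1 : ℤ) else 0)

/-- The components `Φ_{i 0, i 1, i 2, i 3}` of the standard `Spin(7)`-form on `ℝ⁸`:
`- e₀₁₂₇ + e₀₂₃₆ - e₀₃₄₇ - e₀₅₆₇ + e₀₁₄₆ + e₀₂₄₅ - e₀₁₃₅`
`- e₃₄₅₆ - e₁₄₅₇ - e₁₂₅₆ - e₁₂₃₄ - e₂₃₅₇ - e₁₃₆₇ + e₂₄₆₇`. -/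
def stdPhi (i : Fin 4 → Fin 8) : ℤ :=
  - elem4 ![0, 1, 2, 7] i + elem4 ![0, 2, 3, 6] i - elem4 ![0, 3, 4, 7] i
  - elem4 ![0, 5, 6, 7] i + elem4 ![0, 1, 4, 6] i + elem4 ![0, 2, 4, 5] i
  - elem4 ![0, 1, 3, 5] i - elem4 ![3, 4, 5, 6] i - elem4 ![1, 4, 5, 7] i
  - elem4 ![1, 2, 5, 6] i - elem4 ![1, 2, 3, 4] i - elem4 ![2, 3, 5, 7] i
  - elem4 ![1, 3, 6, 7] i + elem4 ![2, 4, 6, 7] i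

theorem finrank_TM {M : Type*} [TopologicalSpace M] [ChartedSpace E8 M] (x : M) :
    Module.finrank ℝ (TM x) = 8 := by
  change Module.finrank ℝ E8 = 8
  simp

instance {M : Type*} [TopologicalSpace M] [ChartedSpace E8 M] (x : M) :
    FiniteDimensional ℝ (TM x) :=
  Module.finite_of_finrank_pos (by rw [finrank_TM]; norm_num)

section Manifold

variable {M : Type*} [TopologicalSpace M] [ChartedSpace E8 M] [IsManifold I8 ∞ M]

/-- Covariant `k`-tensor fields, as functions of `k` tangent vectors. The operators below are
only applied to `k`-forms, i.e. to fields of alternating multilinear maps. -/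
abbrev Field (k : ℕ) (M : Type*) [TopologicalSpace M] [ChartedSpace E8 M] : Type _ :=
  (x : M) → (Fin k → TM x) → ℝ

/-- A vector field on a neighbourhood of `x` that is smooth there and extends `v ∈ T_x M`. The
operators below are tensorial, so that the extension used in them is immaterial. -/
abbrev extV {x : M} (v : TM x) (y : M) : TM y := FiberBundle.extend E8 v y

/-- The exterior derivative,
`dη(V₀,…,V_{n+1}) = ∑ᵢ (-1)ⁱ Vᵢ(η(…,V̂ᵢ,…)) + ∑_{i<j} (-1)^{i+j} η([Vᵢ,Vⱼ],…,V̂ᵢ,…,V̂ⱼ,…)`.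
The pair `(i, j)`, `i ≤ j`, of the last sum stands for the pair of positions `i < j + 1`, whence
the minus sign. -/
def extD {n : ℕ} (η : Field (n + 1) M) : Field (n + 2) M := fun x v =>
  (∑ i : Fin (n + 2), (-1 : ℝ) ^ (i : ℕ) *
      mvfderiv I8 (fun y => η y (i.removeNth fun a => extV (v a) y)) x (v i)) -
    ∑ i : Fin (n + 1), ∑ j ≥ i, (-1 : ℝ) ^ ((i : ℕ) + (j : ℕ)) *
      η x (Matrix.vecCons (mlieBracket I8 (extV (v i.castSucc)) (extV (v j.succ)) x)
        (j.removeNth (i.castSucc.removeNth v)))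

/-- The wedge product (without numerical factors on decomposable forms). -/
def wedge {p q : ℕ} (α : Field p M) (β : Field q M) : Field (p + q) M := fun x v =>
  (1 / ((p ! : ℝ) * (q ! : ℝ))) * ∑ σ : Equiv.Perm (Fin (p + q)),
    ((Equiv.Perm.sign σ : ℤ) : ℝ) *
      α x (fun a => v (σ (Fin.castAdd q a))) * β x (fun b => v (σ (Fin.natAdd p b)))

variable [RiemannianBundle (fun x : M => TangentSpace I8 x)]

/-- An orthonormal basis of `T_x M`. Every contraction below is independent of it. -/
def onb (x : M) : OrthonormalBasis (Fin 8) ℝ (TM x) :=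
  (stdOrthonormalBasis ℝ (TM x)).reindex (finCongr (finrank_TM x))

/-- The vectors `e_{i 0}, e_{i 1}, …` of the orthonormal basis. -/
def frame (x : M) {k : ℕ} (i : Fin k → Fin 8) : Fin k → TM x := fun a => onb x (i a)

/-- A `Spin(7)`-structure on a Riemannian 8-manifold: the fundamental 4-form `Φ` and the volume
form of the orientation, such that near every point there is a smooth oriented orthonormal frame
in which `Φ` has the standard components (a local section of the reduced frame bundle). Both the
metric and the volume form are thereby those determined by `Φ`. -/
structure Structure (M : Type*) [TopologicalSpace M] [ChartedSpace E8 M] [IsManifold I8 ∞ M]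
    [RiemannianBundle (fun x : M => TangentSpace I8 x)] where
  /-- the fundamental form -/
  Phi : (x : M) → (TM x) [⋀^Fin 4]→L[ℝ] ℝ
  /-- the volume form -/
  vol : (x : M) → (TM x) [⋀^Fin 8]→L[ℝ] ℝ
  exists_frame : ∀ x : M, ∃ U : Set M, IsOpen U ∧ x ∈ U ∧
    ∃ e : Fin 8 → (y : M) → TangentSpace I8 y,
      (∀ i, ContMDiffOn I8 I8.tangent ∞ (fun y => (⟨y, e i y⟩ : TangentBundle I8 M)) U) ∧
      ∀ y ∈ U, Orthonormal ℝ (fun i => e i y) ∧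
        vol y (fun i => e i y) = 1 ∧
        ∀ i : Fin 4 → Fin 8, Phi y (fun a => e (i a) y) = (stdPhi i : ℝ)

namespace Structure

variable (S : Structure M)

/-- The fundamental form as a tensor field. -/
def phi : Field 4 M := fun x v => S.Phi x v

/-- The Hodge star on `k`-forms, normalized by `α ∧ *β = ⟨α, β⟩ vol`:
`(*η)(v) = (1/k!) ∑_I η(e_I) vol(e_I, v)`. -/
def star {k m : ℕ} (h : k + m = 8) (η : Field k M) : Field m M := fun x v =>
  (1 / (k ! : ℝ)) * ∑ i : Fin k → Fin 8,
    η x (frame x i) * S.vol x (fun a => Fin.append (frame x i) v (Fin.cast h.symm a))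

/-- The codifferential `δ = - * d *` on `(k+1)`-forms. -/
def codiff {k m : ℕ} (h : k + m = 6) (η : Field (k + 1) M) : Field k M := fun x v =>
  - S.star (k := m + 2) (m := k) (by omega)
      (extD (n := m) (S.star (k := k + 1) (m := m + 1) (by omega) η)) x v

/-- The 3-form `δΦ`. -/
def deltaPhi : Field 3 M := S.codiff (k := 3) (m := 3) (by norm_num) S.phi

/-- The Lee form `θ_a = (1/42) (δΦ)_{ijk} Φ_{ijka}`. -/
def lee : Field 1 M := fun x w =>
  (1 / 42 : ℝ) * ∑ i : Fin 3 → Fin 8, S.deltaPhi x (frame x i) *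
    S.phi x ![onb x (i 0), onb x (i 1), onb x (i 2), w 0]

/-- `β_{ab} Φ_{abij}` for a 2-form `β`. -/
def contrPhi (β : Field 2 M) : Field 2 M := fun x v =>
  ∑ a : Fin 8, ∑ b : Fin 8, β x ![onb x a, onb x b] * S.phi x ![onb x a, onb x b, v 0, v 1]

/-- `θ_s γ_{sij}` for a 3-form `γ`. -/
def leeContr (γ : Field 3 M) : Field 2 M := fun x v =>
  ∑ s : Fin 8, S.lee x ![onb x s] * γ x ![onb x s, v 0, v 1]

/-- The space `Λ²₇ = {β ∈ Λ² | *(β ∧ Φ) = -3 β}`. -/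
def MemLambda27 (β : Field 2 M) : Prop :=
  (∀ x : M, ∃ b : (TM x) [⋀^Fin 2]→L[ℝ] ℝ, β x = b) ∧
  ∀ (x : M) (v : Fin 2 → TM x),
    S.star (k := 2 + 4) (m := 2) (by norm_num) (wedge β S.phi) x v = -3 * β x v

end Structure

/-! ### Linear connections -/

/-- Linear connections on `M`; `∇_X Y` at `x` is `D Y x (X x)`. -/
abbrev Connection (M : Type*) [TopologicalSpace M] [ChartedSpace E8 M] [IsManifold I8 ∞ M] :=
  CovariantDerivative I8 E8 (fun x : M => TangentSpace I8 x)

variable (D : Connection M)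

/-- The torsion as a covariant tensor, `T(X,Y,Z) = g(∇_X Y - ∇_Y X - [X,Y], Z)`. -/
def torsionForm : Field 3 M := fun x v => inner ℝ (D.torsion x (v 0) (v 1)) (v 2)

/-- The curvature `R(X,Y)Z = ∇_X ∇_Y Z - ∇_Y ∇_X Z - ∇_{[X,Y]} Z` on vector fields. -/
def curvatureFields (X Y Z : (y : M) → TM y) (x : M) : TM x :=
  D (fun y => D Z y (Y y)) x (X x) - D (fun y => D Z y (X y)) x (Y x) -
    D Z x (mlieBracket I8 X Y x)

/-- The curvature tensor `R(u,v)w`. -/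
def curvature (x : M) (u v w : TM x) : TM x :=
  curvatureFields D (extV u) (extV v) (extV w) x

/-- The Ricci tensor `Ric(u,v) = ∑ₐ g(R(eₐ,u)v, eₐ)`. -/
def ricci (x : M) (u v : TM x) : ℝ :=
  ∑ a : Fin 8, inner ℝ (curvature D x (onb x a) u v) (onb x a)

/-- The covariant derivative `(∇_u θ)(v)` of a 1-form. -/
def nablaForm (θ : Field 1 M) (x : M) (u v : TM x) : ℝ :=
  mvfderiv I8 (fun y => θ y ![extV v y]) x u - θ x ![D (extV v) x u]

/-- `d^∇θ(X,Y) = (∇_X θ)Y - (∇_Y θ)X`. -/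
def dNabla (θ : Field 1 M) : Field 2 M := fun x v =>
  nablaForm D θ x (v 0) (v 1) - nablaForm D θ x (v 1) (v 0)

/-- A smooth metric is of class `C¹`. -/
instance instRiemannianOne
    [IsContMDiffRiemannianBundle I8 ∞ E8 (fun x : M => TangentSpace I8 x)] :
    IsContMDiffRiemannianBundle I8 1 E8 (fun x : M => TangentSpace I8 x) :=
  IsContMDiffRiemannianBundle.of_le (n := ∞) (by simp)

/-- A `Spin(7)`-torsion connection: a smooth linear connection with `∇g = 0`, `∇Φ = 0` and
totally skew-symmetric torsion. -/
structure Structure.IsTorsionConnection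
    [IsContMDiffRiemannianBundle I8 ∞ E8 (fun x : M => TangentSpace I8 x)]
    (S : Structure M) (D : Connection M) : Prop where
  smooth : CovariantDerivative.ContMDiffCovariantDerivative D ∞
  metric : D.IsMetricCompatible
  parallel : ∀ (x : M) (Y : Fin 4 → (y : M) → TangentSpace I8 y),
    (∀ i, MDifferentiableAt I8 I8.tangent (fun y => (⟨y, Y i y⟩ : TangentBundle I8 M)) x) → ∀ u : TM x,
      mvfderiv I8 (fun y => S.phi y (fun i => Y i y)) x u =
        ∑ i, S.phi x (Function.update (fun j => Y j x) i (D (Y i) x u))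
  skew : ∀ (x : M) (u v w : TM x), torsionForm D x ![u, v, w] = - torsionForm D x ![u, w, v]

end Manifold

end Spin7

end

set_option linter.unusedSectionVars false

noncomputable section

namespace Spin7

/-! ### Identities for the standard 4-form -/

/-! The argument is pointwise tensor algebra in an arbitrary orthonormal basis. Let A be the
operator `opPhi` on 2-forms, (Aβ)_{ij} = β_{ab} Φ_{abij}, let τ_s = T_{abc} Φ_{abcs}, and let V_{uv}
= (∇_a T)_{auv} be the divergence of the torsion. The single algebraic input about Φ is the value of
Φ_{ijkp} Φ_{abcp}, a finite check on the standard form. Its traces give A² = 12 - 4A, so A has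
eigenvalues 2 on Λ²₂₁ and -6 on Λ²₇. Contracted with a 3-form it gives `IsSpinArray.contr₂_cyc`,
which expresses the cyclic sum of T_{abi} Φ_{abjk} through T and τ.

Geometrically, the first Bianchi identity for skew torsion shows that Ric(u,v) - Ric(v,u) = V_{uv},
so symmetry of Ric means V = 0. Since ∇Φ = 0, the curvature endomorphisms lie in Λ²₂₁, hence
Ric_{uv} = ½ R_{uajs} Φ_{ajsv}. The Bianchi identity rewrites this in terms of ∇T and T alone
(`IsCurvatureArray.ricci_eq`). Its skew part, simplified by the cyclic identity for T and for ∇_a T,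
gives `IsCurvatureArray.divV_relation`: (2 + A)V = (1 - A/6)W + (2/3 - A/3)X, where W is the skew
part of ∇τ and X_{uv} = τ_s T_{suv}. On Λ²₇ this reads -4V = 2W + (8/3)X, on Λ²₂₁ it reads 4V =
(2/3)W. Thus V = 0 exactly when W = -(1/3)X + (1/6)AX, and then W = (1/6)(A - 2)X lies in the
eigenspace -6, that is, in Λ²₇.

Translation to the Lee form: dΦ is a contraction of T with Φ because ∇Φ = 0, and Φ is self-dual, so
δΦ = T + (1/6) τ_s Φ_{s···} and θ = -τ/7. Consequently W and X are -7 times d^∇θ and θ ⌟ T. The two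
right-hand sides, with δΦ and with T, coincide because τ_s τ_t Φ_{ts··} = 0.

The analytic work consists of differentiating tensors along fields with constant coordinates in a
chart. These commute near the base point, so bracket terms disappear and second derivatives of
functions are symmetric. -/

theorem eq_sign_mul_of_adjacent_swap {α : Type*} {n : ℕ} {F : (Fin (n + 1) → α) → ℤ}
    (h : ∀ (k : Fin n) i, F (i ∘ Equiv.swap k.castSucc k.succ) = -F i)
    (σ : Equiv.Perm (Fin (n + 1))) (i : Fin (n + 1) → α) :
    F (i ∘ σ) = (Equiv.Perm.sign σ : ℤ) * F i := by
  have hσ : σ ∈ Submonoid.closure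
      (Set.range fun k : Fin n ↦ Equiv.swap k.castSucc k.succ) := by
    rw [Equiv.Perm.mclosure_swap_castSucc_succ]; trivial
  induction hσ using Submonoid.closure_induction generalizing i with
  | mem τ hτ =>
    obtain ⟨k, rfl⟩ := hτ
    rw [h, Equiv.Perm.sign_swap (Fin.castSucc_lt_succ).ne]
    simp
  | one => simp
  | mul σ τ _ _ hσ hτ =>
    have := hτ (i ∘ σ)
    rw [Function.comp_assoc] at this
    rw [Equiv.Perm.coe_mul, this, hσ]
    simp only [Equiv.Perm.sign_mul, Units.val_mul]
    ring

theorem eq_zero_of_not_injective {α : Type*} {n : ℕ} {F : (Fin (n + 1) → α) → ℤ}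
    (h : ∀ (k : Fin n) i, F (i ∘ Equiv.swap k.castSucc k.succ) = -F i)
    {i : Fin (n + 1) → α} (hi : ¬ Function.Injective i) : F i = 0 := by
  rw [Function.Injective] at hi
  push Not at hi
  obtain ⟨a, b, hab, hne⟩ := hi
  have h1 := eq_sign_mul_of_adjacent_swap h (Equiv.swap a b) i
  have h2 : i ∘ Equiv.swap a b = i := by
    funext c
    simp only [Function.comp_apply]
    rcases eq_or_ne c a with rfl | hca
    · simp [hab]
    rcases eq_or_ne c b with rfl | hcb
    · simp [hab]
    · rw [Equiv.swap_apply_of_ne_of_ne hca hcb]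
  rw [h2, Equiv.Perm.sign_swap hne] at h1
  simp at h1
  omega

/-- An alternating array vanishes if its entries with increasing indices do. -/
theorem eq_zero_of_adjacent_swap {α : Type*} [LinearOrder α] {n : ℕ}
    {F : (Fin (n + 1) → α) → ℤ}
    (h : ∀ (k : Fin n) i, F (i ∘ Equiv.swap k.castSucc k.succ) = -F i)
    (h0 : ∀ i, StrictMono i → F i = 0) (i : Fin (n + 1) → α) : F i = 0 := by
  have key := eq_sign_mul_of_adjacent_swap h (Tuple.sort i) i
  have hm := Tuple.monotone_sort i
  by_cases hinj : Function.Injective (i ∘ Tuple.sort i)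
  · rw [h0 _ (hm.strictMono_of_injective hinj)] at key
    rcases mul_eq_zero.1 key.symm with h1 | h1
    · simp at h1
    · exact h1
  · rw [eq_zero_of_not_injective h hinj] at key
    rcases mul_eq_zero.1 key.symm with h1 | h1
    · simp at h1
    · exact h1

theorem elem4_comp_perm (q i : Fin 4 → Fin 8) (σ : Equiv.Perm (Fin 4)) :
    elem4 q (i ∘ σ) = (Equiv.Perm.sign σ : ℤ) * elem4 q i :=
  Matrix.det_permute σ (Matrix.of fun a b : Fin 4 => if i a = q b then (1 : ℤ) else 0)

theorem stdPhi_comp_perm (i : Fin 4 → Fin 8) (σ : Equiv.Perm (Fin 4)) :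
    stdPhi (i ∘ σ) = (Equiv.Perm.sign σ : ℤ) * stdPhi i := by
  simp only [stdPhi, elem4_comp_perm]
  ring

/-- The sign of `b - a`. -/
def ordSign (a b : Fin 8) : ℤ := bif Nat.blt a b then 1 else bif Nat.blt b a then -1 else 0

theorem ordSign_eq (a b : Fin 8) :
    ordSign a b = if a < b then 1 else if b < a then -1 else 0 := by
  simp [ordSign, Bool.cond_eq_ite]

theorem ordSign_swap (a b : Fin 8) : ordSign b a = -ordSign a b := by
  simp only [ordSign_eq]
  rcases lt_trichotomy a b with h | h | h
  · simp [h, h.not_gt]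
  · simp [h]
  · simp [h, h.not_gt]

/-- The coefficient of the standard form on a set of indices, given by its bit mask. -/
def phiCoeff (m : ℕ) : ℤ :=
  bif Nat.beq m 135 then -1 else bif Nat.beq m 77 then 1 else bif Nat.beq m 153 then -1 else
  bif Nat.beq m 225 then -1 else bif Nat.beq m 83 then 1 else bif Nat.beq m 53 then 1 else
  bif Nat.beq m 43 then -1 else bif Nat.beq m 120 then -1 else bif Nat.beq m 178 then -1 else
  bif Nat.beq m 102 then -1 else bif Nat.beq m 30 then -1 else bif Nat.beq m 172 then -1 else
  bif Nat.beq m 202 then -1 else bif Nat.beq m 212 then 1 else 0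

/-- A form of the standard components suited to evaluation. -/
def phiTab (i j k l : Fin 8) : ℤ :=
  -- With a repeated index the mask no longer encodes the index set, but then one of the six signs
  -- is zero.
  ordSign i j * ordSign i k * ordSign i l * ordSign j k * ordSign j l * ordSign k l *
    phiCoeff (2 ^ (i : ℕ) + 2 ^ (j : ℕ) + 2 ^ (k : ℕ) + 2 ^ (l : ℕ))

theorem phiTab_swap₁ (i j k l : Fin 8) : phiTab j i k l = -phiTab i j k l := by
  have : 2 ^ (j : ℕ) + 2 ^ (i : ℕ) + 2 ^ (k : ℕ) + 2 ^ (l : ℕ) =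
    2 ^ (i : ℕ) + 2 ^ (j : ℕ) + 2 ^ (k : ℕ) + 2 ^ (l : ℕ) := by ring
  rw [phiTab, phiTab, ordSign_swap i j, this]
  ring

theorem phiTab_swap₂ (i j k l : Fin 8) : phiTab i k j l = -phiTab i j k l := by
  have : 2 ^ (i : ℕ) + 2 ^ (k : ℕ) + 2 ^ (j : ℕ) + 2 ^ (l : ℕ) =
    2 ^ (i : ℕ) + 2 ^ (j : ℕ) + 2 ^ (k : ℕ) + 2 ^ (l : ℕ) := by ring
  rw [phiTab, phiTab, ordSign_swap j k, this]
  ring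

theorem phiTab_swap₃ (i j k l : Fin 8) : phiTab i j l k = -phiTab i j k l := by
  have : 2 ^ (i : ℕ) + 2 ^ (j : ℕ) + 2 ^ (l : ℕ) + 2 ^ (k : ℕ) =
    2 ^ (i : ℕ) + 2 ^ (j : ℕ) + 2 ^ (k : ℕ) + 2 ^ (l : ℕ) := by ring
  rw [phiTab, phiTab, ordSign_swap k l, this]
  ring

/-- In the Leibniz expansion only permutations with `i ∘ σ = q` survive. Between increasing tuples
such a σ is increasing, hence the identity. -/
theorem elem4_of_strictMono {q i : Fin 4 → Fin 8} (hq : StrictMono q) (hi : StrictMono i) :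
    elem4 q i = if i = q then 1 else 0 := by
  have key : ∀ σ : Equiv.Perm (Fin 4), i ∘ σ = q → σ = 1 := by
    intro σ h
    have hσ : StrictMono σ := by
      intro a b hab
      have := hq hab
      rw [← h] at this
      exact hi.lt_iff_lt.1 this
    ext a
    rw [Equiv.Perm.one_apply]
    exact congrArg Fin.val (congrFun (Subsingleton.elim (hσ.orderIsoOfSurjective _ σ.surjective)
      (OrderIso.refl _) |> congrArg DFunLike.coe) a)
  rw [elem4, Matrix.det_apply, Finset.sum_eq_single 1]
  · simp [funext_iff, Fintype.prod_boole]
  · intro σ _ hσ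
    have : ¬ ∀ a, i (σ a) = q a := fun h ↦ hσ (key σ (funext h))
    simp [Fintype.prod_boole, this]
  · simp

/-- The standard components on increasing indices. -/
def phiSorted (i : Fin 4 → Fin 8) : ℤ :=
  - (if i = ![0, 1, 2, 7] then 1 else 0) + (if i = ![0, 2, 3, 6] then 1 else 0)
  - (if i = ![0, 3, 4, 7] then 1 else 0) - (if i = ![0, 5, 6, 7] then 1 else 0)
  + (if i = ![0, 1, 4, 6] then 1 else 0) + (if i = ![0, 2, 4, 5] then 1 else 0)
  - (if i = ![0, 1, 3, 5] then 1 else 0) - (if i = ![3, 4, 5, 6] then 1 else 0)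
  - (if i = ![1, 4, 5, 7] then 1 else 0) - (if i = ![1, 2, 5, 6] then 1 else 0)
  - (if i = ![1, 2, 3, 4] then 1 else 0) - (if i = ![2, 3, 5, 7] then 1 else 0)
  - (if i = ![1, 3, 6, 7] then 1 else 0) + (if i = ![2, 4, 6, 7] then 1 else 0)

theorem stdPhi_of_strictMono {i : Fin 4 → Fin 8} (hi : StrictMono i) :
    stdPhi i = phiSorted i := by
  rw [stdPhi, phiSorted]
  repeat rw [elem4_of_strictMono (by decide) hi]

theorem phiSorted_eq_phiTab : ∀ i j : Fin 8, i < j → ∀ k, j < k → ∀ l, k < l →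
    phiSorted ![i, j, k, l] = phiTab i j k l := by
  decide +kernel

/-- Both sides alternate, so the 70 increasing quadruples suffice. The table avoids determinants and
makes the larger kernel computations below feasible. -/
theorem stdPhi_eq_phiTab (i : Fin 4 → Fin 8) :
    stdPhi i = phiTab (i 0) (i 1) (i 2) (i 3) := by
  rw [← sub_eq_zero]
  refine eq_zero_of_adjacent_swap (n := 3)
    (F := fun i ↦ stdPhi i - phiTab (i 0) (i 1) (i 2) (i 3)) ?_ ?_ i
  · intro k i
    rw [stdPhi_comp_perm, Equiv.Perm.sign_swap (Fin.castSucc_lt_succ).ne]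
    fin_cases k
    · have := phiTab_swap₁ (i 0) (i 1) (i 2) (i 3)
      simp [Equiv.swap_apply_def, this]; ring
    · have := phiTab_swap₂ (i 0) (i 1) (i 2) (i 3)
      simp [Equiv.swap_apply_def, this]; ring
    · have := phiTab_swap₃ (i 0) (i 1) (i 2) (i 3)
      simp [Equiv.swap_apply_def, this]; ring
  · intro i hi
    have e : i = ![i 0, i 1, i 2, i 3] := by
      ext a; fin_cases a <;> rfl
    rw [sub_eq_zero, stdPhi_of_strictMono hi, ← phiSorted_eq_phiTab _ _ (hi (by decide)) _ (hi (by decide)) _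
      (hi (by decide)), ← e]

/-- The Kronecker symbol. -/
def delta (i j : Fin 8) : ℤ := bif Nat.beq i j then 1 else 0

theorem delta_eq (i j : Fin 8) : delta i j = if i = j then 1 else 0 := by
  simp [delta, Bool.cond_eq_ite, Fin.ext_iff]

/-- The contraction of two copies of the standard form over one index, minus its value. -/
def contractionDefect (i j k a b c : Fin 8) : ℤ :=
  (∑ p, phiTab i j k p * phiTab a b c p) -
    (delta i a * (delta j b * delta k c - delta j c * delta k b)
      - delta i b * (delta j a * delta k c - delta j c * delta k a)
      + delta i c * (delta j a * delta k b - delta j b * delta k a)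
      - delta i a * phiTab j k b c - delta i b * phiTab j k c a - delta i c * phiTab j k a b
      - delta j a * phiTab k i b c - delta j b * phiTab k i c a - delta j c * phiTab k i a b
      - delta k a * phiTab i j b c - delta k b * phiTab i j c a - delta k c * phiTab i j a b)

theorem contractionDefect_of_lt : ∀ i j : Fin 8, i < j → ∀ k, j < k →
    ∀ a b : Fin 8, a < b → ∀ c, b < c → contractionDefect i j k a b c = 0 := by
  simp only [contractionDefect, Fin.sum_univ_eight]
  decide +kernel

theorem contractionDefect_swap₁ (i j k a b c : Fin 8) :
    contractionDefect j i k a b c = -contractionDefect i j k a b c := by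
  simp only [contractionDefect, phiTab_swap₁ i j k, phiTab_swap₁ i j, phiTab_swap₁ i k,
    phiTab_swap₁ k j, neg_mul, Finset.sum_neg_distrib]
  ring

theorem contractionDefect_swap₂ (i j k a b c : Fin 8) :
    contractionDefect i k j a b c = -contractionDefect i j k a b c := by
  simp only [contractionDefect, phiTab_swap₂ i j k, phiTab_swap₁ j k, phiTab_swap₁ k i,
    phiTab_swap₁ i j, neg_mul, Finset.sum_neg_distrib]
  ring

theorem contractionDefect_symm (i j k a b c : Fin 8) :
    contractionDefect a b c i j k = contractionDefect i j k a b c := by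
  have h : ∀ i j k l, phiTab k l i j = phiTab i j k l := fun i j k l ↦ by
    rw [phiTab_swap₂, phiTab_swap₁, phiTab_swap₃, phiTab_swap₂]; simp
  have hd : ∀ i j, delta j i = delta i j := fun i j ↦ by simp [delta_eq, eq_comm]
  simp only [contractionDefect, h _ _ i j, h _ _ j k, h _ _ k i, hd _ a, hd _ b, hd _ c,
    mul_comm (phiTab a b c _)]
  ring

/-- The defect alternates in the first triple and is symmetric under exchange of the two triples.
Reducing one triple, exchanging and reducing the other leaves the 56² pairs of increasing triples,
which are evaluated. -/
theorem contractionDefect_eq_zero (i j k a b c : Fin 8) : contractionDefect i j k a b c = 0 := by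
  have key : ∀ a b c : Fin 8, (∀ i j : Fin 8, i < j → ∀ k, j < k →
      contractionDefect i j k a b c = 0) → ∀ i j k, contractionDefect i j k a b c = 0 := by
    intro a b c h i j k
    refine eq_zero_of_adjacent_swap (n := 2)
      (F := fun v ↦ contractionDefect (v 0) (v 1) (v 2) a b c) ?_ ?_ ![i, j, k]
    · intro l v
      fin_cases l
      · simpa [Equiv.swap_apply_def] using contractionDefect_swap₁ (v 0) (v 1) (v 2) a b c
      · simpa [Equiv.swap_apply_def] using contractionDefect_swap₂ (v 0) (v 1) (v 2) a b c
    · intro v hv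
      exact h _ _ (hv (by decide)) _ (hv (by decide))
  refine key a b c (fun i j hij k hjk ↦ ?_) i j k
  rw [← contractionDefect_symm]
  refine key i j k (fun a b hab c hbc ↦ ?_) a b c
  rw [← contractionDefect_symm]
  exact contractionDefect_of_lt i j hij k hjk a b hab c hbc

/-- The Levi-Civita symbol in eight dimensions. -/
def epsTab (a b c d e f g h : Fin 8) : ℤ :=
  ordSign a b * ordSign a c * ordSign a d * ordSign a e * ordSign a f * ordSign a g * ordSign a h *
  (ordSign b c * ordSign b d * ordSign b e * ordSign b f * ordSign b g * ordSign b h) *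
  (ordSign c d * ordSign c e * ordSign c f * ordSign c g * ordSign c h) *
  (ordSign d e * ordSign d f * ordSign d g * ordSign d h) *
  (ordSign e f * ordSign e g * ordSign e h) * (ordSign f g * ordSign f h) * ordSign g h

theorem epsTab_adjacent_swap (k : Fin 7) (i : Fin 8 → Fin 8) :
    (fun v : Fin 8 → Fin 8 ↦ epsTab (v 0) (v 1) (v 2) (v 3) (v 4) (v 5) (v 6) (v 7))
      (i ∘ Equiv.swap k.castSucc k.succ) =
    -(fun v : Fin 8 → Fin 8 ↦ epsTab (v 0) (v 1) (v 2) (v 3) (v 4) (v 5) (v 6) (v 7)) i := by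
  fin_cases k
  · simp [Equiv.swap_apply_def, epsTab, ordSign_swap (i 0) (i 1), -mul_eq_mul_left_iff,
      -mul_eq_mul_right_iff]; ring
  · simp [Equiv.swap_apply_def, epsTab, ordSign_swap (i 1) (i 2), -mul_eq_mul_left_iff,
      -mul_eq_mul_right_iff]; ring
  · simp [Equiv.swap_apply_def, epsTab, ordSign_swap (i 2) (i 3), -mul_eq_mul_left_iff,
      -mul_eq_mul_right_iff]; ring
  · simp [Equiv.swap_apply_def, epsTab, ordSign_swap (i 3) (i 4), -mul_eq_mul_left_iff,
      -mul_eq_mul_right_iff]; ring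
  · simp [Equiv.swap_apply_def, epsTab, ordSign_swap (i 4) (i 5), -mul_eq_mul_left_iff,
      -mul_eq_mul_right_iff]; ring
  · simp [Equiv.swap_apply_def, epsTab, ordSign_swap (i 5) (i 6), -mul_eq_mul_left_iff,
      -mul_eq_mul_right_iff]; ring
  · simp [Equiv.swap_apply_def, epsTab, ordSign_swap (i 6) (i 7), -mul_eq_mul_left_iff,
      -mul_eq_mul_right_iff]; ring

/-- The defect in the formula for the Hodge star of `e_s ⌟ Φ`. -/
def starDefect (s a b i j k : Fin 8) : ℤ :=
  -- The formula is ∗(e_s ⌟ Φ) = -e_s ∧ Φ, an expression of self-duality. The factor 6 counts the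
  -- orderings of c, d, e.
  (∑ c, ∑ d, ∑ e, phiTab s c d e * epsTab c d e a b i j k) +
    6 * (delta s a * phiTab b i j k - delta s b * phiTab a i j k + delta s i * phiTab a b j k
      - delta s j * phiTab a b i k + delta s k * phiTab a b i j)

theorem starDefect_adjacent_swap (s : Fin 8) (l : Fin 4) (v : Fin 5 → Fin 8) :
    (fun v : Fin 5 → Fin 8 ↦ starDefect s (v 0) (v 1) (v 2) (v 3) (v 4))
      (v ∘ Equiv.swap l.castSucc l.succ) =
    -(fun v : Fin 5 → Fin 8 ↦ starDefect s (v 0) (v 1) (v 2) (v 3) (v 4)) v := by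
  have h3 : ∀ c d e a b i j k, epsTab c d e b a i j k = -epsTab c d e a b i j k :=
    fun c d e a b i j k ↦ epsTab_adjacent_swap 3 ![c, d, e, a, b, i, j, k]
  have h4 : ∀ c d e a b i j k, epsTab c d e a i b j k = -epsTab c d e a b i j k :=
    fun c d e a b i j k ↦ epsTab_adjacent_swap 4 ![c, d, e, a, b, i, j, k]
  have h5 : ∀ c d e a b i j k, epsTab c d e a b j i k = -epsTab c d e a b i j k :=
    fun c d e a b i j k ↦ epsTab_adjacent_swap 5 ![c, d, e, a, b, i, j, k]
  have h6 : ∀ c d e a b i j k, epsTab c d e a b i k j = -epsTab c d e a b i j k :=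
    fun c d e a b i j k ↦ epsTab_adjacent_swap 6 ![c, d, e, a, b, i, j, k]
  generalize hv0 : v 0 = a
  generalize hv1 : v 1 = b
  generalize hv2 : v 2 = i
  generalize hv3 : v 3 = j
  generalize hv4 : v 4 = k
  fin_cases l
  · simp [Equiv.swap_apply_def, starDefect, hv0, hv1, hv2, hv3, hv4, h3 _ _ _ a b,
      phiTab_swap₁ a b, Finset.sum_neg_distrib]
    ring
  · simp [Equiv.swap_apply_def, starDefect, hv0, hv1, hv2, hv3, hv4, h4 _ _ _ _ b i,
      phiTab_swap₁ b i, phiTab_swap₂ _ b i, Finset.sum_neg_distrib]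
    ring
  · simp [Equiv.swap_apply_def, starDefect, hv0, hv1, hv2, hv3, hv4, h5 _ _ _ _ _ i j,
      phiTab_swap₂ _ i j, phiTab_swap₃ _ _ i j, Finset.sum_neg_distrib]
    ring
  · simp [Equiv.swap_apply_def, starDefect, hv0, hv1, hv2, hv3, hv4, h6 _ _ _ _ _ _ j k,
      phiTab_swap₃ _ _ j k, Finset.sum_neg_distrib]
    ring

/-- Membership in a list of five indices. -/
def memFive (a b i j k c : Fin 8) : Bool :=
  Nat.beq c a || Nat.beq c b || Nat.beq c i || Nat.beq c j || Nat.beq c k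

theorem memFive_iff (a b i j k c : Fin 8) :
    memFive a b i j k c = true ↔ c = a ∨ c = b ∨ c = i ∨ c = j ∨ c = k := by
  simp [memFive, Fin.ext_iff, or_assoc]

/-- The sum in `starDefect`, with the vanishing terms left out. -/
def starSum (s a b i j k : Fin 8) : ℤ :=
  ∑ c, bif memFive a b i j k c then 0 else
    ∑ d, bif memFive a b i j k d then 0 else
      ∑ e, bif memFive a b i j k e then 0 else phiTab s c d e * epsTab c d e a b i j k

/-- The Levi-Civita symbol vanishes on repeated indices. For distinct a, b, i, j, k this cuts the
512 terms to 27 before evaluation. -/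
theorem starSum_eq (s a b i j k : Fin 8) :
    ∑ c, ∑ d, ∑ e, phiTab s c d e * epsTab c d e a b i j k = starSum s a b i j k := by
  simp only [starSum, Bool.cond_eq_ite, memFive_iff]
  refine Finset.sum_congr rfl fun c _ ↦ ?_
  split_ifs with hc
  · refine Finset.sum_eq_zero fun d _ ↦ Finset.sum_eq_zero fun e _ ↦ ?_
    rcases hc with rfl | rfl | rfl | rfl | rfl <;> simp [epsTab, ordSign_eq]
  refine Finset.sum_congr rfl fun d _ ↦ ?_
  split_ifs with hd
  · refine Finset.sum_eq_zero fun e _ ↦ ?_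
    rcases hd with rfl | rfl | rfl | rfl | rfl <;> simp [epsTab, ordSign_eq]
  refine Finset.sum_congr rfl fun e _ ↦ ?_
  split_ifs with he
  · rcases he with rfl | rfl | rfl | rfl | rfl <;> simp [epsTab, ordSign_eq]
  rfl

theorem starSum_of_lt : ∀ s a b : Fin 8, a < b → ∀ i, b < i → ∀ j, i < j → ∀ k, j < k →
    starSum s a b i j k =
      -6 * (delta s a * phiTab b i j k - delta s b * phiTab a i j k + delta s i * phiTab a b j k
      - delta s j * phiTab a b i k + delta s k * phiTab a b i j) := by
  simp only [starSum, Fin.sum_univ_eight]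
  decide +kernel

theorem starDefect_eq_zero (s a b i j k : Fin 8) : starDefect s a b i j k = 0 := by
  refine eq_zero_of_adjacent_swap (n := 4)
    (F := fun v ↦ starDefect s (v 0) (v 1) (v 2) (v 3) (v 4)) (starDefect_adjacent_swap s) ?_ ![a, b, i, j, k]
  intro v hv
  simp only [starDefect]
  rw [starSum_eq, starSum_of_lt s _ _ (hv (by decide)) _ (hv (by decide)) _ (hv (by decide)) _
    (hv (by decide))]
  ring

/-! ### Basis-free form of the identities for Φ -/

section Tensor

variable {V : Type*} [NormedAddCommGroup V] [InnerProductSpace ℝ V]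

theorem isLinearMap_slot {n : ℕ} (Ω : V [⋀^Fin n]→L[ℝ] ℝ) (k : Fin n) (f : V → Fin n → V)
    (h : ∀ u, f u = Function.update (f 0) k u) : IsLinearMap ℝ fun u ↦ Ω (f u) :=
  ⟨fun u v ↦ by simp only [h u, h v, h (u + v), Ω.map_update_add],
    fun c u ↦ by simp only [h u, h (c • u), Ω.map_update_smul]⟩

theorem eq_zero_of_onb (e : OrthonormalBasis (Fin 8) ℝ V) {f : V → ℝ} (hf : IsLinearMap ℝ f)
    (h : ∀ i, f (e i) = 0) (u : V) : f u = 0 := by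
  have : hf.mk' f = 0 := e.toBasis.ext fun i ↦ by simpa using h i
  exact LinearMap.congr_fun this u

/-- Expanding `h (b p)` in the basis `e` leaves ∑_p ⟨e_q, b_p⟩ g(b_p) = g(e_q). This moves
contractions between an arbitrary orthonormal basis and an adapted one. -/
theorem sum_onb_mul (b e : OrthonormalBasis (Fin 8) ℝ V) {g h : V → ℝ}
    (hg : IsLinearMap ℝ g) (hh : IsLinearMap ℝ h) :
    ∑ p, g (b p) * h (b p) = ∑ p, g (e p) * h (e p) := by
  have exp : ∀ (b e : OrthonormalBasis (Fin 8) ℝ V) {g : V → ℝ} (_ : IsLinearMap ℝ g) (p),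
      g (b p) = ∑ q, inner ℝ (e q) (b p) * g (e q) := by
    intro b e g hg p
    change hg.mk' g (b p) = _
    conv_lhs => rw [← e.sum_repr' (b p), map_sum]
    simp
  simp_rw [exp b e hh, Finset.mul_sum]
  rw [Finset.sum_comm]
  refine Finset.sum_congr rfl fun q _ ↦ ?_
  rw [exp e b hg q, Finset.sum_mul]
  refine Finset.sum_congr rfl fun p _ ↦ ?_
  rw [real_inner_comm]
  ring

theorem alternating_swap {n : ℕ} (Ω : V [⋀^Fin n]→L[ℝ] ℝ) (v : Fin n → V) {i j : Fin n}
    (hij : i ≠ j) : Ω (v ∘ Equiv.swap i j) = -Ω v :=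
  Ω.toAlternatingMap.map_swap v hij

theorem alt4_swap₁ (Φ : V [⋀^Fin 4]→L[ℝ] ℝ) (a b c d : V) :
    Φ ![b, a, c, d] = -Φ ![a, b, c, d] := by
  rw [← alternating_swap Φ ![a, b, c, d] (show (0 : Fin 4) ≠ 1 by decide)]
  congr 1; ext i; fin_cases i <;> rfl

theorem alt4_swap₂ (Φ : V [⋀^Fin 4]→L[ℝ] ℝ) (a b c d : V) :
    Φ ![a, c, b, d] = -Φ ![a, b, c, d] := by
  rw [← alternating_swap Φ ![a, b, c, d] (show (1 : Fin 4) ≠ 2 by decide)]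
  congr 1; ext i; fin_cases i <;> rfl

theorem alt4_swap₃ (Φ : V [⋀^Fin 4]→L[ℝ] ℝ) (a b c d : V) :
    Φ ![a, b, d, c] = -Φ ![a, b, c, d] := by
  rw [← alternating_swap Φ ![a, b, c, d] (show (2 : Fin 4) ≠ 3 by decide)]
  congr 1; ext i; fin_cases i <;> rfl

theorem isLinearMap_alt4₁ (Φ : V [⋀^Fin 4]→L[ℝ] ℝ) (b c d : V) :
    IsLinearMap ℝ fun a ↦ Φ ![a, b, c, d] :=
  isLinearMap_slot Φ 0 _ fun u ↦ by ext i; fin_cases i <;> rfl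

theorem isLinearMap_alt4₂ (Φ : V [⋀^Fin 4]→L[ℝ] ℝ) (a c d : V) :
    IsLinearMap ℝ fun b ↦ Φ ![a, b, c, d] :=
  isLinearMap_slot Φ 1 _ fun u ↦ by ext i; fin_cases i <;> rfl

theorem isLinearMap_alt4₃ (Φ : V [⋀^Fin 4]→L[ℝ] ℝ) (a b d : V) :
    IsLinearMap ℝ fun c ↦ Φ ![a, b, c, d] :=
  isLinearMap_slot Φ 2 _ fun u ↦ by ext i; fin_cases i <;> rfl

theorem isLinearMap_alt4₄ (Φ : V [⋀^Fin 4]→L[ℝ] ℝ) (a b c : V) :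
    IsLinearMap ℝ fun d ↦ Φ ![a, b, c, d] :=
  isLinearMap_slot Φ 3 _ fun u ↦ by ext i; fin_cases i <;> rfl

/-- An orthonormal basis in which a 4-form and an 8-form are the standard ones. -/
structure IsAdapted (Φ : V [⋀^Fin 4]→L[ℝ] ℝ) (Ω : V [⋀^Fin 8]→L[ℝ] ℝ)
    (e : OrthonormalBasis (Fin 8) ℝ V) : Prop where
  vol : Ω e = 1
  phi : ∀ i j k l, Φ ![e i, e j, e k, e l] = phiTab i j k l

variable {Φ : V [⋀^Fin 4]→L[ℝ] ℝ} {Ω : V [⋀^Fin 8]→L[ℝ] ℝ} {e : OrthonormalBasis (Fin 8) ℝ V}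

/-- The contraction of two copies of the form over one index, minus its value. -/
def contractionForm (Φ : V [⋀^Fin 4]→L[ℝ] ℝ) (b : OrthonormalBasis (Fin 8) ℝ V)
    (u v w x y z : V) : ℝ :=
  (∑ p, Φ ![u, v, w, b p] * Φ ![x, y, z, b p]) -
    (inner ℝ u x * (inner ℝ v y * inner ℝ w z - inner ℝ v z * inner ℝ w y)
      - inner ℝ u y * (inner ℝ v x * inner ℝ w z - inner ℝ v z * inner ℝ w x)
      + inner ℝ u z * (inner ℝ v x * inner ℝ w y - inner ℝ v y * inner ℝ w x)
      - inner ℝ u x * Φ ![v, w, y, z] - inner ℝ u y * Φ ![v, w, z, x]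
      - inner ℝ u z * Φ ![v, w, x, y]
      + inner ℝ v x * Φ ![u, w, y, z] + inner ℝ v y * Φ ![u, w, z, x]
      + inner ℝ v z * Φ ![u, w, x, y]
      - inner ℝ w x * Φ ![u, v, y, z] - inner ℝ w y * Φ ![u, v, z, x]
      - inner ℝ w z * Φ ![u, v, x, y])

theorem contractionForm_swap₁ (b : OrthonormalBasis (Fin 8) ℝ V) (u v w x y z : V) :
    contractionForm Φ b v u w x y z = -contractionForm Φ b u v w x y z := by
  simp only [contractionForm, alt4_swap₁ Φ u v, neg_mul, Finset.sum_neg_distrib]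
  ring

theorem contractionForm_swap₂ (b : OrthonormalBasis (Fin 8) ℝ V) (u v w x y z : V) :
    contractionForm Φ b u w v x y z = -contractionForm Φ b u v w x y z := by
  simp only [contractionForm, alt4_swap₁ Φ v w, alt4_swap₂ Φ u v w, neg_mul,
    Finset.sum_neg_distrib]
  ring

theorem contractionForm_symm (b : OrthonormalBasis (Fin 8) ℝ V) (u v w x y z : V) :
    contractionForm Φ b x y z u v w = contractionForm Φ b u v w x y z := by
  have h : ∀ i j k l, Φ ![k, l, i, j] = Φ ![i, j, k, l] := fun i j k l ↦ by
    rw [alt4_swap₂, alt4_swap₁, alt4_swap₃, alt4_swap₂]; simp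
  simp only [contractionForm, h u v, h v w, h w u, alt4_swap₁ Φ u w, real_inner_comm x,
    real_inner_comm y, real_inner_comm z, mul_comm (Φ ![x, y, z, _]), alt4_swap₃ Φ _ _ x z]
  ring

theorem isLinearMap_contractionForm (b : OrthonormalBasis (Fin 8) ℝ V) (v w x y z : V) :
    IsLinearMap ℝ fun u ↦ contractionForm Φ b u v w x y z := by
  constructor
  · intro u u'
    simp only [contractionForm, (isLinearMap_alt4₁ Φ _ _ _).map_add, inner_add_left, add_mul,
      Finset.sum_add_distrib]
    ring
  · intro c u
    simp only [contractionForm, (isLinearMap_alt4₁ Φ _ _ _).map_smul, inner_smul_left,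
      smul_eq_mul, mul_assoc, ← Finset.mul_sum]
    simp
    ring

theorem IsAdapted.contractionForm_basis (h : IsAdapted Φ Ω e) (i j k a b c : Fin 8) :
    contractionForm Φ e (e i) (e j) (e k) (e a) (e b) (e c) = 0 := by
  have key := contractionDefect_eq_zero i j k a b c
  have hd : ∀ i j, inner ℝ (e i) (e j) = (delta i j : ℝ) := fun i j ↦ by
    rw [OrthonormalBasis.inner_eq_ite, delta_eq]; push_cast; rfl
  rw [contractionDefect] at key
  simp only [contractionForm, h.phi, hd]
  have key' := congrArg (Int.cast : ℤ → ℝ) key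
  push_cast at key'
  rw [← key']
  -- The middle group is written with slots u, w in `contractionForm`, but with k, i in
  -- `contractionDefect`.
  have h1 : ∀ x y, ((phiTab k i x y : ℤ) : ℝ) = -(phiTab i k x y : ℤ) := fun x y ↦ by
    rw [phiTab_swap₁]; simp
  simp only [h1]
  ring

/-- The contraction does not depend on the basis, and a multilinear expression vanishes once it does
so on an adapted basis. Linearity is checked in the first slot only; alternation and the exchange
symmetry carry it to the other five. -/
theorem IsAdapted.contractionForm_eq_zero (h : IsAdapted Φ Ω e)
    (b : OrthonormalBasis (Fin 8) ℝ V) (u v w x y z : V) :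
    contractionForm Φ b u v w x y z = 0 := by
  have hb : ∀ u v w x y z, contractionForm Φ b u v w x y z = contractionForm Φ e u v w x y z := by
    intro u v w x y z
    simp only [contractionForm]
    rw [sum_onb_mul b e (isLinearMap_alt4₄ Φ u v w) (isLinearMap_alt4₄ Φ x y z)]
  have key : ∀ x y z, (∀ i j k, contractionForm Φ e (e i) (e j) (e k) x y z = 0) →
      ∀ u v w, contractionForm Φ e u v w x y z = 0 := by
    intro x y z h0 u v w
    refine eq_zero_of_onb e (isLinearMap_contractionForm e v w x y z) (fun i ↦ ?_) u
    rw [← neg_eq_zero, ← contractionForm_swap₁]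
    refine eq_zero_of_onb e (isLinearMap_contractionForm e _ w x y z) (fun j ↦ ?_) v
    rw [← neg_eq_zero, ← contractionForm_swap₂, ← neg_eq_zero, ← contractionForm_swap₁]
    refine eq_zero_of_onb e (isLinearMap_contractionForm e _ _ x y z) (fun k ↦ ?_) w
    exact h0 k j i
  rw [hb]
  refine key x y z (fun i j k ↦ ?_) u v w
  rw [← contractionForm_symm]
  refine key _ _ _ (fun a b c ↦ ?_) x y z
  exact h.contractionForm_basis a b c i j k

theorem alternating_apply_basis (h : IsAdapted Φ Ω e) (i : Fin 8 → Fin 8) :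
    Ω (fun a ↦ e (i a)) =
      epsTab (i 0) (i 1) (i 2) (i 3) (i 4) (i 5) (i 6) (i 7) := by
  by_cases hi : Function.Injective i
  · obtain ⟨σ, rfl⟩ : ∃ σ : Equiv.Perm (Fin 8), i = σ :=
      ⟨Equiv.ofBijective i (Finite.injective_iff_bijective.1 hi), rfl⟩
    have h1 : Ω (fun a ↦ e (σ a)) = Equiv.Perm.sign σ • Ω e :=
      Ω.toAlternatingMap.map_perm e σ
    have h2 := eq_sign_mul_of_adjacent_swap (n := 7)
      (F := fun v : Fin 8 → Fin 8 ↦ epsTab (v 0) (v 1) (v 2) (v 3) (v 4) (v 5) (v 6) (v 7))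
      epsTab_adjacent_swap σ id
    have h3 : epsTab 0 1 2 3 4 5 6 7 = 1 := by decide
    simp only [Function.id_comp, id, h3, mul_one] at h2
    rw [h1, h2, h.vol]
    simp [Units.smul_def]
  · have h1 : Ω (fun a ↦ e (i a)) = 0 :=
      Ω.toAlternatingMap.map_eq_zero_of_not_injective _ fun h ↦ hi h.of_comp
    have h2 := eq_zero_of_not_injective (n := 7)
      (F := fun v : Fin 8 → Fin 8 ↦ epsTab (v 0) (v 1) (v 2) (v 3) (v 4) (v 5) (v 6) (v 7))
      epsTab_adjacent_swap hi
    rw [h1, h2, Int.cast_zero]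

/-- The defect in the formula for the Hodge star of `w ⌟ Φ`. -/
def starForm (Φ : V [⋀^Fin 4]→L[ℝ] ℝ) (Ω : V [⋀^Fin 8]→L[ℝ] ℝ)
    (b : OrthonormalBasis (Fin 8) ℝ V) (w v₀ v₁ v₂ v₃ v₄ : V) : ℝ :=
  (∑ i, ∑ j, ∑ k, Φ ![w, b i, b j, b k] * Ω ![b i, b j, b k, v₀, v₁, v₂, v₃, v₄]) +
    6 * (inner ℝ w v₀ * Φ ![v₁, v₂, v₃, v₄] - inner ℝ w v₁ * Φ ![v₀, v₂, v₃, v₄]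
      + inner ℝ w v₂ * Φ ![v₀, v₁, v₃, v₄] - inner ℝ w v₃ * Φ ![v₀, v₁, v₂, v₄]
      + inner ℝ w v₄ * Φ ![v₀, v₁, v₂, v₃])

theorem starForm_swap₀₁ (b : OrthonormalBasis (Fin 8) ℝ V) (w v₀ v₁ v₂ v₃ v₄ : V) :
    starForm Φ Ω b w v₁ v₀ v₂ v₃ v₄ = -starForm Φ Ω b w v₀ v₁ v₂ v₃ v₄ := by
  have h : ∀ i j k, Ω ![b i, b j, b k, v₁, v₀, v₂, v₃, v₄] =
      -Ω ![b i, b j, b k, v₀, v₁, v₂, v₃, v₄] := fun i j k ↦ by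
    rw [← alternating_swap Ω _ (show (3 : Fin 8) ≠ 4 by decide)]
    congr 1; ext i; fin_cases i <;> rfl
  simp only [starForm, h, alt4_swap₁ Φ v₀ v₁, mul_neg, Finset.sum_neg_distrib]
  ring

theorem starForm_swap₁₂ (b : OrthonormalBasis (Fin 8) ℝ V) (w v₀ v₁ v₂ v₃ v₄ : V) :
    starForm Φ Ω b w v₀ v₂ v₁ v₃ v₄ = -starForm Φ Ω b w v₀ v₁ v₂ v₃ v₄ := by
  have h : ∀ i j k, Ω ![b i, b j, b k, v₀, v₂, v₁, v₃, v₄] =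
      -Ω ![b i, b j, b k, v₀, v₁, v₂, v₃, v₄] := fun i j k ↦ by
    rw [← alternating_swap Ω _ (show (4 : Fin 8) ≠ 5 by decide)]
    congr 1; ext i; fin_cases i <;> rfl
  simp only [starForm, h, alt4_swap₁ Φ v₁ v₂, alt4_swap₂ Φ _ v₁ v₂, mul_neg,
    Finset.sum_neg_distrib]
  ring

theorem starForm_swap₂₃ (b : OrthonormalBasis (Fin 8) ℝ V) (w v₀ v₁ v₂ v₃ v₄ : V) :
    starForm Φ Ω b w v₀ v₁ v₃ v₂ v₄ = -starForm Φ Ω b w v₀ v₁ v₂ v₃ v₄ := by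
  have h : ∀ i j k, Ω ![b i, b j, b k, v₀, v₁, v₃, v₂, v₄] =
      -Ω ![b i, b j, b k, v₀, v₁, v₂, v₃, v₄] := fun i j k ↦ by
    rw [← alternating_swap Ω _ (show (5 : Fin 8) ≠ 6 by decide)]
    congr 1; ext i; fin_cases i <;> rfl
  simp only [starForm, h, alt4_swap₂ Φ _ v₂ v₃, alt4_swap₃ Φ _ _ v₂ v₃, mul_neg,
    Finset.sum_neg_distrib]
  ring

theorem starForm_swap₃₄ (b : OrthonormalBasis (Fin 8) ℝ V) (w v₀ v₁ v₂ v₃ v₄ : V) :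
    starForm Φ Ω b w v₀ v₁ v₂ v₄ v₃ = -starForm Φ Ω b w v₀ v₁ v₂ v₃ v₄ := by
  have h : ∀ i j k, Ω ![b i, b j, b k, v₀, v₁, v₂, v₄, v₃] =
      -Ω ![b i, b j, b k, v₀, v₁, v₂, v₃, v₄] := fun i j k ↦ by
    rw [← alternating_swap Ω _ (show (6 : Fin 8) ≠ 7 by decide)]
    congr 1; ext i; fin_cases i <;> rfl
  simp only [starForm, h, alt4_swap₃ Φ _ _ v₃ v₄, mul_neg, Finset.sum_neg_distrib]
  ring

theorem isLinearMap_starForm (b : OrthonormalBasis (Fin 8) ℝ V) (w v₁ v₂ v₃ v₄ : V) :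
    IsLinearMap ℝ fun v₀ ↦ starForm Φ Ω b w v₀ v₁ v₂ v₃ v₄ := by
  have h : ∀ i j k, IsLinearMap ℝ fun v₀ ↦ Ω ![b i, b j, b k, v₀, v₁, v₂, v₃, v₄] :=
    fun i j k ↦ isLinearMap_slot Ω 3 _ fun u ↦ by ext i; fin_cases i <;> rfl
  constructor
  · intro u u'
    simp only [starForm, (isLinearMap_alt4₁ Φ _ _ _).map_add, inner_add_right, (h _ _ _).map_add,
      mul_add, add_mul, Finset.sum_add_distrib]
    ring
  · intro c u
    simp only [starForm, (isLinearMap_alt4₁ Φ _ _ _).map_smul, inner_smul_right,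
      (h _ _ _).map_smul, smul_eq_mul, mul_left_comm _ c, mul_assoc c, ← Finset.mul_sum]
    ring

theorem isLinearMap_starForm_left (b : OrthonormalBasis (Fin 8) ℝ V) (v₀ v₁ v₂ v₃ v₄ : V) :
    IsLinearMap ℝ fun w ↦ starForm Φ Ω b w v₀ v₁ v₂ v₃ v₄ := by
  constructor
  · intro u u'
    simp only [starForm, (isLinearMap_alt4₁ Φ _ _ _).map_add, inner_add_left,
      mul_add, add_mul, Finset.sum_add_distrib]
    ring
  · intro c u
    simp only [starForm, (isLinearMap_alt4₁ Φ _ _ _).map_smul, real_inner_smul_left,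
      smul_eq_mul, mul_assoc c, ← Finset.mul_sum]
    ring

theorem sum_onb_mul₃ (b e : OrthonormalBasis (Fin 8) ℝ V) {g h : V → V → V → ℝ}
    (hg₁ : ∀ v w, IsLinearMap ℝ fun u ↦ g u v w) (hg₂ : ∀ u w, IsLinearMap ℝ fun v ↦ g u v w)
    (hg₃ : ∀ u v, IsLinearMap ℝ fun w ↦ g u v w)
    (hh₁ : ∀ v w, IsLinearMap ℝ fun u ↦ h u v w) (hh₂ : ∀ u w, IsLinearMap ℝ fun v ↦ h u v w)
    (hh₃ : ∀ u v, IsLinearMap ℝ fun w ↦ h u v w) :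
    ∑ i, ∑ j, ∑ k, g (b i) (b j) (b k) * h (b i) (b j) (b k) =
      ∑ i, ∑ j, ∑ k, g (e i) (e j) (e k) * h (e i) (e j) (e k) := by
  have h3 : ∀ u v, ∑ k, g u v (b k) * h u v (b k) = ∑ k, g u v (e k) * h u v (e k) :=
    fun u v ↦ sum_onb_mul b e (hg₃ u v) (hh₃ u v)
  have h2 : ∀ u w, ∑ k, g u (b k) w * h u (b k) w = ∑ k, g u (e k) w * h u (e k) w :=
    fun u w ↦ sum_onb_mul b e (hg₂ u w) (hh₂ u w)
  have h1 : ∀ v w, ∑ k, g (b k) v w * h (b k) v w = ∑ k, g (e k) v w * h (e k) v w :=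
    fun v w ↦ sum_onb_mul b e (hg₁ v w) (hh₁ v w)
  simp only [h3]
  have : ∀ i, ∑ j, ∑ k, g (b i) (b j) (e k) * h (b i) (b j) (e k) =
      ∑ j, ∑ k, g (b i) (e j) (e k) * h (b i) (e j) (e k) := fun i ↦ by
    rw [Finset.sum_comm]
    simp only [h2]
    rw [Finset.sum_comm]
  simp only [this]
  rw [Finset.sum_comm]
  conv_rhs => rw [Finset.sum_comm]
  refine Finset.sum_congr rfl fun j _ ↦ ?_
  rw [Finset.sum_comm]
  simp only [h1]
  rw [Finset.sum_comm]

theorem IsAdapted.starForm_basis (h : IsAdapted Φ Ω e) (s a b i j k : Fin 8) :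
    starForm Φ Ω e (e s) (e a) (e b) (e i) (e j) (e k) = 0 := by
  have key := starDefect_eq_zero s a b i j k
  have hd : ∀ i j, inner ℝ (e i) (e j) = (delta i j : ℝ) := fun i j ↦ by
    rw [OrthonormalBasis.inner_eq_ite, delta_eq]; push_cast; rfl
  have hv : ∀ c d f, Ω ![e c, e d, e f, e a, e b, e i, e j, e k] = epsTab c d f a b i j k := by
    intro c d f
    refine Eq.trans ?_ (alternating_apply_basis h ![c, d, f, a, b, i, j, k])
    congr 1; ext l; fin_cases l <;> rfl
  rw [starDefect] at key
  simp only [starForm, h.phi, hd, hv]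
  exact_mod_cast key

/-- Basis independence and multilinearity reduce this to the adapted components. The slots v₁, …, v₄
are brought to the position of v₀, where linearity is known, by adjacent swaps. -/
theorem IsAdapted.starForm_eq_zero (h : IsAdapted Φ Ω e) (b : OrthonormalBasis (Fin 8) ℝ V)
    (w v₀ v₁ v₂ v₃ v₄ : V) : starForm Φ Ω b w v₀ v₁ v₂ v₃ v₄ = 0 := by
  have hb : starForm Φ Ω b w v₀ v₁ v₂ v₃ v₄ = starForm Φ Ω e w v₀ v₁ v₂ v₃ v₄ := by
    simp only [starForm]
    rw [sum_onb_mul₃ b e (g := fun i j k ↦ Φ ![w, i, j, k])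
      (h := fun i j k ↦ Ω ![i, j, k, v₀, v₁, v₂, v₃, v₄])
      (fun _ _ ↦ isLinearMap_alt4₂ Φ _ _ _) (fun _ _ ↦ isLinearMap_alt4₃ Φ _ _ _)
      (fun _ _ ↦ isLinearMap_alt4₄ Φ _ _ _)
      (fun _ _ ↦ isLinearMap_slot Ω 0 _ fun u ↦ by ext i; fin_cases i <;> rfl)
      (fun _ _ ↦ isLinearMap_slot Ω 1 _ fun u ↦ by ext i; fin_cases i <;> rfl)
      (fun _ _ ↦ isLinearMap_slot Ω 2 _ fun u ↦ by ext i; fin_cases i <;> rfl)]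
  rw [hb]
  refine eq_zero_of_onb e (isLinearMap_starForm_left e _ _ _ _ _) (fun s ↦ ?_) w
  refine eq_zero_of_onb e (isLinearMap_starForm e _ _ _ _ _) (fun i₀ ↦ ?_) v₀
  rw [← neg_eq_zero, ← starForm_swap₀₁]
  refine eq_zero_of_onb e (isLinearMap_starForm e _ _ _ _ _) (fun i₁ ↦ ?_) v₁
  rw [← neg_eq_zero, ← starForm_swap₁₂, ← neg_eq_zero, ← starForm_swap₀₁]
  refine eq_zero_of_onb e (isLinearMap_starForm e _ _ _ _ _) (fun i₂ ↦ ?_) v₂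
  rw [← neg_eq_zero, ← starForm_swap₂₃, ← neg_eq_zero, ← starForm_swap₁₂, ← neg_eq_zero,
    ← starForm_swap₀₁]
  refine eq_zero_of_onb e (isLinearMap_starForm e _ _ _ _ _) (fun i₃ ↦ ?_) v₃
  rw [← neg_eq_zero, ← starForm_swap₃₄, ← neg_eq_zero, ← starForm_swap₂₃, ← neg_eq_zero,
    ← starForm_swap₁₂, ← neg_eq_zero, ← starForm_swap₀₁]
  refine eq_zero_of_onb e (isLinearMap_starForm e _ _ _ _ _) (fun i₄ ↦ ?_) v₄
  exact h.starForm_basis _ _ _ _ _ _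

end Tensor

/-! ### Tensor algebra in components -/

section Components

/-- The Kronecker symbol, with real values. -/
abbrev kd (i j : Fin 8) : ℝ := if i = j then 1 else 0

/-- The components of a `Spin(7)`-form in an orthonormal basis, characterized by their symmetry
and the value of the contraction of two copies over one index. -/
structure IsSpinArray (F : Fin 8 → Fin 8 → Fin 8 → Fin 8 → ℝ) : Prop where
  swap₁ : ∀ i j k l, F j i k l = -F i j k l
  swap₂ : ∀ i j k l, F i k j l = -F i j k l
  swap₃ : ∀ i j k l, F i j l k = -F i j k l
  contract : ∀ i j k a b c, ∑ p, F i j k p * F a b c p =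
    kd i a * (kd j b * kd k c - kd j c * kd k b)
      - kd i b * (kd j a * kd k c - kd j c * kd k a)
      + kd i c * (kd j a * kd k b - kd j b * kd k a)
      - kd i a * F j k b c - kd i b * F j k c a - kd i c * F j k a b
      - kd j a * F k i b c - kd j b * F k i c a - kd j c * F k i a b
      - kd k a * F i j b c - kd k b * F i j c a - kd k c * F i j a b

/-- The components of a 3-form. -/
structure IsAlt3 (T : Fin 8 → Fin 8 → Fin 8 → ℝ) : Prop where
  swap₁ : ∀ i j k, T j i k = -T i j k
  swap₂ : ∀ i j k, T i k j = -T i j k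

theorem IsAlt3.cyc {T : Fin 8 → Fin 8 → Fin 8 → ℝ} (hT : IsAlt3 T) (i j k) :
    T j k i = T i j k := by
  rw [hT.swap₂, hT.swap₁]; simp

variable {F : Fin 8 → Fin 8 → Fin 8 → Fin 8 → ℝ}

/-- `T_{abi} F_{abjk}`. -/
def contr₂ (F : Fin 8 → Fin 8 → Fin 8 → Fin 8 → ℝ) (T : Fin 8 → Fin 8 → Fin 8 → ℝ)
    (i j k : Fin 8) : ℝ :=
  ∑ a, ∑ b, T a b i * F a b j k

/-- `T_{abc} F_{abcs}`. -/
def contr₃ (F : Fin 8 → Fin 8 → Fin 8 → Fin 8 → ℝ) (T : Fin 8 → Fin 8 → Fin 8 → ℝ)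
    (s : Fin 8) : ℝ :=
  ∑ a, ∑ b, ∑ c, T a b c * F a b c s

/-- `β_{ab} F_{abij}`. -/
def opPhi (F : Fin 8 → Fin 8 → Fin 8 → Fin 8 → ℝ) (β : Fin 8 → Fin 8 → ℝ)
    (i j : Fin 8) : ℝ :=
  ∑ a, ∑ b, β a b * F a b i j

namespace IsSpinArray

theorem swap₁₃₂₄ (hF : IsSpinArray F) (i j k l) : F k l i j = F i j k l := by
  rw [hF.swap₂, hF.swap₁, hF.swap₃, hF.swap₂]; simp

theorem rotate (hF : IsSpinArray F) (i j k l) : F l i j k = -F i j k l := by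
  rw [hF.swap₁, hF.swap₂, hF.swap₃]; simp

theorem self₁ (hF : IsSpinArray F) (i k l) : F i i k l = 0 := by
  linarith [hF.swap₁ i i k l]

theorem self₂ (hF : IsSpinArray F) (i j l) : F i j j l = 0 := by
  linarith [hF.swap₂ i j j l]

theorem self₂₄ (hF : IsSpinArray F) (i j l) : F i j l j = 0 := by
  rw [hF.swap₃, hF.self₂, neg_zero]

theorem self₁₃ (hF : IsSpinArray F) (i j l) : F i j i l = 0 := by
  rw [hF.swap₂, hF.self₁, neg_zero]

theorem self₁₄ (hF : IsSpinArray F) (i j k) : F i j k i = 0 := by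
  rw [hF.swap₃, hF.self₁₃, neg_zero]

/-- Trace of `contract` over the third index of each triple. The purely Kronecker part contributes 8
- 2 = 6. -/
theorem contract₂ (hF : IsSpinArray F) (i j k l) : ∑ p, ∑ q, F i j p q * F k l p q =
    6 * (kd i k * kd j l - kd i l * kd j k) - 4 * F i j k l := by
  simp only [hF.contract, Finset.sum_add_distrib, Finset.sum_sub_distrib, hF.self₂₄, hF.self₂,
    mul_zero, mul_sub]
  simp only [kd, mul_ite, ite_mul, mul_one, mul_zero, one_mul, zero_mul, Finset.sum_ite_eq,
    Finset.sum_ite_eq', Finset.mem_univ, if_true, Finset.sum_const, Finset.card_univ,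
    Fintype.card_fin, Finset.sum_ite_irrel, Finset.sum_const_zero, nsmul_eq_mul]
  rw [hF.swap₁ i j k l, hF.swap₃ i j k l]
  split_ifs <;> simp_all [hF.self₁₃, hF.self₁₄] <;> ring

/-- A further trace: 6 · (8 - 1) = 42, the constant in the normalization of the Lee form. -/
theorem contract₃ (hF : IsSpinArray F) (i j) :
    ∑ p, ∑ q, ∑ s, F i p q s * F j p q s = 42 * kd i j := by
  simp only [hF.contract₂, Finset.sum_sub_distrib, hF.self₂₄, mul_zero, mul_sub]
  simp only [kd, mul_ite, ite_mul, mul_one, mul_zero, one_mul, zero_mul, Finset.sum_ite_eq,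
    Finset.sum_ite_eq', Finset.mem_univ, if_true, Finset.sum_const, Finset.card_univ,
    Fintype.card_fin, Finset.sum_ite_irrel, Finset.sum_const_zero, nsmul_eq_mul]
  split_ifs <;> simp_all <;> norm_num

/-- The relation factors as (A - 2)(A + 6) = 0. The eigenspaces are Λ²₂₁ and Λ²₇, and all later
conclusions about 2-forms rest on these two eigenvalues. -/
theorem opPhi_opPhi (hF : IsSpinArray F) {β : Fin 8 → Fin 8 → ℝ} (hβ : ∀ i j, β j i = -β i j)
    (i j) : opPhi F (opPhi F β) i j = 12 * β i j - 4 * opPhi F β i j := by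
  have h : opPhi F (opPhi F β) i j =
      ∑ c, ∑ d, β c d * ∑ a, ∑ b, F c d a b * F i j a b := by
    simp only [opPhi, Finset.sum_mul, Finset.mul_sum]
    rw [Finset.sum_congr rfl fun a _ ↦ Finset.sum_comm, Finset.sum_comm]
    refine Finset.sum_congr rfl fun c _ ↦ ?_
    rw [Finset.sum_congr rfl fun a _ ↦ Finset.sum_comm, Finset.sum_comm]
    refine Finset.sum_congr rfl fun d _ ↦ Finset.sum_congr rfl fun a _ ↦
      Finset.sum_congr rfl fun b _ ↦ ?_
    rw [hF.swap₁₃₂₄ i j a b]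
    ring
  rw [h]
  simp only [hF.contract₂, mul_sub, Finset.sum_sub_distrib, opPhi, Finset.mul_sum]
  simp only [kd, mul_ite, ite_mul, mul_one, mul_zero, one_mul, zero_mul, Finset.sum_ite_eq,
    Finset.sum_ite_eq', Finset.mem_univ, if_true, Finset.sum_const, Finset.card_univ,
    Fintype.card_fin, Finset.sum_ite_irrel, Finset.sum_const_zero, nsmul_eq_mul]
  rw [hβ i j]
  simp only [mul_left_comm (β _ _) 4]
  ring

theorem contr₂_swap (hF : IsSpinArray F) (T : Fin 8 → Fin 8 → Fin 8 → ℝ) (i j k) :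
    contr₂ F T i k j = -contr₂ F T i j k := by
  simp only [contr₂, hF.swap₃ _ _ j k, mul_neg, Finset.sum_neg_distrib]

/-- A 3-form in terms of its contractions with the `Spin(7)`-form. -/
theorem contr₂_cyc (hF : IsSpinArray F) {T : Fin 8 → Fin 8 → Fin 8 → ℝ} (hT : IsAlt3 T)
    (i j k) : contr₂ F T i j k + contr₂ F T j k i + contr₂ F T k i j =
      2 * T i j k + (1 / 3) * ∑ s, contr₃ F T s * F s i j k := by
  have h0 : ∑ s, contr₃ F T s * F s i j k =
      -∑ a, ∑ b, ∑ c, T a b c * ∑ s, F a b c s * F i j k s := by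
    simp only [contr₃, Finset.sum_mul, Finset.mul_sum]
    rw [Finset.sum_comm, ← Finset.sum_neg_distrib]
    refine Finset.sum_congr rfl fun a _ ↦ ?_
    rw [Finset.sum_comm, ← Finset.sum_neg_distrib]
    refine Finset.sum_congr rfl fun b _ ↦ ?_
    rw [Finset.sum_comm, ← Finset.sum_neg_distrib]
    refine Finset.sum_congr rfl fun c _ ↦ ?_
    rw [← Finset.sum_neg_distrib]
    refine Finset.sum_congr rfl fun s _ ↦ ?_
    rw [hF.rotate i j k s]
    ring
  have h1 : ∀ i j k, ∑ a, ∑ b, ∑ c, T a b c * (kd a i * F b c j k) = contr₂ F T i j k := by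
    intro i j k
    simp [kd, contr₂, ← hT.cyc i]
  have h2 : ∀ i j k, ∑ a, ∑ b, ∑ c, T a b c * (kd b i * F c a j k) = contr₂ F T i j k := by
    intro i j k
    rw [Finset.sum_comm]
    simp only [kd, contr₂, ite_mul, one_mul, zero_mul, mul_ite, mul_zero, Finset.sum_ite_irrel,
      Finset.sum_const_zero, Finset.sum_ite_eq', Finset.mem_univ, if_true]
    rw [Finset.sum_comm]
    refine Finset.sum_congr rfl fun y _ ↦ Finset.sum_congr rfl fun x _ ↦ ?_
    rw [hT.cyc i y x, hT.cyc x i y]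
  have h3 : ∀ i j k, ∑ a, ∑ b, ∑ c, T a b c * (kd c i * F a b j k) = contr₂ F T i j k := by
    intro i j k
    simp [kd, contr₂]
  have h4 : ∀ i j k, ∑ a, ∑ b, ∑ c, T a b c * (kd a i * (kd b j * kd c k)) = T i j k := by
    intro i j k
    simp [kd]
  -- Summed over a, b, c, the six pure Kronecker terms give 6 T_{ijk} and the nine mixed ones give
  -- each cyclic `contr₂` three times. Hence τ_s F_{sijk} is three times the cyclic sum minus 6
  -- T_{ijk}.
  have h5 : ∀ a b c, T a b c * ∑ s, F a b c s * F i j k s =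
      T a b c * (kd a i * (kd b j * kd c k)) - T a b c * (kd a i * (kd b k * kd c j))
      - T a b c * (kd a j * (kd b i * kd c k)) + T a b c * (kd a j * (kd b k * kd c i))
      + T a b c * (kd a k * (kd b i * kd c j)) - T a b c * (kd a k * (kd b j * kd c i))
      - T a b c * (kd a i * F b c j k) - T a b c * (kd a j * F b c k i)
      - T a b c * (kd a k * F b c i j)
      - T a b c * (kd b i * F c a j k) - T a b c * (kd b j * F c a k i)
      - T a b c * (kd b k * F c a i j)
      - T a b c * (kd c i * F a b j k) - T a b c * (kd c j * F a b k i)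
      - T a b c * (kd c k * F a b i j) := by
    intro a b c
    rw [hF.contract]
    ring
  rw [h0]
  simp only [h5, Finset.sum_sub_distrib, Finset.sum_add_distrib, h1, h2, h3, h4]
  linarith [hT.swap₂ i j k, hT.swap₁ i j k, hT.cyc i j k, hT.cyc k i j, hT.swap₂ k i j]

/-- The 3-form built from contractions determines the Lee form. -/
theorem contr₃_contr₂_cyc (hF : IsSpinArray F) {T : Fin 8 → Fin 8 → Fin 8 → ℝ} (hT : IsAlt3 T)
    (s) : contr₃ F (fun i j k ↦ contr₂ F T i j k + contr₂ F T j k i + contr₂ F T k i j) s =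
      -12 * contr₃ F T s := by
  have h0 : ∑ i, ∑ j, ∑ k, (∑ t, contr₃ F T t * F t i j k) * F i j k s =
      -∑ t, contr₃ F T t * ∑ i, ∑ j, ∑ k, F t i j k * F s i j k := by
    simp only [Finset.sum_mul, Finset.mul_sum, ← Finset.sum_neg_distrib]
    rw [Finset.sum_congr rfl fun i _ ↦ Finset.sum_congr rfl fun j _ ↦ Finset.sum_comm]
    rw [Finset.sum_congr rfl fun i _ ↦ Finset.sum_comm, Finset.sum_comm]
    refine Finset.sum_congr rfl fun t _ ↦ Finset.sum_congr rfl fun i _ ↦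
      Finset.sum_congr rfl fun j _ ↦ Finset.sum_congr rfl fun k _ ↦ ?_
    rw [hF.rotate i j k s]
    ring
  -- The two terms on the right contribute 2 and -42/3 = -14 times τ.
  simp only [hF.contr₂_cyc hT]
  rw [contr₃]
  simp only [add_mul, Finset.sum_add_distrib, mul_assoc, ← Finset.mul_sum]
  rw [h0]
  simp only [hF.contract₃, kd]
  simp [contr₃]
  ring

/-- Infinitesimal stabilizers of the `Spin(7)`-form lie in `Λ²₂₁`. -/
theorem eq_half_opPhi (hF : IsSpinArray F) {ρ : Fin 8 → Fin 8 → ℝ} (hρ : ∀ i j, ρ j i = -ρ i j)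
    (h : ∀ i j k l, ∑ s, (ρ i s * F s j k l + ρ j s * F i s k l + ρ k s * F i j s l +
      ρ l s * F i j k s) = 0) (i m) : ρ i m = 1 / 2 * opPhi F ρ i m := by
  -- The stabilizer equation is contracted with F_{mjkl}. The first term gives 42ρ and each of the
  -- other three gives -6ρ - 4Aρ, so 24ρ = 12Aρ.
  have h0 : ∑ j, ∑ k, ∑ l, (∑ s, (ρ i s * F s j k l + ρ j s * F i s k l + ρ k s * F i j s l +
      ρ l s * F i j k s)) * F m j k l = 0 := by
    simp only [h, zero_mul, Finset.sum_const_zero]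
  simp only [Finset.sum_add_distrib, add_mul, Finset.sum_mul] at h0
  have h1 : ∑ j, ∑ k, ∑ l, ∑ s, ρ i s * F s j k l * F m j k l = 42 * ρ i m := by
    have : ∑ j, ∑ k, ∑ l, ∑ s, ρ i s * F s j k l * F m j k l =
        ∑ s, ρ i s * ∑ j, ∑ k, ∑ l, F s j k l * F m j k l := by
      simp only [Finset.mul_sum]
      rw [Finset.sum_congr rfl fun i _ ↦ Finset.sum_congr rfl fun j _ ↦ Finset.sum_comm]
      rw [Finset.sum_congr rfl fun i _ ↦ Finset.sum_comm, Finset.sum_comm]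
      simp only [mul_assoc]
    rw [this]
    simp only [hF.contract₃]
    simp [kd]
    ring
  have h2 : ∑ j, ∑ k, ∑ l, ∑ s, ρ j s * F i s k l * F m j k l =
      ∑ j, ∑ s, ρ j s * ∑ k, ∑ l, F i s k l * F m j k l := by
    simp only [Finset.mul_sum]
    refine Finset.sum_congr rfl fun j _ ↦ ?_
    rw [Finset.sum_congr rfl fun i _ ↦ Finset.sum_comm, Finset.sum_comm]
    simp only [mul_assoc]
  have h3 : ∑ j, ∑ k, ∑ l, ∑ s, ρ k s * F i j s l * F m j k l =
      ∑ j, ∑ s, ρ j s * ∑ k, ∑ l, F i s k l * F m j k l := by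
    rw [← h2, Finset.sum_comm]
    refine Finset.sum_congr rfl fun j _ ↦ Finset.sum_congr rfl fun k _ ↦
      Finset.sum_congr rfl fun l _ ↦ Finset.sum_congr rfl fun s _ ↦ ?_
    rw [hF.swap₂ i s k l, hF.swap₂ m j k l]
    ring
  have h4 : ∑ j, ∑ k, ∑ l, ∑ s, ρ l s * F i j k s * F m j k l =
      ∑ j, ∑ s, ρ j s * ∑ k, ∑ l, F i s k l * F m j k l := by
    rw [← h3]
    refine Finset.sum_congr rfl fun j _ ↦ ?_
    rw [Finset.sum_comm]
    refine Finset.sum_congr rfl fun k _ ↦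
      Finset.sum_congr rfl fun l _ ↦ Finset.sum_congr rfl fun s _ ↦ ?_
    rw [hF.swap₃ i j s l, hF.swap₃ m j k l]
    ring
  have h5 : ∑ j, ∑ s, ρ j s * ∑ k, ∑ l, F i s k l * F m j k l =
      -6 * ρ i m - 4 * opPhi F ρ i m := by
    have h0 : ∀ j, ρ j j = 0 := fun j ↦ by linarith [hρ j j]
    have h6 : ∀ j s, F i s m j = F j s i m := fun j s ↦ by
      rw [hF.swap₁₃₂₄ m j i s, hF.swap₁ j m i s, hF.swap₂ j i m s, hF.swap₃ j i s m,
        hF.swap₂ j s i m]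
      ring
    simp only [hF.contract₂, mul_sub, Finset.sum_sub_distrib, opPhi, Finset.mul_sum, h6]
    simp [kd, h0, mul_left_comm _ (4 : ℝ)]
    ring
  rw [h1, h2, h3, h4, h5] at h0
  linarith

end IsSpinArray

end Components

/-! ### Algebra of the curvature with skew torsion -/

section CurvatureComponents

variable {F : Fin 8 → Fin 8 → Fin 8 → Fin 8 → ℝ}

/-- `f_{ajs} F_{ajsv}`. -/
def contrLast (F : Fin 8 → Fin 8 → Fin 8 → Fin 8 → ℝ) (v : Fin 8)
    (f : Fin 8 → Fin 8 → Fin 8 → ℝ) : ℝ :=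
  ∑ a, ∑ j, ∑ s, f a j s * F a j s v

theorem contrLast_add (v) (f g : Fin 8 → Fin 8 → Fin 8 → ℝ) :
    contrLast F v (fun a j s ↦ f a j s + g a j s) = contrLast F v f + contrLast F v g := by
  simp only [contrLast, add_mul, Finset.sum_add_distrib]

theorem contrLast_neg (v) (f : Fin 8 → Fin 8 → Fin 8 → ℝ) :
    contrLast F v (fun a j s ↦ -f a j s) = -contrLast F v f := by
  simp only [contrLast, neg_mul, Finset.sum_neg_distrib]

theorem contrLast_mul (v) (c : ℝ) (f : Fin 8 → Fin 8 → Fin 8 → ℝ) :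
    contrLast F v (fun a j s ↦ c * f a j s) = c * contrLast F v f := by
  simp only [contrLast, mul_assoc, ← Finset.mul_sum]

theorem IsSpinArray.contrLast_swap (hF : IsSpinArray F) (v) (f : Fin 8 → Fin 8 → Fin 8 → ℝ) :
    contrLast F v (fun a j s ↦ f j a s) = -contrLast F v f := by
  rw [contrLast, contrLast, Finset.sum_comm]
  simp only [← Finset.sum_neg_distrib]
  refine Finset.sum_congr rfl fun j _ ↦ Finset.sum_congr rfl fun a _ ↦
    Finset.sum_congr rfl fun s _ ↦ ?_
  rw [hF.swap₁ j a s v, mul_neg]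

theorem IsSpinArray.contrLast_cyc (hF : IsSpinArray F) (v) (f : Fin 8 → Fin 8 → Fin 8 → ℝ) :
    contrLast F v (fun a j s ↦ f j s a) = contrLast F v f := by
  rw [contrLast, contrLast, Finset.sum_comm]
  refine Finset.sum_congr rfl fun j _ ↦ ?_
  rw [Finset.sum_comm]
  refine Finset.sum_congr rfl fun s _ ↦ Finset.sum_congr rfl fun a _ ↦ ?_
  rw [hF.swap₂ j a s v, hF.swap₁ a j s v, neg_neg]

theorem IsSpinArray.contrLast_cyc' (hF : IsSpinArray F) (v) (f : Fin 8 → Fin 8 → Fin 8 → ℝ) :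
    contrLast F v (fun a j s ↦ f s a j) = contrLast F v f := by
  rw [← hF.contrLast_cyc v fun a j s ↦ f s a j]

/-- The quadratic expression `T_{abs} T_{scd} + T_{bcs} T_{sad} + T_{cas} T_{sbd}`. -/
def torsionSq (T : Fin 8 → Fin 8 → Fin 8 → ℝ) (a b c d : Fin 8) : ℝ :=
  ∑ s, (T a b s * T s c d + T b c s * T s a d + T c a s * T s b d)

theorem IsAlt3.torsionSq_rotate {T : Fin 8 → Fin 8 → Fin 8 → ℝ} (hT : IsAlt3 T) (u a j s) :
    torsionSq T a j s u = -torsionSq T u a j s := by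
  simp only [torsionSq, ← Finset.sum_neg_distrib]
  refine Finset.sum_congr rfl fun t _ ↦ ?_
  rw [hT.swap₂ t u s, hT.cyc t j s, hT.cyc t u a, hT.swap₂ t a u, hT.cyc t j u, hT.cyc t s a,
    hT.swap₂ t a s]
  ring

/-- The components of the curvature of a `Spin(7)`-connection with skew torsion `T`, together
with those of the covariant derivative `N` of the torsion. -/
structure IsCurvatureArray (F : Fin 8 → Fin 8 → Fin 8 → Fin 8 → ℝ)
    (T : Fin 8 → Fin 8 → Fin 8 → ℝ) (N r : Fin 8 → Fin 8 → Fin 8 → Fin 8 → ℝ) : Prop where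
  spin : IsSpinArray F
  alt : IsAlt3 T
  altN : ∀ a, IsAlt3 (N a)
  swap₁ : ∀ a b c d, r b a c d = -r a b c d
  swap₂ : ∀ a b c d, r a b d c = -r a b c d
  stab : ∀ a b i j k l, ∑ s, (r a b i s * F s j k l + r a b j s * F i s k l +
    r a b k s * F i j s l + r a b l s * F i j k s) = 0
  bianchi : ∀ a b c d, r a b c d + r b c a d + r c a b d =
    N a b c d + N b c a d + N c a b d + torsionSq T a b c d

/-- `N_{uajs} F_{ajsv}`. -/
def divP (F N : Fin 8 → Fin 8 → Fin 8 → Fin 8 → ℝ) (u v : Fin 8) : ℝ := contr₃ F (N u) v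

/-- `N_{aujs} F_{ajsv}`. -/
def divQ (F N : Fin 8 → Fin 8 → Fin 8 → Fin 8 → ℝ) (u v : Fin 8) : ℝ :=
  contrLast F v fun a j s ↦ N a u j s

/-- The divergence `N_{aauv}`. -/
def divV (N : Fin 8 → Fin 8 → Fin 8 → Fin 8 → ℝ) (u v : Fin 8) : ℝ := ∑ a, N a a u v

/-- `τ_s T_{suv}` with `τ_s = T_{abc} F_{abcs}`. -/
def tauT (F : Fin 8 → Fin 8 → Fin 8 → Fin 8 → ℝ) (T : Fin 8 → Fin 8 → Fin 8 → ℝ)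
    (u v : Fin 8) : ℝ := ∑ s, contr₃ F T s * T s u v

namespace IsCurvatureArray

variable {T : Fin 8 → Fin 8 → Fin 8 → ℝ} {N r : Fin 8 → Fin 8 → Fin 8 → Fin 8 → ℝ}

/-- Because r(u,a) lies in Λ²₂₁, the trace becomes ½ r_{uajs} F_{ajsv}. Contraction with F is
unaffected by cyclic permutation of a, j, s, so r_{uajs} may be replaced by a third of its cyclic
sum, which the Bianchi identity determines. -/
theorem ricci_eq (h : IsCurvatureArray F T N r) (u v) :
    ∑ a, r a u v a = 1 / 4 * (divP F N u v - divQ F N u v) +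
      1 / 6 * contrLast F v fun a j s ↦ torsionSq T u a j s := by
  have hF := h.spin
  have h1 : ∑ a, r a u v a = 1 / 2 * contrLast F v (r u) := by
    rw [contrLast, Finset.mul_sum]
    refine Finset.sum_congr rfl fun a _ ↦ ?_
    rw [hF.eq_half_opPhi (ρ := r a u) (h.swap₂ a u) (h.stab a u) v a]
    congr 1
    rw [opPhi]
    refine Finset.sum_congr rfl fun j _ ↦ Finset.sum_congr rfl fun s _ ↦ ?_
    rw [h.swap₁ u a, hF.rotate j s v a]
    ring
  have h2 : 3 * contrLast F v (r u) = 1 / 2 * (3 * contrLast F v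
      (fun a j s ↦ N u a j s + N a j u s + N j u a s + torsionSq T u a j s) +
      contrLast F v fun a j s ↦ N a j s u + N j s a u + N s a j u + torsionSq T a j s u) := by
    have e1 : 3 * contrLast F v (r u) =
        contrLast F v fun a j s ↦ (r u a j s + r u j s a + r u s a j) := by
      rw [contrLast_add, contrLast_add, hF.contrLast_cyc v (r u), hF.contrLast_cyc' v (r u)]
      ring
    -- The combination of four Bianchi sums familiar from pair symmetry: terms with u in the second
    -- pair cancel, those with u in the first pair double.
    have e2 : contrLast F v (fun a j s ↦ (r u a j s + r u j s a + r u s a j)) =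
        contrLast F v fun a j s ↦ 1 / 2 *
          (((r u a j s + r a j u s + r j u a s) + (r u j s a + r j s u a + r s u j a) +
          (r u s a j + r s a u j + r a u s j)) + (r a j s u + r j s a u + r s a j u)) := by
      congr 1
      funext a j s
      linarith [h.swap₁ u a s j, h.swap₂ u a j s, h.swap₁ u j a s, h.swap₂ u j s a,
        h.swap₁ u s j a, h.swap₂ u s a j, h.swap₂ a j s u, h.swap₂ j s a u, h.swap₂ s a j u]
    rw [e1, e2, contrLast_mul, contrLast_add, contrLast_add, contrLast_add,
      hF.contrLast_cyc v fun a j s ↦ r u a j s + r a j u s + r j u a s,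
      hF.contrLast_cyc' v fun a j s ↦ r u a j s + r a j u s + r j u a s]
    simp only [h.bianchi]
    ring
  have q1 : contrLast F v (fun a j s ↦ N a j u s) = -divQ F N u v := by
    rw [divQ, ← contrLast_neg]
    simp only [(h.altN _).swap₁ u]
  have q2 : contrLast F v (fun a j s ↦ N j u a s) = -divQ F N u v :=
    hF.contrLast_swap v fun a j s ↦ N a u j s
  have q3 : contrLast F v (fun a j s ↦ N a j s u) = divQ F N u v := by
    rw [divQ]
    simp only [(h.altN _).cyc u]
  have q4 : contrLast F v (fun a j s ↦ N j s a u) = divQ F N u v := by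
    rw [← q3]; exact hF.contrLast_cyc v fun a j s ↦ N a j s u
  have q5 : contrLast F v (fun a j s ↦ N s a j u) = divQ F N u v := by
    rw [← q3]; exact hF.contrLast_cyc' v fun a j s ↦ N a j s u
  have q6 : contrLast F v (fun a j s ↦ N u a j s) = divP F N u v := rfl
  have q7 : contrLast F v (fun a j s ↦ torsionSq T a j s u) =
      -contrLast F v fun a j s ↦ torsionSq T u a j s := by
    rw [← contrLast_neg]
    congr 1
    funext a j s
    exact h.alt.torsionSq_rotate u a j s
  simp only [contrLast_add, q1, q2, q3, q4, q5, q6, q7] at h2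
  linarith

end IsCurvatureArray

/-- `T_{uat} T_{jst} F_{jsva}`. -/
def quadG (F : Fin 8 → Fin 8 → Fin 8 → Fin 8 → ℝ) (T : Fin 8 → Fin 8 → Fin 8 → ℝ)
    (u v : Fin 8) : ℝ := ∑ a, ∑ t, T u a t * contr₂ F T t v a

/-- The three terms of `torsionSq` differ by cyclic permutations of a, j, s, up to the symmetry of
T, so they contribute equally. -/
theorem contrLast_torsionSq (hF : IsSpinArray F) {T : Fin 8 → Fin 8 → Fin 8 → ℝ}
    (hT : IsAlt3 T) (u v) :
    contrLast F v (fun a j s ↦ torsionSq T u a j s) = -3 * quadG F T u v := by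
  have h0 : contrLast F v (fun a j s ↦ ∑ t, T u a t * T t j s) = -quadG F T u v := by
    rw [contrLast, quadG, ← Finset.sum_neg_distrib]
    refine Finset.sum_congr rfl fun a _ ↦ ?_
    simp only [Finset.sum_mul, contr₂, Finset.mul_sum, ← Finset.sum_neg_distrib]
    rw [Finset.sum_congr rfl fun j _ ↦ Finset.sum_comm, Finset.sum_comm]
    refine Finset.sum_congr rfl fun t _ ↦ Finset.sum_congr rfl fun j _ ↦
      Finset.sum_congr rfl fun s _ ↦ ?_
    rw [hF.rotate j s v a, hT.cyc t j s]
    ring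
  have h1 : contrLast F v (fun a j s ↦ ∑ t, T a j t * T t u s) = -quadG F T u v := by
    rw [← h0, ← hF.contrLast_cyc' v fun a j s ↦ ∑ t, T u a t * T t j s]
    congr 1
    funext a j s
    refine Finset.sum_congr rfl fun t _ ↦ ?_
    rw [hT.cyc t a j, hT.cyc t u s]
    ring
  have h2 : contrLast F v (fun a j s ↦ ∑ t, T j u t * T t a s) = -quadG F T u v := by
    rw [← h0, ← hF.contrLast_cyc v fun a j s ↦ ∑ t, T u a t * T t j s]
    congr 1
    funext a j s
    refine Finset.sum_congr rfl fun t _ ↦ ?_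
    rw [hT.swap₁ u j t, hT.swap₂ t s a]
    ring
  simp only [torsionSq, Finset.sum_add_distrib, contrLast_add, h0, h1, h2]
  ring

/-- The cyclic identity for T, contracted with T_{uat}, expresses 2 `quadG` through terms symmetric
in u, v and one term linear in τ. Only the latter has a skew part. -/
theorem quadG_skew (hF : IsSpinArray F) {T : Fin 8 → Fin 8 → Fin 8 → ℝ}
    (hT : IsAlt3 T) (u v) :
    quadG F T u v - quadG F T v u =
      -(1 / 6) * (2 * tauT F T u v - opPhi F (tauT F T) u v) := by
  -- the cyclic identity, contracted with `T_{uat}`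
  have key : ∀ u v, 2 * quadG F T u v + ∑ a, ∑ t, T u a t * contr₂ F T v a t =
      2 * (∑ a, ∑ t, T u a t * T t v a) -
        1 / 3 * ∑ s, contr₃ F T s * contr₂ F T u v s := by
    intro u v
    have e1 : quadG F T u v = ∑ a, ∑ t, T u a t * contr₂ F T a t v := by
      rw [quadG, Finset.sum_comm]
      refine Finset.sum_congr rfl fun a _ ↦ Finset.sum_congr rfl fun t _ ↦ ?_
      rw [hT.swap₂ u a t, hF.contr₂_swap T a t v]
      ring
    have e2 : ∑ a, ∑ t, T u a t * ∑ s, contr₃ F T s * F s t v a =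
        -∑ s, contr₃ F T s * contr₂ F T u v s := by
      simp only [contr₂, Finset.mul_sum, ← Finset.sum_neg_distrib]
      rw [Finset.sum_congr rfl fun j _ ↦ Finset.sum_comm, Finset.sum_comm]
      refine Finset.sum_congr rfl fun s _ ↦ Finset.sum_congr rfl fun a _ ↦
        Finset.sum_congr rfl fun t _ ↦ ?_
      rw [hT.cyc u a t, hF.rotate t v a s, hF.swap₂ t a v s, hF.swap₁ a t v s]
      ring
    have e3 : ∀ a t, T u a t * contr₂ F T t v a + T u a t * contr₂ F T v a t +
        T u a t * contr₂ F T a t v = 2 * (T u a t * T t v a) +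
          1 / 3 * (T u a t * ∑ s, contr₃ F T s * F s t v a) := by
      intro a t
      linear_combination T u a t * hF.contr₂_cyc hT t v a
    have e4 := Finset.sum_congr rfl fun (a : Fin 8) (_ : a ∈ Finset.univ) ↦
      Finset.sum_congr rfl fun (t : Fin 8) (_ : t ∈ Finset.univ) ↦ e3 a t
    simp only [Finset.sum_add_distrib, ← Finset.mul_sum] at e4
    rw [e2, ← e1] at e4
    rw [quadG] at e4 ⊢
    linarith
  -- This sum and the next are symmetric in u and v, so they drop out of the difference.
  have s1 : ∑ a, ∑ t, T u a t * contr₂ F T v a t = ∑ a, ∑ t, T v a t * contr₂ F T u a t := by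
    simp only [contr₂, Finset.mul_sum]
    rw [Finset.sum_congr rfl fun j _ ↦ Finset.sum_comm, Finset.sum_comm]
    refine Finset.sum_congr rfl fun a _ ↦ ?_
    rw [Finset.sum_congr rfl fun j _ ↦ Finset.sum_comm, Finset.sum_comm]
    refine Finset.sum_congr rfl fun b _ ↦ Finset.sum_congr rfl fun c _ ↦
      Finset.sum_congr rfl fun d _ ↦ ?_
    rw [hF.swap₁₃₂₄ c d a b, hT.cyc v a b, ← hT.cyc u c d]
    ring
  have s2 : ∑ a, ∑ t, T u a t * T t v a = ∑ a, ∑ t, T v a t * T t u a := by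
    refine Finset.sum_congr rfl fun a _ ↦ Finset.sum_congr rfl fun t _ ↦ ?_
    rw [← hT.cyc t v a, ← hT.cyc t u a]
    ring
  -- The cyclic identity again, now contracted with τ; the term τ_s τ_t F_{tsuv} vanishes by
  -- skewness.
  have s3 : ∑ s, contr₃ F T s * contr₂ F T u v s - ∑ s, contr₃ F T s * contr₂ F T v u s =
      2 * tauT F T u v - opPhi F (tauT F T) u v := by
    have e1 : ∀ s, contr₃ F T s * contr₂ F T u v s - contr₃ F T s * contr₂ F T v u s =
        2 * (contr₃ F T s * T s u v) + 1 / 3 * (∑ t, contr₃ F T s * (contr₃ F T t * F t s u v)) -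
          contr₃ F T s * contr₂ F T s u v := by
      intro s
      rw [← Finset.mul_sum]
      linear_combination contr₃ F T s * hF.contr₂_cyc hT s u v -
        contr₃ F T s * hF.contr₂_swap T v s u
    have e2 : ∑ s, ∑ t, contr₃ F T s * (contr₃ F T t * F t s u v) = 0 := by
      have : ∑ s, ∑ t, contr₃ F T s * (contr₃ F T t * F t s u v) =
          -∑ s, ∑ t, contr₃ F T s * (contr₃ F T t * F t s u v) := by
        conv_lhs => rw [Finset.sum_comm]
        simp only [← Finset.sum_neg_distrib]
        refine Finset.sum_congr rfl fun s _ ↦ Finset.sum_congr rfl fun t _ ↦ ?_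
        rw [hF.swap₁ t s u v]
        ring
      linarith
    have e3 : ∑ s, contr₃ F T s * contr₂ F T s u v = opPhi F (tauT F T) u v := by
      simp only [contr₂, opPhi, tauT, Finset.mul_sum, Finset.sum_mul]
      rw [Finset.sum_comm]
      refine Finset.sum_congr rfl fun a _ ↦ ?_
      rw [Finset.sum_comm]
      refine Finset.sum_congr rfl fun b _ ↦ Finset.sum_congr rfl fun s _ ↦ ?_
      rw [hT.cyc s a b]
      ring
    rw [← Finset.sum_sub_distrib]
    simp only [e1, Finset.sum_sub_distrib, Finset.sum_add_distrib, ← Finset.mul_sum]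
    simp only [Finset.mul_sum] at e2 ⊢
    rw [← e3]
    simp only [← Finset.mul_sum] at e2 ⊢
    rw [e2]
    simp [tauT, Finset.mul_sum]
  linarith [key u v, key v u]

/-- Q_{uv} is minus the trace over a of `contr₂ F (N a) u v a`. Its skew part collects two of the
three cyclic terms for the 3-form N_a, and the cyclic identity replaces them by the third one,
N_{aauv} and a contraction of P with F. -/
theorem divQ_skew (hF : IsSpinArray F) {N : Fin 8 → Fin 8 → Fin 8 → Fin 8 → ℝ}
    (hN : ∀ a, IsAlt3 (N a)) (u v) :
    divQ F N u v - divQ F N v u = -2 * divV N u v +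
      1 / 6 * opPhi F (fun a b ↦ divP F N a b - divP F N b a) u v + opPhi F (divV N) u v := by
  have q : ∀ u v, divQ F N u v = -∑ a, contr₂ F (N a) u v a := by
    intro u v
    simp only [divQ, contrLast, contr₂, ← Finset.sum_neg_distrib]
    refine Finset.sum_congr rfl fun a _ ↦ Finset.sum_congr rfl fun j _ ↦
        Finset.sum_congr rfl fun s _ ↦ ?_
    rw [hF.rotate j s v a, (hN a).cyc u j s]
    ring
  have e1 : ∀ a, contr₂ F (N a) u v a - contr₂ F (N a) v u a =
      2 * N a a u v + 1 / 3 * ∑ s, divP F N a s * F s a u v - contr₂ F (N a) a u v := by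
    intro a
    have := hF.contr₂_cyc (hN a) a u v
    simp only [divP]
    linarith [hF.contr₂_swap (N a) v a u]
  have e2 : ∑ a, contr₂ F (N a) a u v = opPhi F (divV N) u v := by
    simp only [contr₂, opPhi, divV, Finset.sum_mul]
    rw [Finset.sum_comm]
    refine Finset.sum_congr rfl fun a _ ↦ ?_
    rw [Finset.sum_comm]
    refine Finset.sum_congr rfl fun b _ ↦ Finset.sum_congr rfl fun s _ ↦ ?_
    rw [(hN s).cyc s a b]
  have e3 : ∑ a, ∑ s, divP F N a s * F s a u v =
      -(1 / 2) * opPhi F (fun a b ↦ divP F N a b - divP F N b a) u v := by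
    simp only [opPhi, sub_mul, Finset.sum_sub_distrib]
    have f1 : ∑ a, ∑ b, divP F N b a * F a b u v = ∑ a, ∑ s, divP F N a s * F s a u v :=
      Finset.sum_comm
    have f2 : ∑ a, ∑ b, divP F N a b * F a b u v = -∑ a, ∑ s, divP F N a s * F s a u v := by
      simp only [← Finset.sum_neg_distrib]
      refine Finset.sum_congr rfl fun a _ ↦ Finset.sum_congr rfl fun b _ ↦ ?_
      rw [hF.swap₁ a b u v]
      ring
    rw [f1, f2]
    ring
  have e4 : divQ F N u v - divQ F N v u =
      -∑ a, (contr₂ F (N a) u v a - contr₂ F (N a) v u a) := by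
    rw [q, q, Finset.sum_sub_distrib]
    ring
  rw [e4]
  simp only [e1, Finset.sum_sub_distrib, Finset.sum_add_distrib, ← Finset.mul_sum]
  rw [e2, e3, divV]
  ring

/-- The relation between the divergence of the torsion and the exterior derivative of the
Lee form. -/
theorem IsCurvatureArray.divV_relation {T : Fin 8 → Fin 8 → Fin 8 → ℝ}
    {N r : Fin 8 → Fin 8 → Fin 8 → Fin 8 → ℝ} (h : IsCurvatureArray F T N r)
    (hV : ∀ u v, ∑ a, r a u v a - ∑ a, r a v u a = divV N u v) (u v) :
    2 * divV N u v + opPhi F (divV N) u v = (divP F N u v - divP F N v u)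
      - 1 / 6 * opPhi F (fun a b ↦ divP F N a b - divP F N b a) u v
      + 2 / 3 * tauT F T u v - 1 / 3 * opPhi F (tauT F T) u v := by
  have h1 := hV u v
  rw [h.ricci_eq, h.ricci_eq, contrLast_torsionSq h.spin h.alt,
    contrLast_torsionSq h.spin h.alt] at h1
  linarith [divQ_skew h.spin h.altN u v, quadG_skew h.spin h.alt u v]

/-- Two relations between 2-forms that are equivalent by the spectrum of `opPhi`. -/
theorem IsSpinArray.eq_zero_iff (hF : IsSpinArray F) {V W X : Fin 8 → Fin 8 → ℝ}
    (hV : ∀ i j, V j i = -V i j) (hW : ∀ i j, W j i = -W i j) (hX : ∀ i j, X j i = -X i j)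
    (h : ∀ i j, 2 * V i j + opPhi F V i j = W i j - 1 / 6 * opPhi F W i j + 2 / 3 * X i j
      - 1 / 3 * opPhi F X i j) :
    (∀ i j, V i j = 0) ↔ ∀ i j, W i j = -(1 / 3) * X i j + 1 / 6 * opPhi F X i j := by
  have hlin : ∀ (a b : ℝ) (Y Z : Fin 8 → Fin 8 → ℝ) i j,
      opPhi F (fun i j ↦ a * Y i j + b * Z i j) i j = a * opPhi F Y i j + b * opPhi F Z i j := by
    intro a b Y Z i j
    simp only [opPhi, add_mul, Finset.sum_add_distrib, mul_assoc, ← Finset.mul_sum]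
  constructor
  · intro h0 i j
    have e0 : V = fun _ _ ↦ 0 := by funext i j; exact h0 i j
    have e1 : ∀ i j, 1 * W i j + -(1 / 6) * opPhi F W i j =
        -(2 / 3) * X i j + 1 / 3 * opPhi F X i j := by
      intro i j
      have := h i j
      simp only [e0, opPhi, zero_mul, Finset.sum_const_zero, mul_zero, add_zero] at this
      simp only [opPhi]
      linarith
    -- Applying A once more separates the eigenspaces: W = 0 on Λ²₂₁ and W = -(4/3)X on Λ²₇.
    have e2 := congrArg (fun Y ↦ opPhi F Y i j) (funext fun i ↦ funext fun j ↦ e1 i j)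
    simp only [hlin, hF.opPhi_opPhi hW, hF.opPhi_opPhi hX] at e2
    linarith [e1 i j]
  · intro h0
    have e0 : W = fun i j ↦ -(1 / 3) * X i j + 1 / 6 * opPhi F X i j := by
      funext i j; exact h0 i j
    have e1 : ∀ i j, 2 * V i j + 1 * opPhi F V i j = 0 := by
      intro i j
      have := h i j
      rw [e0] at this
      simp only [hlin, hF.opPhi_opPhi hX] at this
      linarith
    intro i j
    -- The operator 2 + A has eigenvalues 4 and -4, so it is injective; a second application of A
    -- eliminates AV.
    have e2 := congrArg (fun Y ↦ opPhi F Y i j) (funext fun i ↦ funext fun j ↦ e1 i j)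
    simp only [hlin, hF.opPhi_opPhi hV] at e2
    have e3 : opPhi F (fun _ _ ↦ 0) i j = 0 := by simp [opPhi]
    rw [e3] at e2
    linarith [e1 i j]

/-- W = (1/6)(A - 2)X, and (A + 6)(A - 2) = 0. -/
theorem IsSpinArray.eq_neg_opPhi (hF : IsSpinArray F) {W X : Fin 8 → Fin 8 → ℝ}
    (hX : ∀ i j, X j i = -X i j)
    (h : ∀ i j, W i j = -(1 / 3) * X i j + 1 / 6 * opPhi F X i j) (i j) :
    W i j = -(1 / 6) * opPhi F W i j := by
  have hlin : ∀ (a b : ℝ) (Y Z : Fin 8 → Fin 8 → ℝ) i j,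
      opPhi F (fun i j ↦ a * Y i j + b * Z i j) i j = a * opPhi F Y i j + b * opPhi F Z i j := by
    intro a b Y Z i j
    simp only [opPhi, add_mul, Finset.sum_add_distrib, mul_assoc, ← Finset.mul_sum]
  have e0 : W = fun i j ↦ -(1 / 3) * X i j + 1 / 6 * opPhi F X i j := by
    funext i j; exact h i j
  rw [e0]
  simp only [hlin, hF.opPhi_opPhi hX]
  ring

end CurvatureComponents

/-! ### Coordinate fields and symmetry of second derivatives -/

section CoordinateFields

open Filter Topology

variable {M : Type*} [TopologicalSpace M] [ChartedSpace E8 M] [IsManifold I8 ∞ M]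

/-- Differentiability of a vector field at a point. -/
abbrev DiffAt (Y : (y : M) → TangentSpace I8 y) (x : M) : Prop :=
  MDifferentiableAt I8 I8.tangent (fun y ↦ (⟨y, Y y⟩ : TangentBundle I8 M)) x

/-- Smoothness of a vector field at a point. -/
abbrev SmoothAt (Y : (y : M) → TangentSpace I8 y) (x : M) : Prop :=
  ContMDiffAt I8 I8.tangent ∞ (fun y ↦ (⟨y, Y y⟩ : TangentBundle I8 M)) x

theorem SmoothAt.diffAt {Y : (y : M) → TangentSpace I8 y} {x : M} (h : SmoothAt Y x) :
    DiffAt Y x :=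
  ContMDiffAt.mdifferentiableAt h (by simp)

/-- The differential at `y` of the chart at `x`. -/
def chartDeriv (x y : M) : TM y →L[ℝ] E8 :=
  (trivializationAt E8 (TangentSpace I8) x).continuousLinearMapAt ℝ y

theorem extV_eq {x y : M} (v : TM x) (hy : y ∈ (chartAt E8 x).source) : extV v y =
    (trivializationAt E8 (TangentSpace I8) x).symmL ℝ y (chartDeriv x x v) := by
  have h := (trivializationAt E8 (TangentSpace I8 : M → Type _) x).coe_linearMapAt_of_mem (R := ℝ)
    (FiberBundle.mem_baseSet_trivializationAt' x)
  have hb : y ∈ (trivializationAt E8 (TangentSpace I8) x).baseSet := hy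
  rw [chartDeriv, Trivialization.continuousLinearMapAt_apply, h, Trivialization.symmL_apply _ hb]
  rfl

theorem extV_self {x : M} (v : TM x) : extV v x = v := extend_apply_self E8 v

theorem eventually_smoothAt_extV {x : M} (v : TM x) :
    ∀ᶠ y in 𝓝 x, SmoothAt (extV v) y := by
  obtain ⟨s, hs, h⟩ := exists_contMDiffOn_extend (k := ∞) I8 E8 v
  filter_upwards [eventually_mem_nhds_iff.2 hs] with y hy
  exact h.contMDiffAt hy

theorem smoothAt_extV {x : M} (v : TM x) : SmoothAt (extV v) x :=
  (eventually_smoothAt_extV v).self_of_nhds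

theorem eventually_diffAt_extV {x : M} (v : TM x) : ∀ᶠ y in 𝓝 x, DiffAt (extV v) y :=
  (eventually_smoothAt_extV v).mono fun _ h ↦ h.diffAt

theorem diffAt_extV {x : M} (v : TM x) : DiffAt (extV v) x := (smoothAt_extV v).diffAt

/-- The field `extV v` has constant coordinates in the chart at `x`. -/
theorem chartDeriv_extV {x y : M} (v : TM x) (hy : y ∈ (chartAt E8 x).source) :
    chartDeriv x y (extV v y) = chartDeriv x x v := by
  rw [extV_eq v hy, chartDeriv]
  exact Trivialization.continuousLinearMapAt_symmL _ hy _

theorem mfderiv_extChartAt {x y : M} (hy : y ∈ (chartAt E8 x).source) :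
    mfderiv I8 𝓘(ℝ, E8) (extChartAt I8 x) y = chartDeriv x y :=
  (TangentBundle.continuousLinearMapAt_trivializationAt (I := I8) hy).symm

/-- The vector field on the model space with constant value `c`. -/
def constField (c : E8) (z : E8) : TangentSpace 𝓘(ℝ, E8) z := c

theorem mdifferentiableAt_constField (c z : E8) :
    MDifferentiableAt 𝓘(ℝ, E8) 𝓘(ℝ, E8).tangent
      (fun z ↦ (⟨z, constField c z⟩ : TangentBundle 𝓘(ℝ, E8) E8)) z := by
  have h : ContMDiffAt 𝓘(ℝ, E8) 𝓘(ℝ, E8).tangent 1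
      (fun z ↦ (⟨z, constField c z⟩ : TangentBundle 𝓘(ℝ, E8) E8)) z :=
    contMDiffAt_vectorSpace_iff_contDiffAt.2 (contDiffAt_const (c := c))
  exact h.mdifferentiableAt (by simp)

theorem mlieBracket_constField (c c' : E8) :
    mlieBracket 𝓘(ℝ, E8) (constField c) (constField c') = 0 := by
  rw [← mlieBracketWithin_univ, mlieBracketWithin_eq_lieBracketWithin]
  funext z
  change fderivWithin ℝ (fun _ : E8 ↦ c') Set.univ z c -
    fderivWithin ℝ (fun _ : E8 ↦ c) Set.univ z c' = 0
  simp

/-- Identifies `extV v` as the pullback of a constant field by the chart. Brackets commute with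
pullback, so such fields commute near x. -/
theorem extV_eventuallyEq_mpullback {x : M} (v : TM x) :
    extV v =ᶠ[𝓝 x] mpullback I8 𝓘(ℝ, E8) (extChartAt I8 x) (constField (chartDeriv x x v)) := by
  filter_upwards [(chartAt E8 x).open_source.mem_nhds (mem_chart_source E8 x)] with y hy
  have hi : (mfderiv I8 𝓘(ℝ, E8) (extChartAt I8 x) y).IsInvertible :=
    isInvertible_mfderiv_extChartAt (by rwa [extChartAt_source])
  rw [mpullback_apply]
  have h : constField (chartDeriv x x v) (extChartAt I8 x y) =
      mfderiv I8 𝓘(ℝ, E8) (extChartAt I8 x) y (extV v y) := by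
    rw [mfderiv_extChartAt hy]
    exact (chartDeriv_extV v hy).symm
  rw [h]
  exact (hi.inverse_apply_self _).symm

theorem minSmoothness_two_le : minSmoothness ℝ 2 ≤ ∞ := by
  rw [minSmoothness_of_isRCLikeNormedField]
  exact WithTop.coe_le_coe.2 (le_top : (2 : ℕ∞) ≤ ⊤)

/-- The fields `extV u` and `extV v` commute near `x`. -/
theorem eventually_mlieBracket_extV {x : M} (u v : TM x) :
    ∀ᶠ y in 𝓝 x, mlieBracket I8 (extV u) (extV v) y = 0 := by
  filter_upwards [(extV_eventuallyEq_mpullback u).eventually_nhds,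
    (extV_eventuallyEq_mpullback v).eventually_nhds,
    (chartAt E8 x).open_source.mem_nhds (mem_chart_source E8 x)] with y hu hv hy
  have hf : ContMDiffAt I8 𝓘(ℝ, E8) ∞ (extChartAt I8 x) y := contMDiffAt_extChartAt' hy
  have : IsManifold I8 (minSmoothness ℝ 2) M := by
    rw [minSmoothness_of_isRCLikeNormedField]
    infer_instance
  rw [EventuallyEq.mlieBracket_vectorField_eq hu hv, ← mpullback_mlieBracket (n := ∞)
    (mdifferentiableAt_constField _ _) (mdifferentiableAt_constField _ _) hf minSmoothness_two_le,
    mlieBracket_constField, mpullback_zero]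
  rfl

theorem mlieBracket_extV {x : M} (u v : TM x) : mlieBracket I8 (extV u) (extV v) x = 0 :=
  (eventually_mlieBracket_extV u v).self_of_nhds

theorem mvfderiv_congr {M : Type*} [TopologicalSpace M] [ChartedSpace E8 M] {y : M} {f f' : M → ℝ} (h : f =ᶠ[𝓝 y] f') :
    mvfderiv I8 f y = mvfderiv I8 f' y := by
  ext w
  change mfderiv I8 𝓘(ℝ, ℝ) f y w = mfderiv I8 𝓘(ℝ, ℝ) f' y w
  rw [h.mfderiv_eq]
  rfl

theorem mvfderiv_eq_fderiv {x y : M} {f : M → ℝ} (hy : y ∈ (chartAt E8 x).source)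
    (hf : MDifferentiableAt I8 𝓘(ℝ, ℝ) f y) (w : TM y) :
    mvfderiv I8 f y w =
      fderiv ℝ (f ∘ (extChartAt I8 x).symm) (extChartAt I8 x y) (chartDeriv x y w) := by
  have hs : y ∈ (extChartAt I8 x).source := by rwa [extChartAt_source]
  have ht : extChartAt I8 x y ∈ (extChartAt I8 x).target := (extChartAt I8 x).map_source hs
  have hl : (extChartAt I8 x).symm (extChartAt I8 x y) = y := (extChartAt I8 x).left_inv hs
  have h1 : MDifferentiableAt 𝓘(ℝ, E8) 𝓘(ℝ, ℝ) (f ∘ (extChartAt I8 x).symm)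
      (extChartAt I8 x y) := by
    refine MDifferentiableAt.comp_of_eq (extChartAt I8 x y) hf ?_ hl
    exact (contMDiffOn_extChartAt_symm (n := 1) x).contMDiffAt
      ((isOpen_extChartAt_target x).mem_nhds ht) |>.mdifferentiableAt (by simp)
  have h2 : f =ᶠ[𝓝 y] (f ∘ (extChartAt I8 x).symm) ∘ extChartAt I8 x := by
    filter_upwards [(isOpen_extChartAt_source x).mem_nhds hs] with z hz
    rw [Function.comp_apply, Function.comp_apply, (extChartAt I8 x).left_inv hz]
  rw [mvfderiv_congr h2, mvfderiv_comp_apply y h1 (mdifferentiableAt_extChartAt hy),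
    mfderiv_extChartAt hy]
  change mfderiv 𝓘(ℝ, E8) 𝓘(ℝ, ℝ) (f ∘ (extChartAt I8 x).symm) (extChartAt I8 x y)
    (chartDeriv x y w) = _
  rw [mfderiv_eq_fderiv]
  rfl

/-- Second derivatives along coordinate fields commute. -/
theorem mvfderiv_mvfderiv_extV_comm {x : M} {f : M → ℝ} (hf : ContMDiffAt I8 𝓘(ℝ, ℝ) ∞ f x)
    (u v : TM x) :
    mvfderiv I8 (fun y ↦ mvfderiv I8 f y (extV v y)) x u =
      mvfderiv I8 (fun y ↦ mvfderiv I8 f y (extV u y)) x v := by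
  have hx := mem_chart_source E8 x
  have hs : x ∈ (extChartAt I8 x).source := by rwa [extChartAt_source]
  have hc : ContDiffAt ℝ ∞ (f ∘ (extChartAt I8 x).symm) (extChartAt I8 x x) := by
    rw [← contMDiffAt_iff_contDiffAt]
    refine ContMDiffAt.comp_of_eq (y := x) hf ?_ ((extChartAt I8 x).left_inv hs)
    exact (contMDiffOn_extChartAt_symm (n := ∞) x).contMDiffAt
      ((isOpen_extChartAt_target x).mem_nhds ((extChartAt I8 x).map_source hs))
  have hd : ∀ w : TM x, DifferentiableAt ℝ
      (fun z ↦ fderiv ℝ (f ∘ (extChartAt I8 x).symm) z (chartDeriv x x w)) (extChartAt I8 x x) :=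
    fun w ↦ (((hc.fderiv_right (m := ∞) (by simp)).differentiableAt (by simp)).clm_apply
      (differentiableAt_const _))
  -- In the chart at x the inner field is constant, so the iterated derivative is the Hessian with
  -- no first-order term.
  have key : ∀ u v : TM x, mvfderiv I8 (fun y ↦ mvfderiv I8 f y (extV v y)) x u =
      fderiv ℝ (fderiv ℝ (f ∘ (extChartAt I8 x).symm)) (extChartAt I8 x x)
        (chartDeriv x x u) (chartDeriv x x v) := by
    intro u v
    have h1 : (fun y ↦ mvfderiv I8 f y (extV v y)) =ᶠ[𝓝 x]
        (fun z ↦ fderiv ℝ (f ∘ (extChartAt I8 x).symm) z (chartDeriv x x v)) ∘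
          extChartAt I8 x := by
      have hf1 : ContMDiffAt I8 𝓘(ℝ, ℝ) 1 f x := hf.of_le (by simp)
      filter_upwards [(chartAt E8 x).open_source.mem_nhds hx, contMDiffAt_iff_contMDiffAt_nhds (by simp) |>.1 hf1]
        with y hy hfy
      rw [mvfderiv_eq_fderiv hy (hfy.mdifferentiableAt (by simp)), chartDeriv_extV v hy]
      rfl
    rw [mvfderiv_congr h1, mvfderiv_comp_apply x (hd v).mdifferentiableAt
      (mdifferentiableAt_extChartAt hx), mfderiv_extChartAt hx]
    change mfderiv 𝓘(ℝ, E8) 𝓘(ℝ, ℝ) _ (extChartAt I8 x x) (chartDeriv x x u) = _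
    rw [mfderiv_eq_fderiv]
    rw [fderiv_clm_apply ((hc.fderiv_right (m := ∞) (by simp)).differentiableAt (by simp))
      (differentiableAt_const _), fderiv_fun_const]
    simp only [Pi.zero_apply, ContinuousLinearMap.comp_zero, zero_add]
    rfl
  rw [key, key]
  exact (hc.isSymmSndFDerivAt minSmoothness_two_le).eq _ _

end CoordinateFields

/-! ### Adapted frames and the components of Φ -/

section AdaptedFrames

open Filter Topology

variable {M : Type*} [TopologicalSpace M] [ChartedSpace E8 M] [IsManifold I8 ∞ M]
  [RiemannianBundle (fun x : M => TangentSpace I8 x)]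

namespace Structure

/-- A smooth frame near `x` that is adapted to the `Spin(7)`-structure. -/
theorem exists_adapted_frame (S : Structure M) (x : M) :
    ∃ e : Fin 8 → (y : M) → TangentSpace I8 y, ∀ᶠ y in 𝓝 x, (∀ i, SmoothAt (e i) y) ∧
      ∃ b : OrthonormalBasis (Fin 8) ℝ (TM y), (∀ i, b i = e i y) ∧
        IsAdapted (S.Phi y) (S.vol y) b := by
  obtain ⟨U, hU, hx, e, he, h⟩ := S.exists_frame x
  refine ⟨e, ?_⟩
  filter_upwards [hU.mem_nhds hx] with y hy
  refine ⟨fun i ↦ (he i).contMDiffAt (hU.mem_nhds hy), ?_⟩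
  obtain ⟨ho, hv, hp⟩ := h y hy
  have hcard : Fintype.card (Fin 8) = Module.finrank ℝ (TM y) := by
    rw [finrank_TM, Fintype.card_fin]
  have hs : ⊤ ≤ Submodule.span ℝ (Set.range fun i ↦ e i y) :=
    (ho.linearIndependent.span_eq_top_of_card_eq_finrank' hcard).ge
  refine ⟨OrthonormalBasis.mk ho hs, fun i ↦ by rw [OrthonormalBasis.coe_mk], ⟨?_, ?_⟩⟩
  · rw [OrthonormalBasis.coe_mk]; exact hv
  · intro i j k l
    rw [OrthonormalBasis.coe_mk]
    have h1 := hp ![i, j, k, l]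
    rw [stdPhi_eq_phiTab] at h1
    rw [← show phiTab (![i, j, k, l] 0) (![i, j, k, l] 1) (![i, j, k, l] 2) (![i, j, k, l] 3) =
      phiTab i j k l from rfl, ← h1]
    congr 1
    ext a
    fin_cases a <;> rfl

theorem exists_isAdapted (S : Structure M) (x : M) :
    ∃ b : OrthonormalBasis (Fin 8) ℝ (TM x), IsAdapted (S.Phi x) (S.vol x) b := by
  obtain ⟨e, he⟩ := S.exists_adapted_frame x
  obtain ⟨-, b, -, hb⟩ := he.self_of_nhds
  exact ⟨b, hb⟩

/-- The components of `Φ` in the orthonormal basis `onb x`. -/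
def phiArray (S : Structure M) (x : M) (i j k l : Fin 8) : ℝ :=
  S.Phi x ![onb x i, onb x j, onb x k, onb x l]

/-- The basis `onb x` need not be adapted; the contraction identity holds in it because it is
tensorial. -/
theorem isSpinArray_phiArray (S : Structure M) (x : M) : IsSpinArray (S.phiArray x) where
  swap₁ _ _ _ _ := alt4_swap₁ (S.Phi x) _ _ _ _
  swap₂ _ _ _ _ := alt4_swap₂ (S.Phi x) _ _ _ _
  swap₃ _ _ _ _ := alt4_swap₃ (S.Phi x) _ _ _ _
  contract i j k a b c := by
    obtain ⟨e, he⟩ := S.exists_isAdapted x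
    have h := he.contractionForm_eq_zero (onb x) (onb x i) (onb x j) (onb x k) (onb x a) (onb x b)
      (onb x c)
    simp only [contractionForm, OrthonormalBasis.inner_eq_ite] at h
    simp only [phiArray, kd]
    rw [alt4_swap₁ (S.Phi x) (onb x i) (onb x k) (onb x b), alt4_swap₁ (S.Phi x) (onb x i) (onb x k)
      (onb x c), alt4_swap₁ (S.Phi x) (onb x i) (onb x k) (onb x a)]
    linarith

end Structure

end AdaptedFrames

/-! ### Differentiability of ∇, Φ and the torsion -/

section Smoothness

open Filter Topology

variable {M : Type*} [TopologicalSpace M] [ChartedSpace E8 M] [IsManifold I8 ∞ M]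

theorem DiffAt.congr {Y Z : (y : M) → TangentSpace I8 y} {x : M} (h : DiffAt Y x)
    (hYZ : ∀ᶠ y in 𝓝 x, Y y = Z y) : DiffAt Z x :=
  MDifferentiableAt.congr_of_eventuallyEq h (hYZ.mono fun y hy ↦ by simp only [hy])

/-- Smoothness of the connection is applied to a section that is smooth on all of M, so Y is cut off
by a bump function equal to 1 near x; locality of ∇ removes the cutoff. The Hausdorff property
enters through the smoothness of the bump function. -/
theorem diffAt_nabla [T2Space M] {D : Connection M}
    (hD : CovariantDerivative.ContMDiffCovariantDerivative D ∞) {x : M}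
    {Y Z : (y : M) → TangentSpace I8 y} (hY : ∀ᶠ y in 𝓝 x, SmoothAt Y y) (hZ : DiffAt Z x) :
    DiffAt (fun y ↦ D Y y (Z y)) x := by
  obtain ⟨U, hU, hUo, hxU⟩ := eventually_nhds_iff.1 hY
  obtain ⟨f, -, hf⟩ := (SmoothBumpFunction.nhds_basis_tsupport (I := I8) x).mem_iff.1
    (hUo.mem_nhds hxU)
  have hs : ContMDiff I8 I8.tangent ∞
      (fun y ↦ (⟨y, ((f : M → ℝ) • Y) y⟩ : TangentBundle I8 M)) :=
    ContMDiffOn.smul_section_of_tsupport f.contMDiff.contMDiffOn hUo hf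
      fun y hy ↦ (hU y hy).contMDiffWithinAt
  have h1 := (hD.contMDiff.contMDiff (σ := (f : M → ℝ) • Y) hs.contMDiffOn).contMDiffAt
    (x := x) Filter.univ_mem
  have h2 : DiffAt (fun y ↦ D ((f : M → ℝ) • Y) y (Z y)) x :=
    (h1.mdifferentiableAt (by simp)).clm_bundle_apply hZ
  refine h2.congr ?_
  filter_upwards [hY, f.eventuallyEq_one.eventually_nhds] with y hy hfy
  have h3 : D ((f : M → ℝ) • Y) y = D Y y := by
    refine D.isCovariantDerivativeOn.congr_of_eventuallyEq (s := Set.univ)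
      (hs.contMDiffAt.mdifferentiableAt (by simp)) hy.diffAt Filter.univ_mem ?_
    filter_upwards [hfy] with z hz
    simp [hz]
  rw [h3]

theorem mdifferentiableAt_fun_sum {ι : Type} [Fintype ι] {f : ι → M → ℝ} {x : M}
    (hf : ∀ i, MDifferentiableAt I8 𝓘(ℝ, ℝ) (f i) x) :
    MDifferentiableAt I8 𝓘(ℝ, ℝ) (fun y ↦ ∑ i, f i y) x := by
  have : MDifferentiableAt I8 𝓘(ℝ, ℝ) (∑ i, f i) x := MDifferentiableAt.sum fun i _ ↦ hf i
  rwa [Finset.sum_fn] at this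

theorem mdifferentiableAt_fun_prod {ι : Type} [Fintype ι] {f : ι → M → ℝ} {x : M}
    (hf : ∀ i, MDifferentiableAt I8 𝓘(ℝ, ℝ) (f i) x) :
    MDifferentiableAt I8 𝓘(ℝ, ℝ) (fun y ↦ ∏ i, f i y) x := by
  have : MDifferentiableAt I8 𝓘(ℝ, ℝ) (∏ i, f i) x := MDifferentiableAt.prod fun i _ ↦ hf i
  rwa [Finset.prod_fn] at this

theorem mdifferentiableAt_fun_mul {f g : M → ℝ} {x : M}
    (hf : MDifferentiableAt I8 𝓘(ℝ, ℝ) f x) (hg : MDifferentiableAt I8 𝓘(ℝ, ℝ) g x) :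
    MDifferentiableAt I8 𝓘(ℝ, ℝ) (fun y ↦ f y * g y) x := hf.mul hg

theorem mvfderiv_fun_sum {ι : Type} [Fintype ι] {f : ι → M → ℝ} {x : M}
    (hf : ∀ i, MDifferentiableAt I8 𝓘(ℝ, ℝ) (f i) x) (u : TM x) :
    mvfderiv I8 (fun y ↦ ∑ i, f i y) x u = ∑ i, mvfderiv I8 (f i) x u := by
  classical
  have h : ∀ s : Finset ι, MDifferentiableAt I8 𝓘(ℝ, ℝ) (∑ i ∈ s, f i) x ∧
      mvfderiv I8 (∑ i ∈ s, f i) x u = ∑ i ∈ s, mvfderiv I8 (f i) x u := by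
    intro s
    induction s using Finset.induction_on with
    | empty => exact ⟨mdifferentiableAt_const, by simp [mvfderiv_zero]⟩
    | insert i s hi ih =>
      rw [Finset.sum_insert hi, Finset.sum_insert hi]
      exact ⟨(hf i).add ih.1, by rw [mvfderiv_add (hf i) ih.1, add_apply, ih.2]⟩
  have := (h Finset.univ).2
  rwa [Finset.sum_fn] at this

variable [RiemannianBundle (fun x : M => TangentSpace I8 x)]
  [IsContMDiffRiemannianBundle I8 ∞ E8 (fun x : M => TangentSpace I8 x)]

theorem SmoothAt.inner {Y Z : (y : M) → TangentSpace I8 y} {x : M} (hY : SmoothAt Y x)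
    (hZ : SmoothAt Z x) : ContMDiffAt I8 𝓘(ℝ, ℝ) ∞ (fun y ↦ inner ℝ (Y y) (Z y)) x :=
  ContMDiffAt.inner_bundle (F := E8) hY hZ

theorem DiffAt.inner {Y Z : (y : M) → TangentSpace I8 y} {x : M} (hY : DiffAt Y x)
    (hZ : DiffAt Z x) : MDifferentiableAt I8 𝓘(ℝ, ℝ) (fun y ↦ inner ℝ (Y y) (Z y)) x :=
  MDifferentiableAt.inner_bundle (F := E8) hY hZ

theorem alternating_expand {V : Type*} [NormedAddCommGroup V] [InnerProductSpace ℝ V] {n : ℕ}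
    (Ω : V [⋀^Fin n]→L[ℝ] ℝ) (b : OrthonormalBasis (Fin 8) ℝ V) (v : Fin n → V) :
    Ω v = ∑ i : Fin n → Fin 8, (∏ a, inner ℝ (b (i a)) (v a)) * Ω fun a ↦ b (i a) := by
  conv_lhs => rw [show v = fun a ↦ ∑ j, inner ℝ (b j) (v a) • b j from
    funext fun a ↦ (b.sum_repr' (v a)).symm]
  have h := Ω.toMultilinearMap.map_sum (fun (a : Fin n) (j : Fin 8) ↦ inner ℝ (b j) (v a) • b j)
  refine h.trans (Finset.sum_congr rfl fun i _ ↦ ?_)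
  exact Ω.toMultilinearMap.map_smul_univ _ _

/-- Smoothness of Φ is not part of `Structure`. It follows from this formula: in an adapted frame
the components are constant, so Φ is a polynomial in inner products. -/
theorem Structure.eventually_phi_eq (S : Structure M) {x : M}
    {e : Fin 8 → (y : M) → TangentSpace I8 y}
    (he : ∀ᶠ y in 𝓝 x, (∀ i, SmoothAt (e i) y) ∧ ∃ b : OrthonormalBasis (Fin 8) ℝ (TM y),
      (∀ i, b i = e i y) ∧ IsAdapted (S.Phi y) (S.vol y) b)
    (Y : Fin 4 → (y : M) → TangentSpace I8 y) :
    (fun y ↦ S.phi y fun a ↦ Y a y) =ᶠ[𝓝 x] fun y ↦ ∑ i : Fin 4 → Fin 8,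
      (∏ a, inner ℝ (e (i a) y) (Y a y)) * (phiTab (i 0) (i 1) (i 2) (i 3) : ℝ) := by
  filter_upwards [he] with y hy
  obtain ⟨-, b, hb, h⟩ := hy
  simp only [← hb]
  refine (alternating_expand (S.Phi y) b _).trans (Finset.sum_congr rfl fun i _ ↦ ?_)
  rw [← h.phi]
  congr 2
  ext a
  fin_cases a <;> rfl

theorem Structure.contMDiffAt_phi (S : Structure M) {x : M}
    {Y : Fin 4 → (y : M) → TangentSpace I8 y} (hY : ∀ a, SmoothAt (Y a) x) :
    ContMDiffAt I8 𝓘(ℝ, ℝ) ∞ (fun y ↦ S.phi y fun a ↦ Y a y) x := by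
  obtain ⟨e, he⟩ := S.exists_adapted_frame x
  refine ContMDiffAt.congr_of_eventuallyEq ?_ (S.eventually_phi_eq he Y)
  refine ContMDiffAt.sum fun i _ ↦ ContMDiffAt.mul ?_ contMDiffAt_const
  exact contMDiffAt_finsetProd fun a _ ↦ (he.self_of_nhds.1 (i a)).inner (hY a)

theorem Structure.mdifferentiableAt_phi (S : Structure M) {x : M}
    {Y : Fin 4 → (y : M) → TangentSpace I8 y} (hY : ∀ a, DiffAt (Y a) x) :
    MDifferentiableAt I8 𝓘(ℝ, ℝ) (fun y ↦ S.phi y fun a ↦ Y a y) x := by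
  obtain ⟨e, he⟩ := S.exists_adapted_frame x
  refine MDifferentiableAt.congr_of_eventuallyEq ?_ (S.eventually_phi_eq he Y)
  refine mdifferentiableAt_fun_sum fun i ↦ mdifferentiableAt_fun_mul ?_ mdifferentiableAt_const
  exact mdifferentiableAt_fun_prod fun a ↦ (he.self_of_nhds.1 (i a)).diffAt.inner (hY a)

theorem eventually_eq_sum_frame (S : Structure M) {x : M}
    {e : Fin 8 → (y : M) → TangentSpace I8 y}
    (he : ∀ᶠ y in 𝓝 x, (∀ i, SmoothAt (e i) y) ∧ ∃ b : OrthonormalBasis (Fin 8) ℝ (TM y),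
      (∀ i, b i = e i y) ∧ IsAdapted (S.Phi y) (S.vol y) b)
    (Y : (y : M) → TangentSpace I8 y) :
    ∀ᶠ y in 𝓝 x, ∑ i, (inner ℝ (e i y) (Y y)) • e i y = Y y := by
  filter_upwards [he] with y hy
  obtain ⟨-, b, hb, h⟩ := hy
  simp only [← hb]
  exact b.sum_repr' (Y y)

/-- For merely differentiable Y and Z the derivatives and bracket defining T(Y,Z) need not be
differentiable. By bilinearity T(Y,Z) is expanded in a smooth frame, where they are. -/
theorem diffAt_torsion [T2Space M] (S : Structure M) {D : Connection M}
    (hD : CovariantDerivative.ContMDiffCovariantDerivative D ∞) {x : M}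
    {Y Z : (y : M) → TangentSpace I8 y} (hY : DiffAt Y x) (hZ : DiffAt Z x) :
    DiffAt (fun y ↦ D.torsion y (Y y) (Z y)) x := by
  obtain ⟨e, he⟩ := S.exists_adapted_frame x
  have hs : ∀ i, ∀ᶠ y in 𝓝 x, SmoothAt (e i) y := fun i ↦ he.mono fun y hy ↦ hy.1 i
  have h1 : ∀ i j, DiffAt (fun y ↦ D.torsion y (e i y) (e j y)) x := by
    intro i j
    have hb : DiffAt (mlieBracket I8 (e i) (e j)) x := by
      have h2 : ((2 : ℕ∞) : WithTop ℕ∞) ≤ ∞ := WithTop.coe_le_coe.2 le_top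
      have h3 : ((2 : ℕ∞) : WithTop ℕ∞) + 1 ≤ ∞ :=
        WithTop.coe_le_coe.2 (le_top : (2 + 1 : ℕ∞) ≤ ⊤)
      have : IsManifold I8 (((2 : ℕ∞) : WithTop ℕ∞) + 1) M := IsManifold.of_le h3
      have : IsManifold I8 (minSmoothness ℝ 2) M := by
        rw [minSmoothness_of_isRCLikeNormedField]; infer_instance
      have := ContMDiffAt.mlieBracket_vectorField (m := 1) (n := 2)
        ((hs i).self_of_nhds.of_le h2) ((hs j).self_of_nhds.of_le h2)
        (by rw [minSmoothness_of_isRCLikeNormedField]; exact (one_add_one_eq_two (R := ℕ∞)) ▸ le_rfl)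
      exact this.mdifferentiableAt (by simp)
    have h2 : DiffAt (fun y ↦ D (e j) y (e i y) - D (e i) y (e j y) -
        mlieBracket I8 (e i) (e j) y) x :=
      mdifferentiableAt_sub_section (mdifferentiableAt_sub_section
        (diffAt_nabla hD (hs j) (hs i).self_of_nhds.diffAt)
        (diffAt_nabla hD (hs i) (hs j).self_of_nhds.diffAt)) hb
    refine h2.congr ?_
    filter_upwards [hs i, hs j] with y hi hj
    exact (D.torsion_apply hi.diffAt hj.diffAt).symm
  have h2 : DiffAt (fun y ↦ ∑ i, ∑ j, (inner ℝ (e i y) (Y y) * inner ℝ (e j y) (Z y)) •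
      D.torsion y (e i y) (e j y)) x := by
    refine MDifferentiableAt.sum_section fun i _ ↦ MDifferentiableAt.sum_section fun j _ ↦ ?_
    exact MDifferentiableAt.smul_section
      (((hs i).self_of_nhds.diffAt.inner hY).mul ((hs j).self_of_nhds.diffAt.inner hZ)) (h1 i j)
  refine h2.congr ?_
  filter_upwards [eventually_eq_sum_frame S he Y, eventually_eq_sum_frame S he Z] with y hy hz
  conv_rhs => rw [← hy, ← hz]
  simp only [map_sum, map_smul, FunLike.coe_sum, Finset.sum_apply, FunLike.coe_smul,
    Pi.smul_apply, smul_smul, Finset.smul_sum]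
  rw [Finset.sum_comm]
  refine Finset.sum_congr rfl fun i _ ↦ Finset.sum_congr rfl fun j _ ↦ ?_
  rw [mul_comm]

end Smoothness

theorem isLinearMap_neg {V : Type*} [AddCommGroup V] [Module ℝ V] {f : V → ℝ}
    (hf : IsLinearMap ℝ f) : IsLinearMap ℝ fun v ↦ -f v :=
  ⟨fun u v ↦ by rw [hf.map_add]; ring, fun c u ↦ by rw [hf.map_smul, smul_neg]⟩

/-! ### The covariant derivative of the torsion -/

section TorsionDerivative

open Filter Topology

variable {M : Type*} [TopologicalSpace M] [ChartedSpace E8 M] [IsManifold I8 ∞ M]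
  [RiemannianBundle (fun x : M => TangentSpace I8 x)]

/-- The torsion as a function of three vectors. -/
def tor (D : Connection M) (x : M) (u v w : TM x) : ℝ := inner ℝ (D.torsion x u v) w

theorem isLinearMap_tor₁ (D : Connection M) (x : M) (v w : TM x) :
    IsLinearMap ℝ fun u ↦ tor D x u v w :=
  ⟨fun u u' ↦ by simp only [tor, map_add, add_apply, inner_add_left],
    fun c u ↦ by simp only [tor, map_smul, smul_apply, real_inner_smul_left, smul_eq_mul]⟩

theorem isLinearMap_tor₂ (D : Connection M) (x : M) (u w : TM x) :
    IsLinearMap ℝ fun v ↦ tor D x u v w :=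
  ⟨fun u u' ↦ by simp only [tor, map_add, inner_add_left],
    fun c u ↦ by simp only [tor, map_smul, real_inner_smul_left, smul_eq_mul]⟩

theorem isLinearMap_tor₃ (D : Connection M) (x : M) (u v : TM x) :
    IsLinearMap ℝ fun w ↦ tor D x u v w :=
  ⟨fun u u' ↦ by simp only [tor, inner_add_right],
    fun c u ↦ by simp only [tor, real_inner_smul_right, smul_eq_mul]⟩

theorem tor_swap₁ (D : Connection M) (x : M) (u v w : TM x) :
    tor D x v u w = -tor D x u v w := by
  rw [tor, D.torsion_antisymm, inner_neg_left, tor]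

/-- The derivative `(∇_u T)(Y₁, Y₂, Y₃)` in terms of vector fields. -/
def nablaTorsionAux (D : Connection M) (Y₁ Y₂ Y₃ : (y : M) → TangentSpace I8 y) (x : M)
    (u : TM x) : ℝ :=
  mvfderiv I8 (fun y ↦ tor D y (Y₁ y) (Y₂ y) (Y₃ y)) x u - tor D x (D Y₁ x u) (Y₂ x) (Y₃ x)
    - tor D x (Y₁ x) (D Y₂ x u) (Y₃ x) - tor D x (Y₁ x) (Y₂ x) (D Y₃ x u)

/-- The covariant derivative `(∇_u T)(v₁, v₂, v₃)` of the torsion. -/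
def nablaTorsion (D : Connection M) (x : M) (u v₁ v₂ v₃ : TM x) : ℝ :=
  nablaTorsionAux D (extV v₁) (extV v₂) (extV v₃) x u

theorem isLinearMap_nablaTorsion₁ (D : Connection M) (x : M) (v₁ v₂ v₃ : TM x) :
    IsLinearMap ℝ fun u ↦ nablaTorsion D x u v₁ v₂ v₃ :=
  ⟨fun u u' ↦ by
    simp only [nablaTorsion, nablaTorsionAux, map_add, (isLinearMap_tor₁ D x _ _).map_add,
      (isLinearMap_tor₂ D x _ _).map_add, (isLinearMap_tor₃ D x _ _).map_add]
    ring,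
    fun c u ↦ by
    simp only [nablaTorsion, nablaTorsionAux, map_smul, (isLinearMap_tor₁ D x _ _).map_smul,
      (isLinearMap_tor₂ D x _ _).map_smul, (isLinearMap_tor₃ D x _ _).map_smul, smul_eq_mul]
    ring⟩

theorem nablaTorsionAux_swap₁ (D : Connection M) (Y₁ Y₂ Y₃ : (y : M) → TangentSpace I8 y) (x : M)
    (u : TM x) : nablaTorsionAux D Y₂ Y₁ Y₃ x u = -nablaTorsionAux D Y₁ Y₂ Y₃ x u := by
  have h : (fun y ↦ tor D y (Y₂ y) (Y₁ y) (Y₃ y)) = -fun y ↦ tor D y (Y₁ y) (Y₂ y) (Y₃ y) := by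
    funext y
    exact tor_swap₁ D y _ _ _
  simp only [nablaTorsionAux, h, mvfderiv_neg, neg_apply, tor_swap₁ D x (Y₁ x) (D Y₂ x u),
    tor_swap₁ D x (D Y₁ x u) (Y₂ x), tor_swap₁ D x (Y₁ x) (Y₂ x)]
  ring

variable [IsContMDiffRiemannianBundle I8 ∞ E8 (fun x : M => TangentSpace I8 x)]
  {S : Structure M} {D : Connection M}

namespace Structure.IsTorsionConnection

theorem tor_swap₂ (hD : S.IsTorsionConnection D) (x : M) (u v w : TM x) :
    tor D x u w v = -tor D x u v w := hD.skew x u w v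

theorem nablaTorsionAux_swap₂ (hD : S.IsTorsionConnection D)
    (Y₁ Y₂ Y₃ : (y : M) → TangentSpace I8 y) (x : M) (u : TM x) :
    nablaTorsionAux D Y₁ Y₃ Y₂ x u = -nablaTorsionAux D Y₁ Y₂ Y₃ x u := by
  have h : (fun y ↦ tor D y (Y₁ y) (Y₃ y) (Y₂ y)) = -fun y ↦ tor D y (Y₁ y) (Y₂ y) (Y₃ y) := by
    funext y
    exact hD.tor_swap₂ y _ _ _
  simp only [nablaTorsionAux, h, mvfderiv_neg, neg_apply, hD.tor_swap₂ x _ (Y₂ x) (Y₃ x),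
    hD.tor_swap₂ x _ (Y₂ x) (D Y₃ x u), hD.tor_swap₂ x _ (D Y₂ x u) (Y₃ x)]
  ring

theorem mdifferentiableAt_tor [T2Space M] (hD : S.IsTorsionConnection D) {x : M}
    {Y₁ Y₂ Y₃ : (y : M) → TangentSpace I8 y} (h₁ : DiffAt Y₁ x) (h₂ : DiffAt Y₂ x)
    (h₃ : DiffAt Y₃ x) :
    MDifferentiableAt I8 𝓘(ℝ, ℝ) (fun y ↦ tor D y (Y₁ y) (Y₂ y) (Y₃ y)) x :=
  (diffAt_torsion S hD.smooth h₁ h₂).inner h₃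

theorem tensorialAt_nablaTorsionAux [T2Space M] (hD : S.IsTorsionConnection D) {x : M}
    {Y₂ Y₃ : (y : M) → TangentSpace I8 y} (h₂ : DiffAt Y₂ x) (h₃ : DiffAt Y₃ x) (u : TM x) :
    TensorialAt I8 E8 (fun Y : (y : M) → TangentSpace I8 y ↦ nablaTorsionAux D Y Y₂ Y₃ x u) x where
  smul {f Y} hf hY := by
    have h : (fun y ↦ tor D y ((f • Y) y) (Y₂ y) (Y₃ y)) =
        f * fun y ↦ tor D y (Y y) (Y₂ y) (Y₃ y) := by
      funext y
      exact (isLinearMap_tor₁ D y _ _).map_smul (f y) (Y y)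
    have h' : D (f • Y) x u = f x • D Y x u + mvfderiv I8 f x u • Y x := by
      rw [D.isCovariantDerivativeOn.leibniz (s := Set.univ) hY hf]
      rfl
    have h'' : (f • Y) x = f x • Y x := rfl
    simp only [nablaTorsionAux, h, h', h'', mvfderiv_mul hf (hD.mdifferentiableAt_tor hY h₂ h₃),
      (isLinearMap_tor₁ D x _ _).map_add, (isLinearMap_tor₁ D x _ _).map_smul, add_apply,
      smul_apply, smul_eq_mul]
    ring
  add {Y Y'} hY hY' := by
    have h : (fun y ↦ tor D y ((Y + Y') y) (Y₂ y) (Y₃ y)) =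
        (fun y ↦ tor D y (Y y) (Y₂ y) (Y₃ y)) + fun y ↦ tor D y (Y' y) (Y₂ y) (Y₃ y) := by
      funext y
      exact (isLinearMap_tor₁ D y _ _).map_add (Y y) (Y' y)
    have h' : D (Y + Y') x u = D Y x u + D Y' x u := by
      rw [D.isCovariantDerivativeOn.add (s := Set.univ) hY hY']
      rfl
    have h'' : (Y + Y') x = Y x + Y' x := rfl
    simp only [nablaTorsionAux, h, h', h'', mvfderiv_add (hD.mdifferentiableAt_tor hY h₂ h₃)
      (hD.mdifferentiableAt_tor hY' h₂ h₃), (isLinearMap_tor₁ D x _ _).map_add, add_apply]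
    ring

/-- Tensoriality is proved in the first slot; the skew symmetries carry it to the other two,
replacing the fields by coordinate fields one at a time. -/
theorem nablaTorsionAux_eq [T2Space M] (hD : S.IsTorsionConnection D) {x : M}
    {Y₁ Y₂ Y₃ : (y : M) → TangentSpace I8 y} (h₁ : DiffAt Y₁ x) (h₂ : DiffAt Y₂ x)
    (h₃ : DiffAt Y₃ x) (u : TM x) :
    nablaTorsionAux D Y₁ Y₂ Y₃ x u = nablaTorsion D x u (Y₁ x) (Y₂ x) (Y₃ x) := by
  have e₁ := diffAt_extV (Y₁ x)
  have e₂ := diffAt_extV (Y₂ x)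
  have e₃ := diffAt_extV (Y₃ x)
  have a₁ := (hD.tensorialAt_nablaTorsionAux h₂ h₃ u).pointwise h₁ e₁ (extV_self _).symm
  have a₂ := (hD.tensorialAt_nablaTorsionAux e₁ h₃ u).pointwise h₂ e₂ (extV_self _).symm
  have a₃ := (hD.tensorialAt_nablaTorsionAux e₁ e₂ u).pointwise h₃ e₃ (extV_self _).symm
  rw [nablaTorsionAux_swap₁, nablaTorsionAux_swap₁ D (extV (Y₁ x)) (extV (Y₂ x))] at a₂
  rw [nablaTorsionAux_swap₁, hD.nablaTorsionAux_swap₂, nablaTorsionAux_swap₁ D (extV (Y₁ x)),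
    hD.nablaTorsionAux_swap₂ (extV (Y₁ x)) (extV (Y₂ x))] at a₃
  rw [nablaTorsion]
  linarith

theorem nablaTorsion_swap₁ (_ : S.IsTorsionConnection D) (x : M) (u v₁ v₂ v₃ : TM x) :
    nablaTorsion D x u v₂ v₁ v₃ = -nablaTorsion D x u v₁ v₂ v₃ :=
  nablaTorsionAux_swap₁ D _ _ _ x u

theorem nablaTorsion_swap₂ (hD : S.IsTorsionConnection D) (x : M) (u v₁ v₂ v₃ : TM x) :
    nablaTorsion D x u v₁ v₃ v₂ = -nablaTorsion D x u v₁ v₂ v₃ :=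
  hD.nablaTorsionAux_swap₂ _ _ _ x u

theorem isLinearMap_nablaTorsion₂ [T2Space M] (hD : S.IsTorsionConnection D) (x : M)
    (u v₂ v₃ : TM x) : IsLinearMap ℝ fun v₁ ↦ nablaTorsion D x u v₁ v₂ v₃ := by
  have h := hD.tensorialAt_nablaTorsionAux (diffAt_extV v₂) (diffAt_extV v₃) u
  have h' : (fun v₁ ↦ nablaTorsion D x u v₁ v₂ v₃) = TensorialAt.mkHom _ x h := by
    funext v₁
    exact (h.mkHom_apply_eq_extend v₁).symm
  rw [h']
  exact ⟨map_add _, map_smul _⟩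

theorem isLinearMap_nablaTorsion₃ [T2Space M] (hD : S.IsTorsionConnection D) (x : M)
    (u v₁ v₃ : TM x) : IsLinearMap ℝ fun v₂ ↦ nablaTorsion D x u v₁ v₂ v₃ := by
  simp only [fun v₂ ↦ hD.nablaTorsion_swap₁ x u v₂ v₁ v₃]
  exact isLinearMap_neg (hD.isLinearMap_nablaTorsion₂ x u v₁ v₃)

theorem isLinearMap_nablaTorsion₄ [T2Space M] (hD : S.IsTorsionConnection D) (x : M)
    (u v₁ v₂ : TM x) : IsLinearMap ℝ fun v₃ ↦ nablaTorsion D x u v₁ v₂ v₃ := by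
  simp only [fun v₃ ↦ hD.nablaTorsion_swap₂ x u v₁ v₃ v₂]
  exact isLinearMap_neg (hD.isLinearMap_nablaTorsion₃ x u v₁ v₂)

end Structure.IsTorsionConnection

end TorsionDerivative

/-! ### Bianchi identity, metric and Φ-invariance of the curvature -/

section CurvatureIdentities

open Filter Topology

variable {M : Type*} [TopologicalSpace M] [ChartedSpace E8 M] [IsManifold I8 ∞ M]

/-- The field `∇_{extV v} (extV w)`. -/
def nablaExt (D : Connection M) {x : M} (v w : TM x) (y : M) : TangentSpace I8 y :=
  D (extV w) y (extV v y)

theorem nablaExt_self (D : Connection M) {x : M} (v w : TM x) :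
    nablaExt D v w x = D (extV w) x v := by
  rw [nablaExt, extV_self]

theorem curvature_eq (D : Connection M) {x : M} (u v w : TM x) :
    curvature D x u v w = D (nablaExt D v w) x u - D (nablaExt D u w) x v := by
  rw [curvature, curvatureFields, mlieBracket_extV, map_zero, sub_zero, extV_self, extV_self]
  rfl

theorem curvature_swap (D : Connection M) {x : M} (u v w : TM x) :
    curvature D x v u w = -curvature D x u v w := by
  rw [curvature_eq, curvature_eq, neg_sub]

theorem torsion_eq (D : Connection M) {x : M} (u v : TM x) :
    D.torsion x u v = D (extV v) x u - D (extV u) x v := by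
  rw [D.torsion_apply_eq_extend, mlieBracket_extV, sub_zero]
  simp only [extV_self]

theorem eventually_torsion_eq (D : Connection M) {x : M} (v w : TM x) :
    ∀ᶠ y in 𝓝 x, D.torsion y (extV v y) (extV w y) = nablaExt D v w y - nablaExt D w v y := by
  filter_upwards [eventually_diffAt_extV v, eventually_diffAt_extV w,
    eventually_mlieBracket_extV v w] with y hv hw hb
  rw [D.torsion_apply hv hw, hb, sub_zero]
  rfl

variable [RiemannianBundle (fun x : M => TangentSpace I8 x)]
  [IsContMDiffRiemannianBundle I8 ∞ E8 (fun x : M => TangentSpace I8 x)]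
  {S : Structure M} {D : Connection M}

namespace Structure.IsTorsionConnection

theorem diffAt_nablaExt [T2Space M] (hD : S.IsTorsionConnection D) {x : M} (v w : TM x) :
    DiffAt (nablaExt D v w) x :=
  diffAt_nabla hD.smooth (eventually_smoothAt_extV w) (diffAt_extV v)

theorem mvfderiv_inner (hD : S.IsTorsionConnection D) {x : M}
    {Y Z : (y : M) → TangentSpace I8 y} (hY : DiffAt Y x) (hZ : DiffAt Z x) (u : TM x) :
    mvfderiv I8 (fun y ↦ inner ℝ (Y y) (Z y)) x u =
      inner ℝ (D Y x u) (Z x) + inner ℝ (Y x) (D Z x u) := by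
  have h := hD.metric.mvfderiv_inner_eq (extV u) hY hZ
  simpa only [extV_self] using h

/-- The equation T(v,w) = ∇_v w - ∇_w v for commuting fields, differentiated along u. Its cyclic sum
is the Bianchi identity. -/
theorem inner_nabla_torsion [T2Space M] (hD : S.IsTorsionConnection D) {x : M} (u v w z : TM x) :
    inner ℝ (D (nablaExt D v w) x u - D (nablaExt D w v) x u) z =
      nablaTorsion D x u v w z + tor D x (D (extV v) x u) w z + tor D x v (D (extV w) x u) z := by
  have hB : DiffAt (fun y ↦ D.torsion y (extV v y) (extV w y)) x :=
    diffAt_torsion S hD.smooth (diffAt_extV v) (diffAt_extV w)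
  have h1 : D (nablaExt D v w) x =
      D (nablaExt D w v) x + D (fun y ↦ D.torsion y (extV v y) (extV w y)) x := by
    rw [← D.isCovariantDerivativeOn.add (s := Set.univ) (hD.diffAt_nablaExt w v) hB]
    refine D.isCovariantDerivativeOn.congr_of_eventuallyEq (s := Set.univ)
      (hD.diffAt_nablaExt v w)
      (mdifferentiableAt_add_section (hD.diffAt_nablaExt w v) hB) Filter.univ_mem ?_
    filter_upwards [eventually_torsion_eq D v w] with y hy
    rw [Pi.add_apply, hy]
    abel
  have h2 := hD.mvfderiv_inner hB (diffAt_extV z) u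
  have h3 : D (nablaExt D v w) x u - D (nablaExt D w v) x u =
      D (fun y ↦ D.torsion y (extV v y) (extV w y)) x u := by
    rw [h1, add_apply]; abel
  have h4 : mvfderiv I8 (fun y ↦ inner ℝ (D.torsion y (extV v y) (extV w y)) (extV z y)) x u =
    mvfderiv I8 (fun y ↦ tor D y (extV v y) (extV w y) (extV z y)) x u := rfl
  rw [h4] at h2
  rw [h3]
  simp only [nablaTorsion, nablaTorsionAux, extV_self] at h2 ⊢
  simp only [tor] at h2 ⊢
  linarith

/-- The first Bianchi identity for a connection with skew torsion. -/
theorem bianchi [T2Space M] (hD : S.IsTorsionConnection D) {x : M} (u v w z : TM x) :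
    inner ℝ (curvature D x u v w) z + inner ℝ (curvature D x v w u) z +
        inner ℝ (curvature D x w u v) z =
      nablaTorsion D x u v w z + nablaTorsion D x v w u z + nablaTorsion D x w u v z +
        (tor D x (D.torsion x u v) w z + tor D x (D.torsion x v w) u z +
          tor D x (D.torsion x w u) v z) := by
  have h1 := hD.inner_nabla_torsion u v w z
  have h2 := hD.inner_nabla_torsion v w u z
  have h3 := hD.inner_nabla_torsion w u v z
  -- In the cyclic sum the first-derivative terms pair up as T(∇_u v - ∇_v u, w), which is T(T(u,v),
  -- w).
  have hs : ∀ a b c d : TM x, tor D x (a - b) c d = tor D x a c d - tor D x b c d :=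
    fun a b c d ↦ by simp only [tor, map_sub, sub_apply, inner_sub_left]
  simp only [curvature_eq, torsion_eq, hs, inner_sub_left] at h1 h2 h3 ⊢
  rw [tor_swap₁ D x _ v] at h1
  rw [tor_swap₁ D x _ w] at h2
  rw [tor_swap₁ D x _ u] at h3
  linarith

/-- Differentiate ⟨w, z⟩ along v and then u. The result is symmetric in u, v, the products of first
derivatives cancel in the difference, and the curvature terms remain. -/
theorem curvature_skew [T2Space M] (hD : S.IsTorsionConnection D) {x : M} (u v w z : TM x) :
    inner ℝ (curvature D x u v z) w = -inner ℝ (curvature D x u v w) z := by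
  have key : ∀ u v : TM x,
      mvfderiv I8 (fun y ↦ mvfderiv I8 (fun y ↦ inner ℝ (extV w y) (extV z y)) y (extV v y)) x u =
        inner ℝ (D (nablaExt D v w) x u) z + inner ℝ (D (extV w) x v) (D (extV z) x u) +
        (inner ℝ (D (extV w) x u) (D (extV z) x v) + inner ℝ w (D (nablaExt D v z) x u)) := by
    intro u v
    have h1 : (fun y ↦ mvfderiv I8 (fun y ↦ inner ℝ (extV w y) (extV z y)) y (extV v y)) =ᶠ[𝓝 x]
        (fun y ↦ inner ℝ (nablaExt D v w y) (extV z y)) +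
          fun y ↦ inner ℝ (extV w y) (nablaExt D v z y) := by
      filter_upwards [eventually_diffAt_extV w, eventually_diffAt_extV z] with y hw hz
      exact hD.mvfderiv_inner hw hz (extV v y)
    rw [mvfderiv_congr h1, mvfderiv_add ((hD.diffAt_nablaExt v w).inner (diffAt_extV z))
      ((diffAt_extV w).inner (hD.diffAt_nablaExt v z)), add_apply,
      hD.mvfderiv_inner (hD.diffAt_nablaExt v w) (diffAt_extV z),
      hD.mvfderiv_inner (diffAt_extV w) (hD.diffAt_nablaExt v z)]
    simp only [extV_self, nablaExt_self]
  have h := mvfderiv_mvfderiv_extV_comm ((smoothAt_extV w).inner (smoothAt_extV z)) u v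
  rw [key, key] at h
  rw [curvature_eq, curvature_eq, inner_sub_left, inner_sub_left,
    real_inner_comm w, real_inner_comm w]
  linarith

/-- The same argument with Φ in place of the metric: ∇Φ = 0 turns symmetry of second derivatives
into R(u,v) · Φ = 0. -/
theorem curvature_stabilizes [T2Space M] (hD : S.IsTorsionConnection D) {x : M} (u v : TM x)
    (w : Fin 4 → TM x) :
    ∑ i, S.Phi x (Function.update w i (curvature D x u v (w i))) = 0 := by
  set W : Fin 4 → (y : M) → TangentSpace I8 y := fun i ↦ extV (w i) with hW
  have hWx : (fun j ↦ W j x) = w := funext fun j ↦ extV_self _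
  have hWd : ∀ i, DiffAt (W i) x := fun i ↦ diffAt_extV _
  have upd : ∀ (i : Fin 4) (A : (y : M) → TangentSpace I8 y) (y : M),
      (fun j ↦ Function.update W i A j y) = Function.update (fun j ↦ W j y) i (A y) := by
    intro i A y
    funext j
    by_cases h : j = i
    · subst h; simp
    · simp [h]
  have key : ∀ u v : TM x,
      mvfderiv I8 (fun y ↦ mvfderiv I8 (fun y ↦ S.phi y fun j ↦ W j y) y (extV v y)) x u =
        ∑ i, ∑ k, S.Phi x (Function.update (Function.update w i (D (W i) x v)) k
          (D (Function.update W i (nablaExt D v (w i)) k) x u)) := by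
    intro u v
    have hd : ∀ i k, DiffAt (Function.update W i (nablaExt D v (w i)) k) x := by
      intro i k
      by_cases h : k = i
      · subst h; rw [Function.update_self]; exact hD.diffAt_nablaExt v (w k)
      · rw [Function.update_of_ne h]; exact hWd k
    have h1 : (fun y ↦ mvfderiv I8 (fun y ↦ S.phi y fun j ↦ W j y) y (extV v y)) =ᶠ[𝓝 x]
        fun y ↦ ∑ i, S.phi y fun j ↦ Function.update W i (nablaExt D v (w i)) j y := by
      have : ∀ᶠ y in 𝓝 x, ∀ i, DiffAt (W i) y :=
        Filter.eventually_all.2 fun i ↦ eventually_diffAt_extV (w i)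
      filter_upwards [this] with y hy
      rw [hD.parallel y W hy]
      refine Finset.sum_congr rfl fun i _ ↦ ?_
      rw [upd]
      rfl
    rw [mvfderiv_congr h1, mvfderiv_fun_sum fun i ↦ S.mdifferentiableAt_phi (hd i)]
    refine Finset.sum_congr rfl fun i _ ↦ ?_
    rw [hD.parallel x _ (hd i), upd, hWx, nablaExt_self]
    rfl
  have h := mvfderiv_mvfderiv_extV_comm (S.contMDiffAt_phi fun i ↦ smoothAt_extV (w i)) u v
  rw [key, key, ← sub_eq_zero] at h
  rw [← h]
  -- Exchanging the order of summation pairs the mixed term with derivatives in slots i ≠ k with the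
  -- equal one for (v, u). Only the diagonal survives.
  conv_rhs => rw [Finset.sum_comm (f := fun i k ↦ S.Phi x (Function.update (Function.update w i
    (D (W i) x u)) k (D (Function.update W i (nablaExt D u (w i)) k) x v)))]
  rw [← Finset.sum_sub_distrib]
  refine Finset.sum_congr rfl fun i _ ↦ ?_
  rw [← Finset.sum_sub_distrib, Finset.sum_eq_single i]
  · simp only [Function.update_self, Function.update_idem]
    rw [curvature_eq]
    exact S.Phi x |>.map_update_sub w i _ _
  · intro k _ hk
    rw [Function.update_of_ne hk, Function.update_of_ne hk.symm,
      Function.update_comm hk, sub_self]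
  · simp

end Structure.IsTorsionConnection

end CurvatureIdentities

/-! ### Contractions with the volume form -/

section Contractions

variable {V : Type*} [NormedAddCommGroup V] [InnerProductSpace ℝ V]

theorem alternating_perm {n : ℕ} (Ω : V [⋀^Fin n]→L[ℝ] ℝ) (v : Fin n → V)
    (σ : Equiv.Perm (Fin n)) : Ω (v ∘ σ) = ((Equiv.Perm.sign σ : ℤ) : ℝ) * Ω v := by
  refine (Ω.toAlternatingMap.map_perm v σ).trans ?_
  rw [Units.smul_def, zsmul_eq_mul]
  rfl

theorem alternating_append_perm {k m n : ℕ} (h : k + m = n) (Ω : V [⋀^Fin n]→L[ℝ] ℝ)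
    (w : Fin k → V) (v : Fin m → V) (σ : Equiv.Perm (Fin k)) :
    Ω (fun a ↦ Fin.append (w ∘ σ) v (Fin.cast h.symm a)) =
      ((Equiv.Perm.sign σ : ℤ) : ℝ) * Ω fun a ↦ Fin.append w v (Fin.cast h.symm a) := by
  subst h
  set τ : Equiv.Perm (Fin (k + m)) :=
    finSumFinEquiv.permCongr (Equiv.Perm.sumCongr σ 1) with hτ
  have h1 : (fun a ↦ Fin.append (w ∘ σ) v (Fin.cast rfl a)) =
      (fun a ↦ Fin.append w v (Fin.cast rfl a)) ∘ τ := by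
    funext a
    refine Fin.addCases (fun i ↦ ?_) (fun i ↦ ?_) a
    · simp [hτ, Equiv.permCongr_apply]
    · simp [hτ, Equiv.permCongr_apply]
  have h2 : Equiv.Perm.sign τ = Equiv.Perm.sign σ := by
    rw [hτ, Equiv.Perm.sign_permCongr, Equiv.Perm.sign_sumCongr, Equiv.Perm.sign_one, mul_one]
  rw [h1, ← h2, alternating_perm]

/-- Reindexing by σ moves the permutation onto A, which absorbs the sign. Thus every term of a
skew-symmetrization contributes equally against an alternating A. -/
theorem sum_sign_mul_comp_perm {α : Type*} [Fintype α] [DecidableEq α] {k : ℕ}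
    {A : (Fin k → α) → ℝ}
    (hA : ∀ (σ : Equiv.Perm (Fin k)) I, A (I ∘ σ) = ((Equiv.Perm.sign σ : ℤ) : ℝ) * A I)
    (σ : Equiv.Perm (Fin k)) (H : (Fin k → α) → ℝ) :
    ∑ I, ((Equiv.Perm.sign σ : ℤ) : ℝ) * H (I ∘ σ) * A I = ∑ I, H I * A I := by
  have h := Equiv.sum_comp (Equiv.arrowCongr σ (Equiv.refl α)) fun I ↦
    ((Equiv.Perm.sign σ : ℤ) : ℝ) * H (I ∘ σ) * A I
  rw [← h]
  refine Finset.sum_congr rfl fun I _ ↦ ?_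
  have h1 : (Equiv.arrowCongr σ (Equiv.refl α)) I ∘ σ = I := by
    funext a; simp [Equiv.arrowCongr]
  have h2 := hA σ ((Equiv.arrowCongr σ (Equiv.refl α)) I)
  rw [h1] at h2 ⊢
  rw [h2]
  ring

theorem sum_fin_succ_fun {α : Type*} [Fintype α] [DecidableEq α] {k : ℕ}
    (f : (Fin (k + 1) → α) → ℝ) :
    ∑ I, f I = ∑ a, ∑ I : Fin k → α, f (Matrix.vecCons a I) := by
  rw [← Equiv.sum_comp (Fin.consEquiv fun _ : Fin (k + 1) ↦ α) f, Fintype.sum_prod_type]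
  rfl

theorem sum_fin_zero_fun {α : Type*} [Fintype α] [DecidableEq α] (f : (Fin 0 → α) → ℝ) :
    ∑ I, f I = f ![] := by
  rw [Fintype.sum_unique]
  congr 1

theorem sum_fin_three_fun {α : Type*} [Fintype α] [DecidableEq α] (f : (Fin 3 → α) → ℝ) :
    ∑ I, f I = ∑ a, ∑ b, ∑ c, f ![a, b, c] := by
  simp only [sum_fin_succ_fun, sum_fin_zero_fun]

variable {Φ : V [⋀^Fin 4]→L[ℝ] ℝ} {Ω : V [⋀^Fin 8]→L[ℝ] ℝ} {e : OrthonormalBasis (Fin 8) ℝ V}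

theorem sum_inner_mul_onb (b : OrthonormalBasis (Fin 8) ℝ V) {f : V → ℝ} (hf : IsLinearMap ℝ f)
    (v : V) : ∑ i, inner ℝ (b i) v * f (b i) = f v := by
  change ∑ i, inner ℝ (b i) v * hf.mk' f (b i) = hf.mk' f v
  conv_rhs => rw [← b.sum_repr' v, map_sum]
  simp only [map_smul, smul_eq_mul]

/-- The form `Φ` is self-dual. -/
theorem IsAdapted.star_phi (h : IsAdapted Φ Ω e) (b : OrthonormalBasis (Fin 8) ℝ V)
    (v₀ v₁ v₂ v₃ : V) : ∑ i, ∑ j, ∑ k, ∑ l, Φ ![b i, b j, b k, b l] *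
      Ω ![b i, b j, b k, b l, v₀, v₁, v₂, v₃] = 24 * Φ ![v₀, v₁, v₂, v₃] := by
  -- Setting w = v₀ = b_l and summing over l: the trace gives 8Φ, the other four terms -Φ each, and
  -- 6 · (8 - 4) = 24.
  have key := fun l ↦ h.starForm_eq_zero b (b l) (b l) v₀ v₁ v₂ v₃
  have hs : ∀ i j k l, Ω ![b j, b k, b l, b i, v₀, v₁, v₂, v₃] =
      -Ω ![b i, b j, b k, b l, v₀, v₁, v₂, v₃] := by
    intro i j k l
    have h1 : ![b j, b k, b l, b i, v₀, v₁, v₂, v₃] =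
        ![b i, b j, b k, b l, v₀, v₁, v₂, v₃] ∘ Fin.cycleRange 3 := by
      ext a; fin_cases a <;> rfl
    rw [h1, alternating_perm, Fin.sign_cycleRange]
    norm_num
  have hsum : ∑ l, starForm Φ Ω b (b l) (b l) v₀ v₁ v₂ v₃ = 0 := by
    simp only [key, Finset.sum_const_zero]
  simp only [starForm, Finset.sum_add_distrib, ← Finset.mul_sum, Finset.sum_sub_distrib] at hsum
  have hfst : ∑ i, ∑ j, ∑ k, ∑ l, Φ ![b i, b j, b k, b l] *
      Ω ![b j, b k, b l, b i, v₀, v₁, v₂, v₃] = -∑ i, ∑ j, ∑ k, ∑ l, Φ ![b i, b j, b k, b l] *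
      Ω ![b i, b j, b k, b l, v₀, v₁, v₂, v₃] := by
    simp only [← Finset.sum_neg_distrib]
    refine Finset.sum_congr rfl fun i _ ↦ Finset.sum_congr rfl fun j _ ↦
      Finset.sum_congr rfl fun k _ ↦ Finset.sum_congr rfl fun l _ ↦ ?_
    rw [hs i j k l, mul_neg]
  rw [hfst, sum_inner_mul_onb b (isLinearMap_alt4₁ Φ _ _ _),
    sum_inner_mul_onb b (isLinearMap_alt4₁ Φ _ _ _),
    sum_inner_mul_onb b (isLinearMap_alt4₁ Φ _ _ _),
    sum_inner_mul_onb b (isLinearMap_alt4₁ Φ _ _ _)] at hsum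
  simp only [OrthonormalBasis.inner_eq_one, one_mul, Finset.sum_const, Finset.card_univ,
    Fintype.card_fin, nsmul_eq_mul] at hsum
  have h1 : Φ ![v₁, v₀, v₂, v₃] = -Φ ![v₀, v₁, v₂, v₃] := alt4_swap₁ _ _ _ _ _
  have h2 : Φ ![v₂, v₀, v₁, v₃] = Φ ![v₀, v₁, v₂, v₃] := by
    rw [alt4_swap₁, alt4_swap₂, neg_neg]
  have h3 : Φ ![v₃, v₀, v₁, v₂] = -Φ ![v₀, v₁, v₂, v₃] := by
    rw [alt4_swap₁, alt4_swap₂, alt4_swap₃, neg_neg]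
  rw [h1, h2, h3] at hsum
  push_cast at hsum
  linarith

theorem sum_mul_eq_of_swap {α : Type*} [Fintype α] [DecidableEq α] {k : ℕ}
    {A : (Fin k → α) → ℝ}
    (hA : ∀ (σ : Equiv.Perm (Fin k)) I, A (I ∘ σ) = ((Equiv.Perm.sign σ : ℤ) : ℝ) * A I)
    {i j : Fin k} (hij : i ≠ j) (H : (Fin k → α) → ℝ) :
    ∑ I, H (I ∘ Equiv.swap i j) * A I = -∑ I, H I * A I := by
  rw [← sum_sign_mul_comp_perm hA (Equiv.swap i j) H, Equiv.Perm.sign_swap hij,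
    ← Finset.sum_neg_distrib]
  refine Finset.sum_congr rfl fun I _ ↦ ?_
  push_cast
  ring

/-- The contraction of `u ↦ Φ(… ∇_u w …)`, skew-symmetrized, with an alternating function. -/
theorem sum_removeNth_mul (Φ : V [⋀^Fin 4]→L[ℝ] ℝ) (b : Fin 8 → V) (d : V → V → V)
    {A : (Fin 5 → Fin 8) → ℝ}
    (hA : ∀ (σ : Equiv.Perm (Fin 5)) I, A (I ∘ σ) = ((Equiv.Perm.sign σ : ℤ) : ℝ) * A I) :
    ∑ I, (∑ i : Fin 5, (-1 : ℝ) ^ (i : ℕ) * ∑ j : Fin 4, Φ (Function.update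
      (i.removeNth fun a ↦ b (I a)) j (d (b (I i)) (b (I (i.succAbove j)))))) * A I =
    10 * ∑ I, Φ ![d (b (I 0)) (b (I 1)) - d (b (I 1)) (b (I 0)), b (I 2), b (I 3), b (I 4)] *
      A I := by
  -- the function with the differentiating index in front
  set H : (Fin 5 → Fin 8) → ℝ := fun I ↦ ∑ j : Fin 4, Φ (Function.update
    (fun a : Fin 4 ↦ b (I a.succ)) j (d (b (I 0)) (b (I j.succ)))) with hH
  set K : (Fin 5 → Fin 8) → ℝ := fun I ↦
    Φ ![d (b (I 0)) (b (I 1)), b (I 2), b (I 3), b (I 4)] with hK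
  -- The cycle bringing index i to the front has sign (-1)^i, so the five terms agree.
  have h1 : ∀ i : Fin 5, ∑ I, ((-1 : ℝ) ^ (i : ℕ) * ∑ j : Fin 4, Φ (Function.update
      (i.removeNth fun a ↦ b (I a)) j (d (b (I i)) (b (I (i.succAbove j)))))) * A I =
      ∑ I, H I * A I := by
    intro i
    rw [← sum_sign_mul_comp_perm hA i.cycleRange.symm H]
    refine Finset.sum_congr rfl fun I _ ↦ ?_
    rw [Equiv.Perm.sign_symm, Fin.sign_cycleRange, hH]
    simp only [Function.comp_apply, Fin.cycleRange_symm_zero, Fin.cycleRange_symm_succ]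
    push_cast
    rfl
  -- A transposition in I and one in Φ bring the differentiated slot to the front, so the four terms
  -- agree as well. The total is 20 K, and skew-symmetrizing the two arguments of d accounts for a
  -- factor 2.
  have h2 : ∀ j : Fin 4, ∑ I, Φ (Function.update
      (fun a : Fin 4 ↦ b (I a.succ)) j (d (b (I 0)) (b (I j.succ)))) * A I = ∑ I, K I * A I := by
    intro j
    by_cases hj : j = 0
    · subst hj
      refine Finset.sum_congr rfl fun I _ ↦ ?_
      congr 2
      ext a
      fin_cases a <;> rfl
    · have hne : (1 : Fin 5) ≠ j.succ := fun h ↦ hj (Fin.succ_injective _ h.symm)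
      rw [← neg_inj, ← sum_mul_eq_of_swap hA hne K, ← Finset.sum_neg_distrib]
      refine Finset.sum_congr rfl fun I _ ↦ ?_
      rw [← neg_mul, ← alternating_swap Φ _ (Ne.symm hj), hK]
      congr 2
      ext a
      fin_cases j
      · exact absurd rfl hj
      all_goals fin_cases a <;> rfl
  have h3 : ∑ I, Φ ![d (b (I 0)) (b (I 1)) - d (b (I 1)) (b (I 0)), b (I 2), b (I 3), b (I 4)] *
      A I = 2 * ∑ I, K I * A I := by
    have e : ∀ I, Φ ![d (b (I 0)) (b (I 1)) - d (b (I 1)) (b (I 0)), b (I 2), b (I 3), b (I 4)] *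
        A I = K I * A I - K (I ∘ Equiv.swap 0 1) * A I := by
      intro I
      rw [← sub_mul, (isLinearMap_alt4₁ Φ _ _ _).map_sub]
      rfl
    simp only [e, Finset.sum_sub_distrib]
    rw [sum_mul_eq_of_swap hA (show (0 : Fin 5) ≠ 1 by decide) K]
    ring
  have h4 : ∑ I, H I * A I = 4 * ∑ I, K I * A I := by
    simp only [hH, Finset.sum_mul]
    rw [Finset.sum_comm]
    simp only [h2, Finset.sum_const, Finset.card_univ, Fintype.card_fin, nsmul_eq_mul]
    norm_num
  simp only [Finset.sum_mul]
  rw [Finset.sum_comm]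
  simp only [h1, h4, Finset.sum_const, Finset.card_univ, Fintype.card_fin, nsmul_eq_mul]
  rw [h3]
  push_cast
  ring

end Contractions

/-! ### δΦ and the Lee form in terms of the torsion -/

section LeeForm

variable {M : Type*} [TopologicalSpace M] [ChartedSpace E8 M] [IsManifold I8 ∞ M]
  [RiemannianBundle (fun x : M => TangentSpace I8 x)]

namespace Structure

theorem star_phi (S : Structure M) : S.star (k := 3 + 1) (m := 3 + 1) (by norm_num) S.phi =
    S.phi := by
  funext x v
  obtain ⟨e, he⟩ := S.exists_isAdapted x
  have h := he.star_phi (onb x) (v 0) (v 1) (v 2) (v 3)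
  rw [star]
  have h1 : ∑ i : Fin (3 + 1) → Fin 8, S.phi x (frame x i) *
      S.vol x (fun a ↦ Fin.append (frame x i) v (Fin.cast (by norm_num) a)) =
      24 * S.Phi x ![v 0, v 1, v 2, v 3] := by
    rw [← h]
    simp only [sum_fin_succ_fun, sum_fin_zero_fun]
    refine Finset.sum_congr rfl fun i _ ↦ Finset.sum_congr rfl fun j _ ↦
      Finset.sum_congr rfl fun k _ ↦ Finset.sum_congr rfl fun l _ ↦ ?_
    congr 2
    · ext a; fin_cases a <;> rfl
    · ext a; fin_cases a <;> rfl
  rw [h1]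
  have h2 : ![v 0, v 1, v 2, v 3] = v := by ext a; fin_cases a <;> rfl
  rw [h2, phi]
  have h3 : ((3 + 1)! : ℝ) = 24 := by norm_num [Nat.factorial]
  rw [h3]
  ring

variable [IsContMDiffRiemannianBundle I8 ∞ E8 (fun x : M => TangentSpace I8 x)]
  {S : Structure M} {D : Connection M}

/-- On commuting extensions the bracket terms vanish, and ∇Φ = 0 replaces each derivative of Φ by
derivatives of its arguments. -/
theorem IsTorsionConnection.extD_phi (hD : S.IsTorsionConnection D) (x : M) (v : Fin 5 → TM x) :
    extD (n := 3) S.phi x v = ∑ i : Fin 5, (-1 : ℝ) ^ (i : ℕ) * ∑ j : Fin 4,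
      S.Phi x (Function.update (i.removeNth v) j (D (extV (v (i.succAbove j))) x (v i))) := by
  have h0 : ∀ w : Fin 3 → TM x, S.phi x (Matrix.vecCons 0 w) = 0 :=
    fun w ↦ (S.Phi x).map_coord_zero 0 rfl
  rw [extD]
  simp only [mlieBracket_extV, h0, mul_zero, Finset.sum_const_zero, sub_zero]
  refine Finset.sum_congr rfl fun i _ ↦ ?_
  congr 1
  have h := hD.parallel x (fun j ↦ extV (v (i.succAbove j))) (fun j ↦ diffAt_extV _) (v i)
  have h1 : (fun j : Fin 4 ↦ extV (v (i.succAbove j)) x) = i.removeNth v :=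
    funext fun j ↦ extV_self _
  rw [h1] at h
  exact h

/-- Since ∗Φ = Φ, δΦ = -∗dΦ. Skew-symmetrization leaves only the torsion in dΦ, and
`starForm_eq_zero` evaluates the star of T(a,c) ⌟ Φ. The constant is -(1/120) · 10 · (-6) = 1/2. -/
theorem IsTorsionConnection.deltaPhi_eq (hD : S.IsTorsionConnection D) (x : M)
    (v : Fin 3 → TM x) : S.deltaPhi x v = 1 / 2 * ∑ a, ∑ c,
      (tor D x (onb x a) (onb x c) (v 0) * S.Phi x ![onb x a, onb x c, v 1, v 2]
        - tor D x (onb x a) (onb x c) (v 1) * S.Phi x ![onb x a, onb x c, v 0, v 2]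
        + tor D x (onb x a) (onb x c) (v 2) * S.Phi x ![onb x a, onb x c, v 0, v 1]) := by
  obtain ⟨e, he⟩ := S.exists_isAdapted x
  set b := onb x with hb
  set A : (Fin 5 → Fin 8) → ℝ := fun I ↦
    S.vol x (fun a ↦ Fin.append (frame x I) v (Fin.cast (by norm_num) a)) with hAdef
  have hA : ∀ (σ : Equiv.Perm (Fin 5)) I, A (I ∘ σ) = ((Equiv.Perm.sign σ : ℤ) : ℝ) * A I :=
    fun σ I ↦ alternating_append_perm (by norm_num) (S.vol x) (frame x I) v σ
  have h1 : S.deltaPhi x v = -(1 / 120 * ∑ I, extD (n := 3) S.phi x (frame x I) * A I) := by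
    rw [deltaPhi, codiff, S.star_phi, star]
    have h3 : ((3 + 2)! : ℝ) = 120 := by norm_num [Nat.factorial]
    rw [h3]
  have h2 : ∑ I, extD (n := 3) S.phi x (frame x I) * A I =
      10 * ∑ I, S.Phi x ![D.torsion x (b (I 0)) (b (I 1)), b (I 2), b (I 3), b (I 4)] * A I := by
    simp only [hD.extD_phi, torsion_eq]
    exact sum_removeNth_mul (S.Phi x) b (fun u w ↦ D (extV w) x u) hA
  have h3 : ∑ I, S.Phi x ![D.torsion x (b (I 0)) (b (I 1)), b (I 2), b (I 3), b (I 4)] * A I =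
      ∑ a, ∑ c, ∑ i, ∑ j, ∑ k, S.Phi x ![D.torsion x (b a) (b c), b i, b j, b k] *
        S.vol x ![b i, b j, b k, b a, b c, v 0, v 1, v 2] := by
    simp only [sum_fin_succ_fun, sum_fin_zero_fun]
    refine Finset.sum_congr rfl fun a _ ↦ Finset.sum_congr rfl fun c _ ↦
      Finset.sum_congr rfl fun i _ ↦ Finset.sum_congr rfl fun j _ ↦
      Finset.sum_congr rfl fun k _ ↦ ?_
    congr 1
    have e1 : A ![a, c, i, j, k] = S.vol x ![b a, b c, b i, b j, b k, v 0, v 1, v 2] := by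
      rw [hAdef]
      dsimp only
      congr 1
      ext a; fin_cases a <;> rfl
    have e2 : ![b i, b j, b k, b a, b c, v 0, v 1, v 2] =
        ![b a, b c, b i, b j, b k, v 0, v 1, v 2] ∘
          (Fin.cycleRange 4 * Fin.cycleRange 4 : Equiv.Perm (Fin 8)) := by
      ext a; fin_cases a <;> rfl
    rw [e2, alternating_perm]
    refine e1.trans ?_
    rw [Equiv.Perm.sign_mul, Fin.sign_cycleRange]
    norm_num
  have h4 : ∀ a c, ∑ i, ∑ j, ∑ k, S.Phi x ![D.torsion x (b a) (b c), b i, b j, b k] *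
        S.vol x ![b i, b j, b k, b a, b c, v 0, v 1, v 2] =
      -6 * (tor D x (b a) (b c) (v 0) * S.Phi x ![b a, b c, v 1, v 2]
        - tor D x (b a) (b c) (v 1) * S.Phi x ![b a, b c, v 0, v 2]
        + tor D x (b a) (b c) (v 2) * S.Phi x ![b a, b c, v 0, v 1]) := by
    intro a c
    have h := he.starForm_eq_zero b (D.torsion x (b a) (b c)) (b a) (b c) (v 0) (v 1) (v 2)
    rw [starForm] at h
    -- Total skewness removes the inner products with b_a and b_c, leaving three of the five terms
    -- of the star formula.
    have t1 : inner ℝ (D.torsion x (b a) (b c)) (b c) = 0 := by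
      have := hD.tor_swap₂ x (b a) (b c) (b c)
      rw [tor] at this
      linarith
    have t2 : inner ℝ (D.torsion x (b a) (b c)) (b a) = 0 := by
      have := hD.tor_swap₂ x (b c) (b a) (b a)
      rw [D.torsion_antisymm, inner_neg_left, neg_eq_zero]
      rw [tor] at this
      linarith
    rw [t1, t2] at h
    simp only [tor]
    linarith
  rw [h1, h2, h3]
  simp only [h4, ← Finset.mul_sum]
  ring

/-- The components of the torsion in the orthonormal basis `onb x`. -/
def _root_.Spin7.torArray (D : Connection M) (x : M) (i j k : Fin 8) : ℝ :=
  tor D x (onb x i) (onb x j) (onb x k)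

theorem IsTorsionConnection.isAlt3_torArray (hD : S.IsTorsionConnection D) (x : M) :
    IsAlt3 (torArray D x) :=
  ⟨fun _ _ _ ↦ tor_swap₁ D x _ _ _, fun _ _ _ ↦ hD.tor_swap₂ x _ _ _⟩

theorem IsTorsionConnection.deltaPhi_onb (hD : S.IsTorsionConnection D) (x : M) (i j k : Fin 8) :
    S.deltaPhi x ![onb x i, onb x j, onb x k] = 1 / 2 *
      (contr₂ (S.phiArray x) (torArray D x) i j k + contr₂ (S.phiArray x) (torArray D x) j k i +
        contr₂ (S.phiArray x) (torArray D x) k i j) := by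
  rw [hD.deltaPhi_eq, (S.isSpinArray_phiArray x).contr₂_swap _ j i k]
  simp only [Finset.sum_add_distrib, Finset.sum_sub_distrib]
  rw [← sub_eq_add_neg]
  rfl

/-- δΦ is half the cyclic sum of `contr₂`, whose contraction with Φ is -12 τ; hence (1/42) · (1/2) ·
(-12) = -1/7. -/
theorem IsTorsionConnection.lee_eq (hD : S.IsTorsionConnection D) (x : M) (w : Fin 1 → TM x) :
    S.lee x w = -(1 / 7) * ∑ i, ∑ j, ∑ k, tor D x (onb x i) (onb x j) (onb x k) *
      S.Phi x ![onb x i, onb x j, onb x k, w 0] := by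
  have lin : ∀ f : Fin 8 → Fin 8 → Fin 8 → ℝ, IsLinearMap ℝ fun u ↦
      ∑ i, ∑ j, ∑ k, f i j k * S.Phi x ![onb x i, onb x j, onb x k, u] := by
    intro f
    constructor
    · intro u u'
      simp only [(isLinearMap_alt4₄ (S.Phi x) _ _ _).map_add, mul_add, Finset.sum_add_distrib]
    · intro c u
      simp only [(isLinearMap_alt4₄ (S.Phi x) _ _ _).map_smul, smul_eq_mul, Finset.mul_sum]
      refine Finset.sum_congr rfl fun i _ ↦ Finset.sum_congr rfl fun j _ ↦
        Finset.sum_congr rfl fun k _ ↦ ?_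
      ring
  have h1 : S.lee x w = 1 / 42 * ∑ i, ∑ j, ∑ k, S.deltaPhi x ![onb x i, onb x j, onb x k] *
      S.Phi x ![onb x i, onb x j, onb x k, w 0] := by
    rw [lee, sum_fin_three_fun]
    congr 1
    refine Finset.sum_congr rfl fun i _ ↦ Finset.sum_congr rfl fun j _ ↦
      Finset.sum_congr rfl fun k _ ↦ ?_
    congr 2
    ext a; fin_cases a <;> rfl
  rw [h1]
  rw [← sum_inner_mul_onb (onb x) (lin _) (w 0), ← sum_inner_mul_onb (onb x) (lin _) (w 0),
    Finset.mul_sum, Finset.mul_sum]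
  refine Finset.sum_congr rfl fun s _ ↦ ?_
  have h2 := (S.isSpinArray_phiArray x).contr₃_contr₂_cyc (hD.isAlt3_torArray x) s
  have h3 : ∑ i, ∑ j, ∑ k, S.deltaPhi x ![onb x i, onb x j, onb x k] *
      S.Phi x ![onb x i, onb x j, onb x k, onb x s] =
      1 / 2 * (-12 * contr₃ (S.phiArray x) (torArray D x) s) := by
    rw [← h2, contr₃]
    simp only [Finset.mul_sum, hD.deltaPhi_onb]
    refine Finset.sum_congr rfl fun i _ ↦ Finset.sum_congr rfl fun j _ ↦
      Finset.sum_congr rfl fun k _ ↦ ?_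
    rw [phiArray]
    ring
  rw [h3, contr₃]
  simp only [torArray, phiArray]
  ring

end Structure

end LeeForm

/-- Infinitesimal form of basis independence: the derivative of an orthonormal frame is skew, so it
does not contribute to the derivative of a contraction. -/
theorem sum_skew_mul_add {V : Type*} [NormedAddCommGroup V] [InnerProductSpace ℝ V]
    (e : OrthonormalBasis (Fin 8) ℝ V) {d : Fin 8 → V}
    (hd : ∀ i j, inner ℝ (e j) (d i) = -inner ℝ (e i) (d j)) {g h : V → ℝ}
    (hg : IsLinearMap ℝ g) (hh : IsLinearMap ℝ h) :
    ∑ i, (g (d i) * h (e i) + g (e i) * h (d i)) = 0 := by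
  have h1 : ∑ i, g (e i) * h (d i) = -∑ i, g (d i) * h (e i) := by
    have e1 : ∀ i, g (d i) * h (e i) = ∑ j, inner ℝ (e j) (d i) * (g (e j) * h (e i)) := by
      intro i
      rw [← sum_inner_mul_onb e hg (d i), Finset.sum_mul]
      simp only [mul_assoc]
    have e2 : ∀ i, g (e i) * h (d i) = ∑ j, inner ℝ (e j) (d i) * (g (e i) * h (e j)) := by
      intro i
      rw [← sum_inner_mul_onb e hh (d i), Finset.mul_sum]
      refine Finset.sum_congr rfl fun j _ ↦ ?_
      ring
    simp only [e1, e2]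
    rw [Finset.sum_comm, ← Finset.sum_neg_distrib]
    refine Finset.sum_congr rfl fun i _ ↦ ?_
    rw [← Finset.sum_neg_distrib]
    refine Finset.sum_congr rfl fun j _ ↦ ?_
    rw [hd j i]
    ring
  rw [Finset.sum_add_distrib, h1, add_neg_cancel]

/-! ### The covariant derivative of the Lee form -/

section LeeDerivative

open Filter Topology

variable {M : Type*} [TopologicalSpace M] [ChartedSpace E8 M] [IsManifold I8 ∞ M]
  [RiemannianBundle (fun x : M => TangentSpace I8 x)]
  [IsContMDiffRiemannianBundle I8 ∞ E8 (fun x : M => TangentSpace I8 x)]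
  {S : Structure M} {D : Connection M}

namespace Structure

theorem mdifferentiableAt_Phi (S : Structure M) {x : M}
    {Y₀ Y₁ Y₂ Y₃ : (y : M) → TangentSpace I8 y} (h₀ : DiffAt Y₀ x) (h₁ : DiffAt Y₁ x)
    (h₂ : DiffAt Y₂ x) (h₃ : DiffAt Y₃ x) :
    MDifferentiableAt I8 𝓘(ℝ, ℝ) (fun y ↦ S.Phi y ![Y₀ y, Y₁ y, Y₂ y, Y₃ y]) x := by
  have h := S.mdifferentiableAt_phi (Y := ![Y₀, Y₁, Y₂, Y₃]) (x := x)
    (fun a ↦ by fin_cases a <;> assumption)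
  have e : (fun y ↦ S.phi y fun a ↦ ![Y₀, Y₁, Y₂, Y₃] a y) =
      fun y ↦ S.Phi y ![Y₀ y, Y₁ y, Y₂ y, Y₃ y] := by
    funext y
    rw [phi]
    congr 1
    ext a; fin_cases a <;> rfl
  rwa [e] at h

namespace IsTorsionConnection

theorem mvfderiv_Phi (hD : S.IsTorsionConnection D) {x : M}
    {Y₀ Y₁ Y₂ Y₃ : (y : M) → TangentSpace I8 y} (h₀ : DiffAt Y₀ x) (h₁ : DiffAt Y₁ x)
    (h₂ : DiffAt Y₂ x) (h₃ : DiffAt Y₃ x) (u : TM x) :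
    mvfderiv I8 (fun y ↦ S.Phi y ![Y₀ y, Y₁ y, Y₂ y, Y₃ y]) x u =
      S.Phi x ![D Y₀ x u, Y₁ x, Y₂ x, Y₃ x] + S.Phi x ![Y₀ x, D Y₁ x u, Y₂ x, Y₃ x] +
        S.Phi x ![Y₀ x, Y₁ x, D Y₂ x u, Y₃ x] + S.Phi x ![Y₀ x, Y₁ x, Y₂ x, D Y₃ x u] := by
  have h := hD.parallel x ![Y₀, Y₁, Y₂, Y₃] (fun a ↦ by fin_cases a <;> assumption) u
  have e : (fun y ↦ S.phi y fun a ↦ ![Y₀, Y₁, Y₂, Y₃] a y) =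
      fun y ↦ S.Phi y ![Y₀ y, Y₁ y, Y₂ y, Y₃ y] := by
    funext y
    rw [phi]
    congr 1
    ext a; fin_cases a <;> rfl
  rw [e] at h
  rw [h, Fin.sum_univ_four]
  simp only [phi]
  congr 1
  congr 1
  congr 1
  all_goals
    congr 1
    ext a; fin_cases a <;> rfl

theorem mvfderiv_tor [T2Space M] (hD : S.IsTorsionConnection D) {x : M}
    {Y₁ Y₂ Y₃ : (y : M) → TangentSpace I8 y} (h₁ : DiffAt Y₁ x) (h₂ : DiffAt Y₂ x)
    (h₃ : DiffAt Y₃ x) (u : TM x) :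
    mvfderiv I8 (fun y ↦ tor D y (Y₁ y) (Y₂ y) (Y₃ y)) x u =
      nablaTorsion D x u (Y₁ x) (Y₂ x) (Y₃ x) + tor D x (D Y₁ x u) (Y₂ x) (Y₃ x)
        + tor D x (Y₁ x) (D Y₂ x u) (Y₃ x) + tor D x (Y₁ x) (Y₂ x) (D Y₃ x u) := by
  rw [← hD.nablaTorsionAux_eq h₁ h₂ h₃ u, nablaTorsionAux]
  ring

theorem sum_tor_mul_Phi (x : M) (b e : OrthonormalBasis (Fin 8) ℝ (TM x)) (w : TM x) :
    ∑ i, ∑ j, ∑ k, tor D x (b i) (b j) (b k) * S.Phi x ![b i, b j, b k, w] =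
      ∑ i, ∑ j, ∑ k, tor D x (e i) (e j) (e k) * S.Phi x ![e i, e j, e k, w] :=
  sum_onb_mul₃ b e (g := fun i j k ↦ tor D x i j k) (h := fun i j k ↦ S.Phi x ![i, j, k, w])
    (fun _ _ ↦ isLinearMap_tor₁ D x _ _) (fun _ _ ↦ isLinearMap_tor₂ D x _ _)
    (fun _ _ ↦ isLinearMap_tor₃ D x _ _) (fun _ _ ↦ isLinearMap_alt4₁ (S.Phi x) _ _ _)
    (fun _ _ ↦ isLinearMap_alt4₂ (S.Phi x) _ _ _) (fun _ _ ↦ isLinearMap_alt4₃ (S.Phi x) _ _ _)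

/-- The covariant derivative of the Lee form in terms of that of the torsion. -/
theorem nablaForm_lee [T2Space M] (hD : S.IsTorsionConnection D) (x : M) (u v : TM x) :
    nablaForm D S.lee x u v = -(1 / 7) * ∑ i, ∑ j, ∑ k,
      nablaTorsion D x u (onb x i) (onb x j) (onb x k) *
        S.Phi x ![onb x i, onb x j, onb x k, v] := by
  -- The bases `onb y` are chosen pointwise without regularity in y, so θ is rewritten in a smooth
  -- frame before differentiating.
  obtain ⟨e, he⟩ := S.exists_adapted_frame x
  obtain ⟨hs, b, hb, -⟩ := he.self_of_nhds
  have hd : ∀ i, DiffAt (e i) x := fun i ↦ (hs i).diffAt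
  have hv : DiffAt (extV v) x := diffAt_extV v
  -- the connection coefficients are skew-symmetric
  have hskew : ∀ i j, inner ℝ (b j) (D (e i) x u) = -inner ℝ (b i) (D (e j) x u) := by
    intro i j
    have h1 : (fun y ↦ (inner ℝ (e i y) (e j y) : ℝ)) =ᶠ[𝓝 x] fun _ ↦ if i = j then 1 else 0 := by
      filter_upwards [he] with y hy
      obtain ⟨-, b', hb', -⟩ := hy
      rw [← hb', ← hb', OrthonormalBasis.inner_eq_ite]
    have h2 := hD.mvfderiv_inner (hd i) (hd j) u
    rw [mvfderiv_congr h1, mvfderiv_const] at h2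
    rw [hb, hb, real_inner_comm]
    have h3 : (0 : TM x →L[ℝ] ℝ) u = 0 := rfl
    linarith
  have hlee : (fun y ↦ S.lee y ![extV v y]) =ᶠ[𝓝 x] fun y ↦ -(1 / 7) * ∑ i, ∑ j, ∑ k,
      tor D y (e i y) (e j y) (e k y) * S.Phi y ![e i y, e j y, e k y, extV v y] := by
    filter_upwards [he] with y hy
    obtain ⟨-, b', hb', -⟩ := hy
    rw [hD.lee_eq, sum_tor_mul_Phi y (onb y) b']
    simp only [hb']
    rfl
  have ht : ∀ i j k, MDifferentiableAt I8 𝓘(ℝ, ℝ) (fun y ↦ tor D y (e i y) (e j y) (e k y)) x :=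
    fun i j k ↦ hD.mdifferentiableAt_tor (hd i) (hd j) (hd k)
  have hp : ∀ i j k, MDifferentiableAt I8 𝓘(ℝ, ℝ)
      (fun y ↦ S.Phi y ![e i y, e j y, e k y, extV v y]) x :=
    fun i j k ↦ S.mdifferentiableAt_Phi (hd i) (hd j) (hd k) hv
  have htp : ∀ i j k, MDifferentiableAt I8 𝓘(ℝ, ℝ) (fun y ↦ tor D y (e i y) (e j y) (e k y) *
      S.Phi y ![e i y, e j y, e k y, extV v y]) x :=
    fun i j k ↦ mdifferentiableAt_fun_mul (ht i j k) (hp i j k)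
  have h1 : mvfderiv I8 (fun y ↦ S.lee y ![extV v y]) x u = -(1 / 7) * ∑ i, ∑ j, ∑ k,
      (mvfderiv I8 (fun y ↦ tor D y (e i y) (e j y) (e k y)) x u *
        S.Phi x ![e i x, e j x, e k x, v] + tor D x (e i x) (e j x) (e k x) *
        mvfderiv I8 (fun y ↦ S.Phi y ![e i y, e j y, e k y, extV v y]) x u) := by
    rw [mvfderiv_congr hlee]
    have e1 : (fun y ↦ -(1 / 7) * ∑ i, ∑ j, ∑ k,
        tor D y (e i y) (e j y) (e k y) * S.Phi y ![e i y, e j y, e k y, extV v y]) =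
        (fun _ ↦ (-(1 / 7) : ℝ)) * fun y ↦ ∑ i, ∑ j, ∑ k,
        tor D y (e i y) (e j y) (e k y) * S.Phi y ![e i y, e j y, e k y, extV v y] := rfl
    rw [e1, mvfderiv_mul mdifferentiableAt_const (mdifferentiableAt_fun_sum fun i ↦
      mdifferentiableAt_fun_sum fun j ↦ mdifferentiableAt_fun_sum fun k ↦ htp i j k),
      mvfderiv_const, smul_zero, add_zero, smul_apply, smul_eq_mul,
      mvfderiv_fun_sum fun i ↦ mdifferentiableAt_fun_sum fun j ↦
        mdifferentiableAt_fun_sum fun k ↦ htp i j k]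
    congr 1
    refine Finset.sum_congr rfl fun i _ ↦ ?_
    rw [mvfderiv_fun_sum fun j ↦ mdifferentiableAt_fun_sum fun k ↦ htp i j k]
    refine Finset.sum_congr rfl fun j _ ↦ ?_
    rw [mvfderiv_fun_sum fun k ↦ htp i j k]
    refine Finset.sum_congr rfl fun k _ ↦ ?_
    have e2 : (fun y ↦ tor D y (e i y) (e j y) (e k y) *
        S.Phi y ![e i y, e j y, e k y, extV v y]) = (fun y ↦ tor D y (e i y) (e j y) (e k y)) *
        fun y ↦ S.Phi y ![e i y, e j y, e k y, extV v y] := rfl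
    rw [e2, mvfderiv_mul (ht i j k) (hp i j k), add_apply, smul_apply, smul_apply, smul_eq_mul,
      smul_eq_mul, extV_self]
    ring
  -- Derivatives of the frame cancel separately in each of the three contracted slots.
  have z₁ : ∀ j k, ∑ i, (tor D x (D (e i) x u) (b j) (b k) * S.Phi x ![b i, b j, b k, v] +
      tor D x (b i) (b j) (b k) * S.Phi x ![D (e i) x u, b j, b k, v]) = 0 := fun j k ↦
    sum_skew_mul_add b hskew (isLinearMap_tor₁ D x _ _) (isLinearMap_alt4₁ (S.Phi x) _ _ _)
  have z₂ : ∀ i k, ∑ j, (tor D x (b i) (D (e j) x u) (b k) * S.Phi x ![b i, b j, b k, v] +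
      tor D x (b i) (b j) (b k) * S.Phi x ![b i, D (e j) x u, b k, v]) = 0 := fun j k ↦
    sum_skew_mul_add b hskew (isLinearMap_tor₂ D x _ _) (isLinearMap_alt4₂ (S.Phi x) _ _ _)
  have z₃ : ∀ i j, ∑ k, (tor D x (b i) (b j) (D (e k) x u) * S.Phi x ![b i, b j, b k, v] +
      tor D x (b i) (b j) (b k) * S.Phi x ![b i, b j, D (e k) x u, v]) = 0 := fun j k ↦
    sum_skew_mul_add b hskew (isLinearMap_tor₃ D x _ _) (isLinearMap_alt4₃ (S.Phi x) _ _ _)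
  have s₁ : ∑ i, ∑ j, ∑ k, (tor D x (D (e i) x u) (b j) (b k) * S.Phi x ![b i, b j, b k, v] +
      tor D x (b i) (b j) (b k) * S.Phi x ![D (e i) x u, b j, b k, v]) = 0 := by
    rw [Finset.sum_comm]
    refine Finset.sum_eq_zero fun j _ ↦ ?_
    rw [Finset.sum_comm]
    exact Finset.sum_eq_zero fun k _ ↦ z₁ j k
  have s₂ : ∑ i, ∑ j, ∑ k, (tor D x (b i) (D (e j) x u) (b k) * S.Phi x ![b i, b j, b k, v] +
      tor D x (b i) (b j) (b k) * S.Phi x ![b i, D (e j) x u, b k, v]) = 0 := by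
    refine Finset.sum_eq_zero fun i _ ↦ ?_
    rw [Finset.sum_comm]
    exact Finset.sum_eq_zero fun k _ ↦ z₂ i k
  have s₃ : ∑ i, ∑ j, ∑ k, (tor D x (b i) (b j) (D (e k) x u) * S.Phi x ![b i, b j, b k, v] +
      tor D x (b i) (b j) (b k) * S.Phi x ![b i, b j, D (e k) x u, v]) = 0 :=
    Finset.sum_eq_zero fun i _ ↦ Finset.sum_eq_zero fun j _ ↦ z₃ i j
  have hN : ∑ i, ∑ j, ∑ k, nablaTorsion D x u (onb x i) (onb x j) (onb x k) *
        S.Phi x ![onb x i, onb x j, onb x k, v] =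
      ∑ i, ∑ j, ∑ k, nablaTorsion D x u (b i) (b j) (b k) * S.Phi x ![b i, b j, b k, v] :=
    sum_onb_mul₃ (onb x) b (g := fun i j k ↦ nablaTorsion D x u i j k)
      (h := fun i j k ↦ S.Phi x ![i, j, k, v])
      (fun _ _ ↦ hD.isLinearMap_nablaTorsion₂ x u _ _)
      (fun _ _ ↦ hD.isLinearMap_nablaTorsion₃ x u _ _)
      (fun _ _ ↦ hD.isLinearMap_nablaTorsion₄ x u _ _)
      (fun _ _ ↦ isLinearMap_alt4₁ (S.Phi x) _ _ _) (fun _ _ ↦ isLinearMap_alt4₂ (S.Phi x) _ _ _)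
      (fun _ _ ↦ isLinearMap_alt4₃ (S.Phi x) _ _ _)
  have hl : S.lee x ![D (extV v) x u] = -(1 / 7) * ∑ i, ∑ j, ∑ k,
      tor D x (b i) (b j) (b k) * S.Phi x ![b i, b j, b k, D (extV v) x u] := by
    rw [hD.lee_eq, sum_tor_mul_Phi x (onb x) b]
    rfl
  have hsum : ∑ i, ∑ j, ∑ k, (mvfderiv I8 (fun y ↦ tor D y (e i y) (e j y) (e k y)) x u *
        S.Phi x ![e i x, e j x, e k x, v] + tor D x (e i x) (e j x) (e k x) *
        mvfderiv I8 (fun y ↦ S.Phi y ![e i y, e j y, e k y, extV v y]) x u) =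
      ∑ i, ∑ j, ∑ k, nablaTorsion D x u (b i) (b j) (b k) * S.Phi x ![b i, b j, b k, v] +
      ∑ i, ∑ j, ∑ k, (tor D x (D (e i) x u) (b j) (b k) * S.Phi x ![b i, b j, b k, v] +
        tor D x (b i) (b j) (b k) * S.Phi x ![D (e i) x u, b j, b k, v]) +
      ∑ i, ∑ j, ∑ k, (tor D x (b i) (D (e j) x u) (b k) * S.Phi x ![b i, b j, b k, v] +
        tor D x (b i) (b j) (b k) * S.Phi x ![b i, D (e j) x u, b k, v]) +
      ∑ i, ∑ j, ∑ k, (tor D x (b i) (b j) (D (e k) x u) * S.Phi x ![b i, b j, b k, v] +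
        tor D x (b i) (b j) (b k) * S.Phi x ![b i, b j, D (e k) x u, v]) +
      ∑ i, ∑ j, ∑ k, tor D x (b i) (b j) (b k) * S.Phi x ![b i, b j, b k, D (extV v) x u] := by
    simp only [← Finset.sum_add_distrib]
    refine Finset.sum_congr rfl fun i _ ↦ Finset.sum_congr rfl fun j _ ↦
      Finset.sum_congr rfl fun k _ ↦ ?_
    rw [hD.mvfderiv_tor (hd i) (hd j) (hd k), hD.mvfderiv_Phi (hd i) (hd j) (hd k) hv, extV_self,
      hb, hb, hb]
    ring
  rw [nablaForm, h1, hsum, s₁, s₂, s₃, hl, hN]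
  ring

end IsTorsionConnection

end Structure

end LeeDerivative

/-! ### Bilinear forms and their components -/

section Bilinear

variable {V : Type*} [NormedAddCommGroup V] [InnerProductSpace ℝ V]

/-- A function of two vectors which is linear in each of them. -/
structure IsBilin (f : V → V → ℝ) : Prop where
  left : ∀ v, IsLinearMap ℝ fun u ↦ f u v
  right : ∀ u, IsLinearMap ℝ fun v ↦ f u v

namespace IsBilin

variable {f g : V → V → ℝ}

theorem mul {f g : V → ℝ} (hf : IsLinearMap ℝ f) (hg : IsLinearMap ℝ g) :
    IsBilin fun u v ↦ f u * g v :=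
  ⟨fun v ↦ ⟨fun u u' ↦ by rw [hf.map_add, add_mul],
    fun c u ↦ by rw [hf.map_smul, smul_eq_mul, smul_eq_mul, mul_assoc]⟩,
    fun u ↦ ⟨fun v v' ↦ by rw [hg.map_add, mul_add],
    fun c v ↦ by rw [hg.map_smul, smul_eq_mul, smul_eq_mul, mul_left_comm]⟩⟩

theorem const_mul (c : ℝ) (hf : IsBilin f) : IsBilin fun u v ↦ c * f u v :=
  ⟨fun v ↦ ⟨fun u u' ↦ by rw [(hf.left v).map_add, mul_add],
    fun a u ↦ by rw [(hf.left v).map_smul, smul_eq_mul, smul_eq_mul, mul_left_comm]⟩,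
    fun u ↦ ⟨fun v v' ↦ by rw [(hf.right u).map_add, mul_add],
    fun a v ↦ by rw [(hf.right u).map_smul, smul_eq_mul, smul_eq_mul, mul_left_comm]⟩⟩

theorem add (hf : IsBilin f) (hg : IsBilin g) : IsBilin fun u v ↦ f u v + g u v :=
  ⟨fun v ↦ ⟨fun u u' ↦ by rw [(hf.left v).map_add, (hg.left v).map_add, add_add_add_comm],
    fun c u ↦ by rw [(hf.left v).map_smul, (hg.left v).map_smul, smul_add]⟩,
    fun u ↦ ⟨fun v v' ↦ by rw [(hf.right u).map_add, (hg.right u).map_add, add_add_add_comm],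
    fun c v ↦ by rw [(hf.right u).map_smul, (hg.right u).map_smul, smul_add]⟩⟩

theorem sub (hf : IsBilin f) (hg : IsBilin g) : IsBilin fun u v ↦ f u v - g u v := by
  simpa only [neg_one_mul, ← sub_eq_add_neg] using hf.add (hg.const_mul (-1))

theorem flip (hf : IsBilin f) : IsBilin fun u v ↦ f v u := ⟨hf.right, hf.left⟩

theorem sum {ι : Type*} [Fintype ι] {f : ι → V → V → ℝ} (hf : ∀ i, IsBilin (f i)) :
    IsBilin fun u v ↦ ∑ i, f i u v :=
  ⟨fun v ↦ ⟨fun u u' ↦ by simp only [((hf _).left v).map_add, Finset.sum_add_distrib],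
    fun c u ↦ by simp only [((hf _).left v).map_smul, Finset.smul_sum]⟩,
    fun u ↦ ⟨fun v v' ↦ by simp only [((hf _).right u).map_add, Finset.sum_add_distrib],
    fun c v ↦ by simp only [((hf _).right u).map_smul, Finset.smul_sum]⟩⟩

theorem ext_onb (b : OrthonormalBasis (Fin 8) ℝ V) (hf : IsBilin f) (hg : IsBilin g)
    (h : ∀ i j, f (b i) (b j) = g (b i) (b j)) (u v : V) : f u v = g u v := by
  rw [← sum_inner_mul_onb b (hf.left v) u, ← sum_inner_mul_onb b (hg.left v) u]
  refine Finset.sum_congr rfl fun i _ ↦ ?_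
  rw [← sum_inner_mul_onb b (hf.right (b i)) v, ← sum_inner_mul_onb b (hg.right (b i)) v]
  simp only [h]

/-- A skew-symmetric bilinear form as a continuous alternating map. -/
theorem exists_alternating (b : OrthonormalBasis (Fin 8) ℝ V) (hf : IsBilin f)
    (h : ∀ u v, f v u = -f u v) : ∃ β : V [⋀^Fin 2]→L[ℝ] ℝ, ∀ v, β v = f (v 0) (v 1) := by
  refine ⟨{ toFun := fun v ↦ f (v 0) (v 1)
            map_update_add' := ?_
            map_update_smul' := ?_
            cont := ?_
            map_eq_zero_of_eq' := ?_ }, fun v ↦ rfl⟩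
  · intro _ v i x y
    fin_cases i
    · simpa using (hf.left (v 1)).map_add x y
    · simpa using (hf.right (v 0)).map_add x y
  · intro _ v i c x
    fin_cases i
    · simpa using (hf.left (v 1)).map_smul c x
    · simpa using (hf.right (v 0)).map_smul c x
  · have e : (fun v : Fin 2 → V ↦ f (v 0) (v 1)) = fun v ↦ ∑ i, inner ℝ (b i) (v 0) *
        ∑ j, inner ℝ (b j) (v 1) * f (b i) (b j) := by
      funext v
      rw [← sum_inner_mul_onb b (hf.left (v 1)) (v 0)]
      refine Finset.sum_congr rfl fun i _ ↦ ?_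
      rw [sum_inner_mul_onb b (hf.right (b i)) (v 1)]
    change Continuous fun v : Fin 2 → V ↦ f (v 0) (v 1)
    rw [e]
    fun_prop
  · intro v i j hij hne
    have h01 : v 0 = v 1 := by
      fin_cases i <;> fin_cases j
      · exact absurd rfl hne
      · exact hij
      · exact hij.symm
      · exact absurd rfl hne
    change f (v 0) (v 1) = 0
    have := h (v 0) (v 1)
    rw [h01] at this ⊢
    linarith

end IsBilin

end Bilinear

/-! ### The skew part of the Ricci tensor -/

section Ricci

variable {M : Type*} [TopologicalSpace M] [ChartedSpace E8 M] [IsManifold I8 ∞ M]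
  [RiemannianBundle (fun x : M => TangentSpace I8 x)]

/-- The components of the covariant derivative of the torsion. -/
def nablaTorsionArray (D : Connection M) (x : M) (a i j k : Fin 8) : ℝ :=
  nablaTorsion D x (onb x a) (onb x i) (onb x j) (onb x k)

/-- The components of the curvature. -/
def curvatureArray (D : Connection M) (x : M) (i j k l : Fin 8) : ℝ :=
  inner ℝ (curvature D x (onb x i) (onb x j) (onb x k)) (onb x l)

theorem sum_tor_mul_tor (D : Connection M) (x : M) (u v w z : TM x) :
    ∑ s, tor D x u v (onb x s) * tor D x (onb x s) w z = tor D x (D.torsion x u v) w z := by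
  rw [← sum_inner_mul_onb (onb x) (isLinearMap_tor₁ D x w z)]
  refine Finset.sum_congr rfl fun s _ ↦ ?_
  rw [tor, real_inner_comm]

variable [IsContMDiffRiemannianBundle I8 ∞ E8 (fun x : M => TangentSpace I8 x)]
  {S : Structure M} {D : Connection M}

namespace Structure.IsTorsionConnection

theorem tor_self (hD : S.IsTorsionConnection D) (x : M) (u v : TM x) : tor D x u v v = 0 := by
  linarith [hD.tor_swap₂ x u v v]

theorem nablaTorsion_self (hD : S.IsTorsionConnection D) (x : M) (u v w : TM x) :
    nablaTorsion D x u v w w = 0 := by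
  linarith [hD.nablaTorsion_swap₂ x u v w w]

theorem nablaTorsion_cyc (hD : S.IsTorsionConnection D) (x : M) (u v w z : TM x) :
    nablaTorsion D x u w z v = nablaTorsion D x u v w z := by
  rw [hD.nablaTorsion_swap₂, hD.nablaTorsion_swap₁, neg_neg]

/-- The skew-symmetric part of the Ricci tensor is the divergence of the torsion. -/
theorem ricci_sub_ricci [T2Space M] (hD : S.IsTorsionConnection D) (x : M) (u v : TM x) :
    ricci D x u v - ricci D x v u = ∑ a, nablaTorsion D x (onb x a) (onb x a) u v := by
  set b := onb x with hb
  have key : ∀ a, inner ℝ (curvature D x (b a) u v) (b a) - inner ℝ (curvature D x (b a) v u) (b a)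
      = nablaTorsion D x (b a) (b a) u v + (tor D x (D.torsion x (b a) u) v (b a) +
        tor D x (D.torsion x v (b a)) u (b a)) := by
    intro a
    have h := hD.bianchi (b a) u v (b a)
    have h1 : inner ℝ (curvature D x u v (b a)) (b a) = 0 := by
      linarith [hD.curvature_skew u v (b a) (b a)]
    have h2 : nablaTorsion D x v (b a) u (b a) = 0 := by
      rw [hD.nablaTorsion_swap₁, hD.nablaTorsion_self, neg_zero]
    rw [curvature_swap D (b a) v u, inner_neg_left, h1, hD.nablaTorsion_self, h2, hD.tor_self,
      hD.nablaTorsion_cyc] at h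
    linarith
  -- Exchanging the two summed indices shows that the quadratic torsion traces cancel.
  have hT : ∑ a, tor D x (D.torsion x v (b a)) u (b a) =
      -∑ a, tor D x (D.torsion x (b a) u) v (b a) := by
    simp only [← sum_tor_mul_tor]
    rw [Finset.sum_comm, ← Finset.sum_neg_distrib]
    refine Finset.sum_congr rfl fun a _ ↦ ?_
    rw [← Finset.sum_neg_distrib]
    refine Finset.sum_congr rfl fun s _ ↦ ?_
    rw [tor_swap₁ D x (b s) v (b a)]
    ring
  rw [ricci, ricci, ← Finset.sum_sub_distrib]
  simp only [← hb, key, Finset.sum_add_distrib, hT]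
  ring

theorem isCurvatureArray [T2Space M] (hD : S.IsTorsionConnection D) (x : M) :
    IsCurvatureArray (S.phiArray x) (torArray D x) (nablaTorsionArray D x)
      (curvatureArray D x) where
  spin := S.isSpinArray_phiArray x
  alt := hD.isAlt3_torArray x
  altN a := ⟨fun _ _ _ ↦ hD.nablaTorsion_swap₁ x _ _ _ _,
    fun _ _ _ ↦ hD.nablaTorsion_swap₂ x _ _ _ _⟩
  swap₁ a b c d := by
    rw [curvatureArray, curvature_swap, inner_neg_left, curvatureArray]
  swap₂ a b c d := hD.curvature_skew _ _ _ _
  stab a b i j k l := by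
    have h := hD.curvature_stabilizes (onb x a) (onb x b) ![onb x i, onb x j, onb x k, onb x l]
    have e₁ := sum_inner_mul_onb (onb x) (isLinearMap_alt4₁ (S.Phi x) (onb x j) (onb x k) (onb x l))
      (curvature D x (onb x a) (onb x b) (onb x i))
    have e₂ := sum_inner_mul_onb (onb x) (isLinearMap_alt4₂ (S.Phi x) (onb x i) (onb x k) (onb x l))
      (curvature D x (onb x a) (onb x b) (onb x j))
    have e₃ := sum_inner_mul_onb (onb x) (isLinearMap_alt4₃ (S.Phi x) (onb x i) (onb x j) (onb x l))
      (curvature D x (onb x a) (onb x b) (onb x k))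
    have e₄ := sum_inner_mul_onb (onb x) (isLinearMap_alt4₄ (S.Phi x) (onb x i) (onb x j) (onb x k))
      (curvature D x (onb x a) (onb x b) (onb x l))
    have hs : ∑ m, S.Phi x (Function.update ![onb x i, onb x j, onb x k, onb x l] m
        (curvature D x (onb x a) (onb x b) (![onb x i, onb x j, onb x k, onb x l] m))) =
        S.Phi x ![curvature D x (onb x a) (onb x b) (onb x i), onb x j, onb x k, onb x l] +
        S.Phi x ![onb x i, curvature D x (onb x a) (onb x b) (onb x j), onb x k, onb x l] +
        S.Phi x ![onb x i, onb x j, curvature D x (onb x a) (onb x b) (onb x k), onb x l] +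
        S.Phi x ![onb x i, onb x j, onb x k, curvature D x (onb x a) (onb x b) (onb x l)] := by
      rw [Fin.sum_univ_four]
      congr 1
      congr 1
      congr 1
      all_goals
        congr 1
        ext a; fin_cases a <;> rfl
    rw [hs, ← e₁, ← e₂, ← e₃, ← e₄] at h
    simp only [curvatureArray, phiArray, Finset.sum_add_distrib]
    simp only [real_inner_comm (onb x _)] at h ⊢
    exact h
  bianchi a b c d := by
    have h := hD.bianchi (onb x a) (onb x b) (onb x c) (onb x d)
    simp only [← sum_tor_mul_tor, ← Finset.sum_add_distrib] at h
    exact h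

end Structure.IsTorsionConnection

end Ricci

/-! ### The 2-forms built from the Lee form, and the equivalences -/

section LeeTwoForms

variable {M : Type*} [TopologicalSpace M] [ChartedSpace E8 M] [IsManifold I8 ∞ M]
  [RiemannianBundle (fun x : M => TangentSpace I8 x)]

theorem isBilin_tor (D : Connection M) (x : M) (u : TM x) :
    IsBilin fun v w ↦ tor D x u v w :=
  ⟨fun w ↦ isLinearMap_tor₂ D x u w, fun v ↦ isLinearMap_tor₃ D x u v⟩

namespace Structure

theorem isBilin_Phi (S : Structure M) (x : M) (u v : TM x) :
    IsBilin fun w z ↦ S.Phi x ![u, v, w, z] :=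
  ⟨fun z ↦ isLinearMap_alt4₃ (S.Phi x) u v z, fun w ↦ isLinearMap_alt4₄ (S.Phi x) u v w⟩

theorem isBilin_contrPhi (S : Structure M) (β : Field 2 M) (x : M) :
    IsBilin fun u v ↦ S.contrPhi β x ![u, v] :=
  IsBilin.sum fun _ ↦ IsBilin.sum fun _ ↦ (S.isBilin_Phi x _ _).const_mul _

theorem contrPhi_onb (S : Structure M) (β : Field 2 M) (x : M) (i j : Fin 8) :
    S.contrPhi β x ![onb x i, onb x j] =
      opPhi (S.phiArray x) (fun a c ↦ β x ![onb x a, onb x c]) i j := rfl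

/-- `*(β ∧ Φ)` in terms of the contraction of `β` with `Φ`. -/
theorem star_wedge_phi (S : Structure M) (β : Field 2 M) (x : M) (v : Fin 2 → TM x) :
    S.star (k := 2 + 4) (m := 2) (by norm_num) (wedge β S.phi) x v =
      1 / 2 * S.contrPhi β x v := by
  obtain ⟨e, he⟩ := S.exists_isAdapted x
  set b := onb x with hb
  set A : (Fin (2 + 4) → Fin 8) → ℝ := fun I ↦
    S.vol x (fun a ↦ Fin.append (frame x I) v (Fin.cast (by norm_num) a)) with hAdef
  have hA : ∀ (σ : Equiv.Perm (Fin (2 + 4))) I,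
      A (I ∘ σ) = ((Equiv.Perm.sign σ : ℤ) : ℝ) * A I :=
    fun σ I ↦ alternating_append_perm (by norm_num) (S.vol x) (frame x I) v σ
  set H : (Fin (2 + 4) → Fin 8) → ℝ := fun I ↦ β x (fun a ↦ b (I (Fin.castAdd 4 a))) *
    S.Phi x (fun c ↦ b (I (Fin.natAdd 2 c))) with hH
  -- All 720 permutations contribute equally, and 48 = 2! · 4!. The 720 cancels the 6! of the star,
  -- and 24/48 is the final 1/2.
  have h1 : ∑ I, wedge β S.phi x (frame x I) * A I = 1 / 48 * (720 * ∑ I, H I * A I) := by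
    have e1 : ∀ I, wedge β S.phi x (frame x I) * A I = 1 / 48 *
        ∑ σ : Equiv.Perm (Fin (2 + 4)), ((Equiv.Perm.sign σ : ℤ) : ℝ) * H (I ∘ σ) * A I := by
      intro I
      have hc : (1 / ((2 ! : ℝ) * (4 ! : ℝ))) = 1 / 48 := by norm_num [Nat.factorial]
      rw [wedge, hc, mul_assoc, Finset.sum_mul]
      congr 1
      refine Finset.sum_congr rfl fun σ _ ↦ ?_
      rw [mul_assoc ((Equiv.Perm.sign σ : ℤ) : ℝ)]
      rfl
    simp only [e1]
    rw [← Finset.mul_sum, Finset.sum_comm]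
    simp only [sum_sign_mul_comp_perm hA, Finset.sum_const, Finset.card_univ,
      Fintype.card_perm, Fintype.card_fin, nsmul_eq_mul]
    norm_num [Nat.factorial]
  have h2 : ∑ I, H I * A I = 24 * S.contrPhi β x v := by
    have e1 : ∑ I, H I * A I = ∑ p, ∑ q, β x ![b p, b q] * ∑ i, ∑ j, ∑ k, ∑ l,
        S.Phi x ![b i, b j, b k, b l] * S.vol x ![b i, b j, b k, b l, b p, b q, v 0, v 1] := by
      simp only [sum_fin_succ_fun, sum_fin_zero_fun, Finset.mul_sum]
      refine Finset.sum_congr rfl fun p _ ↦ Finset.sum_congr rfl fun q _ ↦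
        Finset.sum_congr rfl fun i _ ↦ Finset.sum_congr rfl fun j _ ↦
        Finset.sum_congr rfl fun k _ ↦ Finset.sum_congr rfl fun l _ ↦ ?_
      have a1 : A ![p, q, i, j, k, l] = S.vol x ![b p, b q, b i, b j, b k, b l, v 0, v 1] := by
        rw [hAdef]
        dsimp only
        congr 1
        ext a; fin_cases a <;> rfl
      have a2 : ![b i, b j, b k, b l, b p, b q, v 0, v 1] =
          ![b p, b q, b i, b j, b k, b l, v 0, v 1] ∘
            (Fin.cycleRange 5 * Fin.cycleRange 5 : Equiv.Perm (Fin 8)) := by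
        ext a; fin_cases a <;> rfl
      have a3 : S.vol x ![b i, b j, b k, b l, b p, b q, v 0, v 1] =
          S.vol x ![b p, b q, b i, b j, b k, b l, v 0, v 1] := by
        rw [a2, alternating_perm, Equiv.Perm.sign_mul, Fin.sign_cycleRange]
        norm_num
      have a4 : H ![p, q, i, j, k, l] = β x ![b p, b q] * S.Phi x ![b i, b j, b k, b l] := by
        rw [hH]
        dsimp only
        congr 2
        · ext a; fin_cases a <;> rfl
        · ext a; fin_cases a <;> rfl
      rw [a3, ← a1, ← mul_assoc, ← a4]
    rw [e1, contrPhi, Finset.mul_sum]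
    refine Finset.sum_congr rfl fun p _ ↦ ?_
    rw [Finset.mul_sum]
    refine Finset.sum_congr rfl fun q _ ↦ ?_
    rw [he.star_phi, phi]
    ring
  have h3 : ((2 + 4)! : ℝ) = 720 := by norm_num [Nat.factorial]
  change 1 / ((2 + 4)! : ℝ) * ∑ I, wedge β S.phi x (frame x I) * A I = _
  rw [h1, h2, h3]
  ring

theorem isBilin_leeContr_torsionForm (S : Structure M) (D : Connection M) (x : M) :
    IsBilin fun u v ↦ S.leeContr (torsionForm D) x ![u, v] :=
  IsBilin.sum fun _ ↦ (isBilin_tor D x _).const_mul _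

variable [IsContMDiffRiemannianBundle I8 ∞ E8 (fun x : M => TangentSpace I8 x)]
  {S : Structure M} {D : Connection M}

namespace IsTorsionConnection

theorem isBilin_leeContr_deltaPhi (hD : S.IsTorsionConnection D) (x : M) :
    IsBilin fun u v ↦ S.leeContr S.deltaPhi x ![u, v] := by
  have h : ∀ s u v, S.deltaPhi x ![onb x s, u, v] = 1 / 2 * ∑ a, ∑ c,
      (tor D x (onb x a) (onb x c) (onb x s) * S.Phi x ![onb x a, onb x c, u, v]
        - tor D x (onb x a) (onb x c) u * S.Phi x ![onb x a, onb x c, onb x s, v]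
        + tor D x (onb x a) (onb x c) v * S.Phi x ![onb x a, onb x c, onb x s, u]) :=
    fun s u v ↦ hD.deltaPhi_eq x _
  change IsBilin fun u v ↦ ∑ s, S.lee x ![onb x s] * S.deltaPhi x ![onb x s, u, v]
  simp only [h]
  exact IsBilin.sum fun _ ↦ IsBilin.const_mul _ <| IsBilin.const_mul _ <| IsBilin.sum fun _ ↦
    IsBilin.sum fun _ ↦ IsBilin.add (IsBilin.sub ((S.isBilin_Phi x _ _).const_mul _)
      (IsBilin.mul (isLinearMap_tor₃ D x _ _) (isLinearMap_alt4₄ (S.Phi x) _ _ _)))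
      (IsBilin.flip (IsBilin.mul (isLinearMap_tor₃ D x _ _) (isLinearMap_alt4₄ (S.Phi x) _ _ _)))

theorem lee_onb (hD : S.IsTorsionConnection D) (x : M) (s : Fin 8) :
    S.lee x ![onb x s] = -(1 / 7) * contr₃ (S.phiArray x) (torArray D x) s :=
  hD.lee_eq x _

theorem leeContr_torsionForm_onb (hD : S.IsTorsionConnection D) (x : M) (i j : Fin 8) :
    S.leeContr (torsionForm D) x ![onb x i, onb x j] =
      -(1 / 7) * tauT (S.phiArray x) (torArray D x) i j := by
  rw [leeContr, tauT, Finset.mul_sum]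
  refine Finset.sum_congr rfl fun s _ ↦ ?_
  rw [hD.lee_onb, mul_assoc]
  rfl

/-- δΦ - T is (1/6) τ_t Φ_{t···}, and θ is a multiple of τ, so the difference contracts to τ_s τ_t
Φ_{ts··} = 0. Conditions (b) and (c) therefore have the same right-hand side. -/
theorem leeContr_deltaPhi (hD : S.IsTorsionConnection D) :
    S.leeContr S.deltaPhi = S.leeContr (torsionForm D) := by
  have hb : ∀ (x : M) (i j : Fin 8), S.leeContr S.deltaPhi x ![onb x i, onb x j] =
      S.leeContr (torsionForm D) x ![onb x i, onb x j] := by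
    intro x i j
    have hF := S.isSpinArray_phiArray x
    set F := S.phiArray x with hFdef
    set T := torArray D x with hTdef
    have h1 : ∀ s, S.deltaPhi x ![onb x s, onb x i, onb x j] =
        T s i j + 1 / 6 * ∑ t, contr₃ F T t * F t s i j := by
      intro s
      have h := hF.contr₂_cyc (hD.isAlt3_torArray x) s i j
      rw [hD.deltaPhi_onb, ← hFdef, ← hTdef]
      linarith
    have h2 : ∑ s, contr₃ F T s * ∑ t, contr₃ F T t * F t s i j = 0 := by
      simp only [Finset.mul_sum]
      have h3 : ∑ s, ∑ t, contr₃ F T s * (contr₃ F T t * F t s i j) =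
          -∑ s, ∑ t, contr₃ F T s * (contr₃ F T t * F t s i j) := by
        conv_lhs => rw [Finset.sum_comm]
        simp only [← Finset.sum_neg_distrib]
        refine Finset.sum_congr rfl fun s _ ↦ Finset.sum_congr rfl fun t _ ↦ ?_
        rw [hF.swap₁ t s]
        ring
      linarith
    have h4 : S.leeContr S.deltaPhi x ![onb x i, onb x j] = -(1 / 7) * tauT F T i j +
        -(1 / 42) * ∑ s, contr₃ F T s * ∑ t, contr₃ F T t * F t s i j := by
      rw [leeContr, tauT, Finset.mul_sum, Finset.mul_sum, ← Finset.sum_add_distrib]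
      refine Finset.sum_congr rfl fun s _ ↦ ?_
      have h5 := h1 s
      change S.lee x ![onb x s] * S.deltaPhi x ![onb x s, onb x i, onb x j] = _
      rw [h5, hD.lee_onb]
      ring
    rw [h4, h2, hD.leeContr_torsionForm_onb, mul_zero, add_zero]
  funext x v
  exact IsBilin.ext_onb (onb x) (hD.isBilin_leeContr_deltaPhi x)
    (isBilin_leeContr_torsionForm S D x) (hb x) (v 0) (v 1)

theorem tauT_swap (hD : S.IsTorsionConnection D) (x : M) (i j : Fin 8) :
    tauT (S.phiArray x) (torArray D x) j i = -tauT (S.phiArray x) (torArray D x) i j := by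
  rw [tauT, tauT, ← Finset.sum_neg_distrib]
  refine Finset.sum_congr rfl fun s _ ↦ ?_
  rw [(hD.isAlt3_torArray x).swap₂ s i j, mul_neg]

variable [T2Space M]

theorem isBilin_nablaForm_lee (hD : S.IsTorsionConnection D) (x : M) :
    IsBilin fun u v ↦ nablaForm D S.lee x u v := by
  simp only [hD.nablaForm_lee]
  exact IsBilin.const_mul _ <| IsBilin.sum fun _ ↦ IsBilin.sum fun _ ↦ IsBilin.sum fun _ ↦
    IsBilin.mul (isLinearMap_nablaTorsion₁ D x _ _ _) (isLinearMap_alt4₄ (S.Phi x) _ _ _)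

theorem isBilin_dNabla_lee (hD : S.IsTorsionConnection D) (x : M) :
    IsBilin fun u v ↦ dNabla D S.lee x ![u, v] :=
  (hD.isBilin_nablaForm_lee x).sub (hD.isBilin_nablaForm_lee x).flip

theorem dNabla_lee_onb (hD : S.IsTorsionConnection D) (x : M) (i j : Fin 8) :
    dNabla D S.lee x ![onb x i, onb x j] =
      -(1 / 7) * (divP (S.phiArray x) (nablaTorsionArray D x) i j -
        divP (S.phiArray x) (nablaTorsionArray D x) j i) := by
  change nablaForm D S.lee x (onb x i) (onb x j) - nablaForm D S.lee x (onb x j) (onb x i) = _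
  rw [hD.nablaForm_lee, hD.nablaForm_lee, mul_sub]
  rfl

theorem isBilin_divergence (hD : S.IsTorsionConnection D) (x : M) :
    IsBilin fun u v ↦ ∑ a, nablaTorsion D x (onb x a) (onb x a) u v :=
  IsBilin.sum fun _ ↦ ⟨fun _ ↦ hD.isLinearMap_nablaTorsion₃ x _ _ _,
    fun _ ↦ hD.isLinearMap_nablaTorsion₄ x _ _ _⟩

theorem ricci_symm_iff_divV_eq_zero (hD : S.IsTorsionConnection D) (x : M) :
    (∀ u v, ricci D x u v = ricci D x v u) ↔ ∀ i j, divV (nablaTorsionArray D x) i j = 0 := by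
  constructor
  · intro h i j
    have h1 := hD.ricci_sub_ricci x (onb x i) (onb x j)
    rw [h, sub_self] at h1
    exact h1.symm
  · intro h u v
    have h1 := hD.ricci_sub_ricci x u v
    have h2 := (hD.isBilin_divergence x).ext_onb (onb x) ((hD.isBilin_divergence x).const_mul 0)
      (fun i j ↦ (h i j).trans (zero_mul _).symm) u v
    rw [h2, zero_mul] at h1
    exact sub_eq_zero.1 h1

/-- Every term is linear in the outer θ = -τ/7 or in its derivative, so the factor -1/7 cancels
throughout. -/
theorem dNabla_lee_eq_iff (hD : S.IsTorsionConnection D) (x : M) :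
    (∀ v, dNabla D S.lee x v = -(1 / 3 : ℝ) * S.leeContr (torsionForm D) x v +
      (1 / 6 : ℝ) * S.contrPhi (S.leeContr (torsionForm D)) x v) ↔
    ∀ i j, divP (S.phiArray x) (nablaTorsionArray D x) i j -
        divP (S.phiArray x) (nablaTorsionArray D x) j i =
      -(1 / 3) * tauT (S.phiArray x) (torArray D x) i j +
        1 / 6 * opPhi (S.phiArray x) (tauT (S.phiArray x) (torArray D x)) i j := by
  have hc : ∀ i j, S.contrPhi (S.leeContr (torsionForm D)) x ![onb x i, onb x j] =
      -(1 / 7) * opPhi (S.phiArray x) (tauT (S.phiArray x) (torArray D x)) i j := by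
    intro i j
    rw [contrPhi_onb, opPhi, opPhi]
    simp only [hD.leeContr_torsionForm_onb, mul_assoc, ← Finset.mul_sum]
  constructor
  · intro h i j
    have h1 := h ![onb x i, onb x j]
    rw [hD.dNabla_lee_onb, hD.leeContr_torsionForm_onb, hc] at h1
    linarith
  · intro h v
    refine IsBilin.ext_onb (onb x) (hD.isBilin_dNabla_lee x)
      (((isBilin_leeContr_torsionForm S D x).const_mul _).add
        ((S.isBilin_contrPhi _ x).const_mul _)) (fun i j ↦ ?_) (v 0) (v 1)
    rw [hD.dNabla_lee_onb, hD.leeContr_torsionForm_onb, hc, h i j]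
    ring

/-- At every point, the Ricci tensor is symmetric if and only if `d^∇θ` is the given expression in
the Lee form and the torsion. -/
theorem ricci_symm_iff (hD : S.IsTorsionConnection D) (x : M) :
    (∀ u v, ricci D x u v = ricci D x v u) ↔
      ∀ v, dNabla D S.lee x v = -(1 / 3 : ℝ) * S.leeContr (torsionForm D) x v +
        (1 / 6 : ℝ) * S.contrPhi (S.leeContr (torsionForm D)) x v := by
  rw [hD.ricci_symm_iff_divV_eq_zero, hD.dNabla_lee_eq_iff]
  refine (S.isSpinArray_phiArray x).eq_zero_iff (V := divV (nablaTorsionArray D x))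
    (fun i j ↦ ?_) (fun i j ↦ (neg_sub _ _).symm) (fun i j ↦ hD.tauT_swap x i j) (fun i j ↦
      (hD.isCurvatureArray x).divV_relation (fun u v ↦ hD.ricci_sub_ricci x _ _) i j)
  rw [divV, divV, ← Finset.sum_neg_distrib]
  exact Finset.sum_congr rfl fun a _ ↦ hD.nablaTorsion_swap₂ x _ _ _ _

theorem dNabla_lee_eq_contrPhi (hD : S.IsTorsionConnection D) (x : M)
    (h : ∀ u v, ricci D x u v = ricci D x v u) (v : Fin 2 → TM x) :
    dNabla D S.lee x v = -(1 / 6 : ℝ) * S.contrPhi (dNabla D S.lee) x v := by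
  rw [hD.ricci_symm_iff, hD.dNabla_lee_eq_iff] at h
  refine IsBilin.ext_onb (onb x) (hD.isBilin_dNabla_lee x)
    ((S.isBilin_contrPhi _ x).const_mul _) (fun i j ↦ ?_) (v 0) (v 1)
  have h1 := (S.isSpinArray_phiArray x).eq_neg_opPhi (W := fun i j ↦
    divP (S.phiArray x) (nablaTorsionArray D x) i j -
      divP (S.phiArray x) (nablaTorsionArray D x) j i) (hD.tauT_swap x) h i j
  rw [contrPhi_onb, opPhi]
  simp only [hD.dNabla_lee_onb, mul_assoc, ← Finset.mul_sum]
  rw [opPhi] at h1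
  linarith

theorem memLambda27_dNabla_lee (hD : S.IsTorsionConnection D)
    (h : ∀ (x : M) (u v : TM x), ricci D x u v = ricci D x v u) :
    S.MemLambda27 (dNabla D S.lee) := by
  refine ⟨fun x ↦ ?_, fun x v ↦ ?_⟩
  · obtain ⟨β, hβ⟩ := (hD.isBilin_dNabla_lee x).exists_alternating (onb x)
      fun u v ↦ (neg_sub _ _).symm
    exact ⟨β, funext fun v ↦ (hβ v).symm⟩
  -- The star is half the contraction with Φ, which is -6 on d^∇θ, so the eigenvalue is -3.
  · rw [S.star_wedge_phi]
    linarith [hD.dNabla_lee_eq_contrPhi x (h x) v]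

end IsTorsionConnection

end Structure

end LeeTwoForms

end Spin7

end

/-- On a `Spin(7)`-manifold, with Lee form `θ`, `Spin(7)`-torsion connection `∇` and torsion `T`:
`Ric` is symmetric iff
`(d^∇θ)_{ij} = -(1/3) θ_s (δΦ)_{sij} + (1/6) θ_s (δΦ)_{sab} Φ_{abij}`, iff
`(d^∇θ)_{ij} = -(1/3) θ_s T_{sij} + (1/6) θ_s T_{sab} Φ_{abij}`; and then
`(d^∇θ)_{ij} = -(1/6) (d^∇θ)_{ab} Φ_{abij}` and `d^∇θ ∈ Λ²₇`. -/
theorem mainTheorem9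
    {M : Type*} [TopologicalSpace M] [T2Space M] [SecondCountableTopology M]
    [ChartedSpace Spin7.E8 M] [IsManifold Spin7.I8 ∞ M]
    [RiemannianBundle (fun x : M => TangentSpace Spin7.I8 x)]
    [IsContMDiffRiemannianBundle Spin7.I8 ∞ Spin7.E8 (fun x : M => TangentSpace Spin7.I8 x)]
    (S : Spin7.Structure M) (D : Spin7.Connection M) (hD : S.IsTorsionConnection D) :
    ((∀ (x : M) (u v : Spin7.TM x), Spin7.ricci D x u v = Spin7.ricci D x v u) ↔
      ∀ (x : M) (v : Fin 2 → Spin7.TM x),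
        Spin7.dNabla D S.lee x v =
          -(1 / 3 : ℝ) * S.leeContr S.deltaPhi x v +
            (1 / 6 : ℝ) * S.contrPhi (S.leeContr S.deltaPhi) x v) ∧
    ((∀ (x : M) (u v : Spin7.TM x), Spin7.ricci D x u v = Spin7.ricci D x v u) ↔
      ∀ (x : M) (v : Fin 2 → Spin7.TM x),
        Spin7.dNabla D S.lee x v =
          -(1 / 3 : ℝ) * S.leeContr (Spin7.torsionForm D) x v +
            (1 / 6 : ℝ) * S.contrPhi (S.leeContr (Spin7.torsionForm D)) x v) ∧
    ((∀ (x : M) (u v : Spin7.TM x), Spin7.ricci D x u v = Spin7.ricci D x v u) →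
      (∀ (x : M) (v : Fin 2 → Spin7.TM x),
        Spin7.dNabla D S.lee x v = -(1 / 6 : ℝ) * S.contrPhi (Spin7.dNabla D S.lee) x v) ∧
      S.MemLambda27 (Spin7.dNabla D S.lee)) := by
  refine ⟨?_, forall_congr' fun x ↦ hD.ricci_symm_iff x,
    fun h ↦ ⟨fun x v ↦ hD.dNabla_lee_eq_contrPhi x (h x) v, hD.memLambda27_dNabla_lee h⟩⟩
  rw [hD.leeContr_deltaPhi]
  exact forall_congr' fun x ↦ hD.ricci_symm_iff x
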